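/- **Conventions.** A multisorted structure $\mathbf M$ is a family of sets (sorts) with basic relations (operations and constants are given by their graphs); $\mathrm{Aut}(\mathbf M)$ is the group of families of permutations of the sorts preserving all basic relations. A relation is *definable* (without parameters) if it is $\mathrm{Aut}(\mathbf M)$-invariant. An *interpretation* of $\mathbf N$ in $\mathbf M$ is, for each sort of $\mathbf N$, a bijection onto $D/E$, where $D$ is a definable subset of a disjoint union of finite products of sorts of $\mathbf M$ and $E$ is a definable equivalence relation on $D$, such that the basic relations of $\mathbf N$ become definable in $\mathbf M$. It is a *bi-interpretation* ($\mathbf N\cong_{\mathfrak M}\mathbf M$) if every relation on the image of $\mathbf N$ definable in $\mathbf M$ is definable in $\mathbf N$, and every element of $\mathbf M$ is fixed by all automorphisms of $\mathbf M$ that fix some finite set of elements of the image of $\mathbf N$. Sorts interpreted in $\mathbf M$ "with induced relations" carry all relations definable in $\mathbf M$. **Setting.** Let $\mathrm k$ be a field of characteristic $0$, $F=\mathrm k^{alg}$, and $\mathbb X$ an integral, smooth, separated, geometrically connected $\mathrm k$-scheme of finite type with function field $\mathrm K$. Let $(\mu: Y_\mu\to\mathbb X)_{\mu\in\mathcal M}$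 represent all connected finite Galois étale covers of $\mathbb X$ up to isomorphism. Let $a_\mu$ generate the field of elements of $\Gamma(Y_\mu,\mathcal O)$ algebraic over $\mathrm k$, with minimal polynomial $\mathbf f_\mu$ over $\mathrm k$. For a zero $\alpha\in F$ of $\mathbf f_\mu$ let $\mathbb X_{\mu,\alpha}=Y_\mu\otimes_{\mathrm k[a_\mu],\,a_\mu\mapsto\alpha}F$, let $\mathrm{GDeck}(\mathbb X_{\mu,\alpha}/\mathbb X)$ be the group of automorphisms of this $F$-variety over $\mathbb X$, and let $\mathrm K_{\mu,\alpha}$ be the function field of $Y_\mu$, viewed as the field of $\mathrm k(\alpha)$-rational functions on $\mathbb X_{\mu,\alpha}$ with $a_\mu=\alpha$. Fix $b_\mu\in \mathrm K_{\mu,\alpha}$ with $\mathrm K_{\mu,\alpha}=\mathrm K(a_\mu,b_\mu)$. Fix a projective system of distinguished morphisms: whenever there is a morphism of covers $Y_\mu\to Y_\nu$ over $\mathbb X$ carrying $\mathbb X_{\mu,\alpha}$ to $\mathbb X_{\nu,\beta}$, one such morphism is distinguished; identities and composites of distinguished morphisms are distinguished. Put $$\mathbb U=\varprojlim \mathbb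 X_{\mu,\alpha}(F),\qquad \tilde{\mathrm K}=\varinjlim \mathrm K_{\mu,\alpha}$$ along the distinguished morphisms and the embeddings of function fields that they induce, and let $\mathbf p_{\mu,\alpha}:\mathbb U\to\mathbb X_{\mu,\alpha}(F)$ be the projections. Let $\tilde{\mathbf p}_{\mu,\alpha}=\{g\circ\mathbf p_{\mu,\alpha}: g\in\mathrm{GDeck}(\mathbb X_{\mu,\alpha}/\mathbb X)\}$ and $\tilde{\mathbf p}_\mu=\bigsqcup_\alpha\tilde{\mathbf p}_{\mu,\alpha}$. $\tilde{\mathbf X}^{et}(F)$ is the structure with sorts $\mathbb U$, $F$, $\tilde{\mathbf p}_\mu$, $\bigsqcup_\alpha\mathbb X_{\mu,\alpha}(F)$ and $\bigsqcup_\alpha\mathrm{GDeck}(\mathbb X_{\mu,\alpha}/\mathbb X)$ $(\mu\in\mathcal M)$, with the field operations on $F$, names for the elements of $\mathrm k$, the graphs of the regular functions on open subsets of $Y_\mu$ (as functions from points to $F$), the action of deck transformations on points and on $\tilde{\mathbf p}_{\mu,\alpha}$, the relation $p\in\tilde{\mathbf p}_{\mu,\alpha}$ between $p$ and $\alpha$,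 and the relation $p(u)=x$. $\tilde{\mathbf X}^{et}_{fin}(F)$ is obtained by removing the sort $\mathbb U$ and keeping all induced relations; $\tilde{\mathbf p}_{\mathbb X}$ consists of the sorts $\tilde{\mathbf p}_\mu$ with all induced relations. $\mathrm P_{\mu,\alpha}$ is the ring of formal terms $T(\alpha,p_1,\dots,p_N)$, with $T$ a polynomial over $\mathrm K$ and $p_i\in\tilde{\mathbf p}_{\mu,\alpha}$, modulo the terms for which the rational function $T(\alpha,b_\mu\circ p_1,\dots,b_\mu\circ p_N)$ vanishes. $\mathbf P_{\mathbb X}$ is the multisorted structure with sorts $\mathbf P_\mu=\bigsqcup_\alpha \mathrm P_{\mu,\alpha}$, interpreted in $\tilde{\mathbf X}^{et}(F)$ through formal terms, with all induced relations. $\tilde{\mathrm K}$ is regarded as a structure in the language of rings with names for the elements of $\mathrm K$. **Theorem.** 1. $\tilde{\mathrm K}$ is a field, and there are ring isomorphisms $i_{\mu,\alpha}:\mathrm P_{\mu,\alpha}\to\mathrm K_{\mu,\alpha}$ that are the identity on $\mathrm K$, send $\alpha$ to $a_\mu$ and $g\circ\mathbf p_{\mu,\alpha}$ to $b_\mu\circ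 g$, such that the resulting map $i_{\mathbb X}$ from the disjoint union of the sorts of $\mathbf P_{\mathbb X}$ onto $\tilde{\mathrm K}$ is an isomorphism of structures $\mathbf P_{\mathbb X}\cong_{i_{\mathbb X}}\tilde{\mathrm K}$: it exhibits $\tilde{\mathrm K}$ as a quotient sort of $\mathbf P_{\mathbb X}$, and this is a bi-interpretation. 2. The presentation by formal terms is a bi-interpretation $\mathbf P_{\mathbb X}\cong_{\mathfrak M}\tilde{\mathbf p}_{\mathbb X}$. 3. The presentation by formal terms is a bi-interpretation $\mathbf P_{\mathbb X}\cong_{\mathfrak M}\tilde{\mathbf X}^{et}_{fin}(F)$, and there is a group isomorphism $\mathrm{Aut}(\mathbf P_{\mathbb X})\cong\mathrm{Aut}(\tilde{\mathbf X}^{et}(F))$ which is induced by it: if $\tau$ corresponds to $\sigma$, then $\tau$ is the automorphism of $\mathbf P_{\mathbb X}$ induced, through the bi-interpretation, by the restriction of $\sigma$ to $\tilde{\mathbf X}^{et}_{fin}(F)$. -/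

import Mathlib

open CategoryTheory CategoryTheory.Limits AlgebraicGeometry
open scoped Polynomial

universe u

noncomputable section

/-! ## Multisorted structures, automorphisms, definability and interpretations -/

/-- A multisorted relational structure (operations and constants are given by their graphs). -/
structure MStr where
  /-- the sorts -/
  S : Type u
  /-- the universe of each sort -/
  carrier : S → Type u
  /-- names of the basic relations -/
  Rel : Type u
  /-- number of arguments of a basic relation -/
  len : Rel → ℕ
  /-- sorts of the arguments of a basic relation -/
  srt : ∀ r, Fin (len r) → S
  /-- interpretation of the basic relations -/
  rel : ∀ r, (∀ i, carrier (srt r i)) → Prop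

namespace MStr

/-- The automorphism group: families of permutations of the sorts preserving all basic relations. -/
def Aut (M : MStr.{u}) : Subgroup (∀ s, Equiv.Perm (M.carrier s)) where
  carrier := {σ | ∀ r t, M.rel r t ↔ M.rel r (fun i => σ (M.srt r i) (t i))}
  one_mem' := fun _ _ => Iff.rfl
  mul_mem' := by
    intro σ τ hσ hτ r t
    exact (hτ r t).trans (hσ r _)
  inv_mem' := by
    intro σ hσ r t
    have h := hσ r (fun i => (σ⁻¹) (M.srt r i) (t i))
    have e : (fun i => σ (M.srt r i) ((σ⁻¹) (M.srt r i) (t i))) = t := by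
      funext i
      exact Equiv.apply_symm_apply (σ (M.srt r i)) (t i)
    rw [e] at h
    exact h.symm

/-- A relation is definable (without parameters) iff it is invariant under automorphisms. -/
def Definable (M : MStr.{u}) {n : ℕ} (w : Fin n → M.S) (R : (∀ i, M.carrier (w i)) → Prop) : Prop :=
  ∀ σ ∈ M.Aut, ∀ t, R t ↔ R (fun i => σ (w i) (t i))

/-- A finitary relation on a family of sets. -/
structure RelOn {A : Type u} (car : A → Type u) where
  /-- number of arguments -/
  n : ℕ
  /-- sorts of the arguments -/
  w : Fin n → A
  /-- the relation -/
  R : (∀ i, car (w i)) → Prop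

/-- The structure on the sorts `e a` of `M` which has as basic relations all relations that are
induced from `M`, i.e. definable in `M`. -/
def induced (M : MStr.{u}) {A : Type u} (e : A → M.S) : MStr.{u} where
  S := A
  carrier := fun a => M.carrier (e a)
  Rel := {r : RelOn (fun a => M.carrier (e a)) // M.Definable (fun i => e (r.w i)) r.R}
  len := fun r => r.1.n
  srt := fun r => r.1.w
  rel := fun r => r.1.R

/-- The restriction of an automorphism of `M` to the induced structure on some sorts. -/
def restrict (M : MStr.{u}) {A : Type u} (e : A → M.S) (σ : M.Aut) : (M.induced e).Aut :=
  ⟨fun a => σ.1 (e a), fun r t => r.2 σ.1 σ.2 t⟩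

/-- The data of a presentation of a family of sets `car a` as imaginary sorts `D/E` of `M`.
For each `a`, the set `D` is a subset of a disjoint union, over `idx a`, of finite products of
sorts of `M`; `codes a i t x` says that the tuple `t` of the `i`-th product lies in `D` and that
its class in `D/E` corresponds to `x` under the bijection of `car a` with `D/E`. Thus `D` is the
domain of the relation `codes`, and two tuples are `E`-equivalent iff they code the same
element. -/
structure Coding {A : Type u} (car : A → Type u) (M : MStr.{u}) where
  /-- index set of the disjoint union -/
  idx : A → Type u
  /-- number of factors -/
  len : ∀ a, idx a → ℕ
  /-- the factors -/
  srt : ∀ a i, Fin (len a i) → M.S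
  /-- the tuple codes the element -/
  codes : ∀ a i, (∀ j, M.carrier (srt a i j)) → car a → Prop

namespace Coding

variable {A : Type u} {car : A → Type u} {M : MStr.{u}} (c : Coding car M)

/-- The disjoint union of finite products of sorts in which the codes of elements of `car a` lie. -/
def Tup (a : A) : Type u := Σ i : c.idx a, ∀ j, M.carrier (c.srt a i j)

/-- `d` is a code of `x`. -/
def Rep {a : A} (d : c.Tup a) (x : car a) : Prop := c.codes a d.1 d.2 x

/-- The action of a family of permutations of the sorts on tuples. -/
def move (σ : ∀ s, Equiv.Perm (M.carrier s)) {a : A} (d : c.Tup a) : c.Tup a :=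
  ⟨d.1, fun j => σ (c.srt a d.1 j) (d.2 j)⟩

/-- A relation on the coded family is definable in `M` if its pull-back to codes is. -/
def DefRel {n : ℕ} (w : Fin n → A) (R : (∀ i, car (w i)) → Prop) : Prop :=
  ∀ σ ∈ M.Aut, ∀ (d : ∀ i, c.Tup (w i)) (x y : ∀ i, car (w i)),
    (∀ i, c.Rep (d i) (x i)) → (∀ i, c.Rep (c.move σ (d i)) (y i)) → (R x ↔ R y)

/-- The coded family with all relations induced from `M`. -/
def interpreted : MStr.{u} where
  S := A
  carrier := car
  Rel := {r : RelOn car // c.DefRel r.w r.R}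
  len := fun r => r.1.n
  srt := fun r => r.1.w
  rel := fun r => r.1.R

end Coding

variable {N M : MStr.{u}}

/-- The coding is an interpretation of `N` in `M`: it is a bijection of each sort of `N` with some
`D/E` where `D` and `E` are definable, and the image of every basic relation is definable. -/
structure IsInterpretation (c : Coding N.carrier M) : Prop where
  functional : ∀ {a} (d : c.Tup a) (x y : N.carrier a), c.Rep d x → c.Rep d y → x = y
  surjective : ∀ {a} (x : N.carrier a), ∃ d : c.Tup a, c.Rep d x
  dom_definable : ∀ σ ∈ M.Aut, ∀ {a} (d : c.Tup a),
    (∃ x, c.Rep d x) → ∃ x, c.Rep (c.move σ d) x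
  eqv_definable : ∀ σ ∈ M.Aut, ∀ {a} (d d' : c.Tup a) (x y y' : N.carrier a),
    c.Rep d x → c.Rep d' x → c.Rep (c.move σ d) y → c.Rep (c.move σ d') y' → y = y'
  rel_definable : ∀ r, c.DefRel (N.srt r) (N.rel r)

/-- The image of `N` has no proper expansion definable in `M`: each relation on it that is
definable in `M` is definable in `N`. -/
def IsEmbedding (c : Coding N.carrier M) : Prop :=
  ∀ (n : ℕ) (w : Fin n → N.S) (R : (∀ i, N.carrier (w i)) → Prop),
    c.DefRel w R → N.Definable w R

/-- Every element of `M` is in the definable closure of the image of `N`: it is fixed by all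
automorphisms of `M` that fix certain finitely many elements of the image. -/
def IsSurjection (c : Coding N.carrier M) : Prop :=
  ∀ (s : M.S) (m : M.carrier s), ∃ B : Finset (Σ a, N.carrier a), ∀ σ ∈ M.Aut,
    (∀ x ∈ B, ∀ d : c.Tup x.1, c.Rep d x.2 → c.Rep (c.move σ d) x.2) → σ s m = m

/-- The coding is an isomorphism of `N` with `M` in the category of structures and
interpretations, i.e. a bi-interpretation. -/
structure IsBiinterpretation (c : Coding N.carrier M) : Prop where
  isInterpretation : IsInterpretation c
  isEmbedding : IsEmbedding c
  isSurjection : IsSurjection c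

/-- `τ` is the automorphism of the interpreted structure induced by the automorphism `σ` of the
ambient one. -/
def Induces (c : Coding N.carrier M) (σ : M.Aut) (τ : N.Aut) : Prop :=
  ∀ {a} (d : c.Tup a) (x : N.carrier a), c.Rep d x → c.Rep (c.move σ.1 d) (τ.1 a x)

end MStr

/-! ## Rational functions and their values at points -/

namespace EtCov

section Geometry

variable {k F : Type u} [Field k] [Field F] [Algebra k F]

/-- The ring homomorphism `k → Γ(Y, 𝒪_Y)` given by a structure morphism `Y ⟶ Spec k`. -/
def constants {Y : Scheme.{u}} (t : Y ⟶ Spec (.of k)) : k →+* Γ(Y, ⊤) :=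
  ((Scheme.ΓSpecIso (.of k)).inv ≫ t.appTop).hom

/-- The point of `Y` underlying an `F`-valued point. -/
def pt {Y : Scheme.{u}} (y : Spec (.of F) ⟶ Y) : Y :=
  y (IsLocalRing.closedPoint (CommRingCat.of F))

/-- The regular function `r` on the open set `V` is defined at `y` and has the value `v` there. -/
def RegVal {Y : Scheme.{u}} (y : Spec (.of F) ⟶ Y) (V : Y.Opens) (r : Γ(Y, V)) (v : F) : Prop :=
  ∃ h : pt y ∈ V, (Scheme.stalkClosedPointTo y).hom ((Y.presheaf.germ V (pt y) h).hom r) = v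

/-- The rational function `r` on `Y` is regular at `y` and has the value `v` there. -/
def RatVal {Y : Scheme.{u}} [IsIntegral Y] (y : Spec (.of F) ⟶ Y) (r : Y.functionField) (v : F) :
    Prop :=
  ∃ g : Y.presheaf.stalk (pt y),
    algebraMap (Y.presheaf.stalk (pt y)) Y.functionField g = r ∧
      (Scheme.stalkClosedPointTo y).hom g = v

theorem isDominant_of_etale {Y X : Scheme.{u}} [IsIntegral Y] [IsIntegral X] (f : Y ⟶ X)
    [Etale f] : IsDominant f := by
  refine ⟨?_⟩
  exact f.isOpenMap.isOpen_range.dense (Set.range_nonempty _)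

theorem map_genericPoint {Y X : Scheme.{u}} [IsIntegral Y] [IsIntegral X] (f : Y ⟶ X)
    [IsDominant f] : f (genericPoint Y) = genericPoint X := by
  apply ((genericPoint_spec X).eq _).symm
  have h := (genericPoint_spec Y).image f.continuous
  rwa [Set.image_univ, f.denseRange.closure_range] at h

/-- The pull-back of rational functions along a dominant morphism. -/
def pullFF {Y X : Scheme.{u}} [IsIntegral Y] [IsIntegral X] (f : Y ⟶ X) [IsDominant f] :
    X.functionField →+* Y.functionField :=
  (X.presheaf.stalkSpecializes (specializes_of_eq (map_genericPoint f)) ≫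
    f.stalkMap (genericPoint Y)).hom

/-- A global function as a rational function. -/
def globFF (Y : Scheme.{u}) [IsIntegral Y] : Γ(Y, ⊤) →+* Y.functionField :=
  (Y.presheaf.germ ⊤ (genericPoint Y) trivial).hom

variable (F) in
/-- A (connected) finite Galois étale cover: an integral finite étale `X`-scheme whose
automorphism group acts transitively on its geometric fibres. (Connected étale covers of the
smooth schemes considered here are automatically integral.) -/
structure IsGaloisCover {Y X : Scheme.{u}} (f : Y ⟶ X) : Prop where
  isIntegral : IsIntegral Y
  isFinite : IsFinite f
  etale : Etale f
  transitive : ∀ y y' : Spec (.of F) ⟶ Y, y ≫ f = y' ≫ f → ∃ φ : Y ≅ Y, φ.hom ≫ f = f ∧ y ≫ φ.hom = y'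

end Geometry

/-! ## The family of all Galois étale covers -/

/-- A choice of representatives of all finite Galois étale covers of the `k`-scheme `X`, indexed by
a set `ℳ` of names, together with, for each of them,
a generator `a` of the field of constants (the maximal subfield of the ring of global functions
that is algebraic over `k`) and its minimal polynomial `f`. -/
structure CoverFamily {k : Type u} (F : Type u) [Field k] [Field F] [Algebra k F]
    {X : Scheme.{u}} (s : X ⟶ Spec (.of k)) where
  /-- names of covers -/
  ℳ : Type u
  /-- the covers -/
  Y : ℳ → Scheme.{u}
  /-- the covering morphisms -/
  π : ∀ μ, Y μ ⟶ X
  galois : ∀ μ, IsGaloisCover F (π μ)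
  complete : ∀ (Y' : Scheme.{u}) (π' : Y' ⟶ X), IsGaloisCover F π' →
    ∃ (μ : ℳ) (φ : Y' ≅ Y μ), φ.hom ≫ π μ = π'
  /-- the minimal polynomial of the generator of the field of constants -/
  f : ℳ → k[X]
  monic : ∀ μ, (f μ).Monic
  irreducible : ∀ μ, Irreducible (f μ)
  /-- the generator of the field of constants -/
  a : ∀ μ, Γ(Y μ, ⊤)
  a_root : ∀ μ, (f μ).eval₂ (constants (π μ ≫ s)) (a μ) = 0
  a_generates : ∀ μ (c : Γ(Y μ, ⊤)), (constants (π μ ≫ s)).IsIntegralElem c →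
    ∃ q : k[X], c = q.eval₂ (constants (π μ ≫ s)) (a μ)

namespace CoverFamily

variable {k F : Type u} [Field k] [Field F] [Algebra k F] {X : Scheme.{u}}
  {s : X ⟶ Spec (.of k)} (C : CoverFamily F s)

instance isIntegral_Y (μ : C.ℳ) : IsIntegral (C.Y μ) := (C.galois μ).isIntegral

instance etale_π (μ : C.ℳ) : Etale (C.π μ) := (C.galois μ).etale

instance isDominant_π [IsIntegral X] (μ : C.ℳ) : IsDominant (C.π μ) := isDominant_of_etale (C.π μ)

end CoverFamily

namespace CoverFamily

variable {k F : Type u} [Field k] [Field F] [Algebra k F] {X : Scheme.{u}} [IsIntegral X]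
  {s : X ⟶ Spec (.of k)} (C : CoverFamily F s)

/-- The zeros in `F` of the polynomial `f μ`. -/
def Zeros (μ : C.ℳ) : Type u := {α : F // (C.f μ).eval₂ (algebraMap k F) α = 0}

/-- The pairs `(μ, α)` with `α` a zero of `f μ`. -/
def Idx : Type u := Σ μ : C.ℳ, C.Zeros μ

/-- The morphism from the cover to the spectrum of its field of constants `k[T]/(f μ) ≅ k[a μ]`. -/
def toConst (μ : C.ℳ) : C.Y μ ⟶ Spec (.of (AdjoinRoot (C.f μ))) :=
  (C.Y μ).toSpecΓ ≫
    Spec.map (CommRingCat.ofHom (AdjoinRoot.lift (constants (C.π μ ≫ s)) (C.a μ) (C.a_root μ)))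

/-- The morphism `Spec F ⟶ Spec (k[T]/(f μ))` given by the embedding that sends `a μ` to `α`. -/
def embConst (i : C.Idx) : Spec (.of F) ⟶ Spec (.of (AdjoinRoot (C.f i.1))) :=
  Spec.map (CommRingCat.ofHom (AdjoinRoot.lift (algebraMap k F) i.2.1 i.2.2))

/-- The variety `X_{μ,α}` over `F`: the base change of the cover `μ` to `F` along the
embedding of its field of constants with `a μ ↦ α`. -/
def Z (i : C.Idx) : Scheme.{u} := pullback (C.toConst i.1) (C.embConst i)

/-- The projection of `X_{μ,α}` to the `k`-scheme `Y μ`. -/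
def prY (i : C.Idx) : C.Z i ⟶ C.Y i.1 := pullback.fst _ _

/-- The structure morphism of the `F`-variety `X_{μ,α}`. -/
def prF (i : C.Idx) : C.Z i ⟶ Spec (.of F) := pullback.snd _ _

/-- The set of points `X_{μ,α}(F)`. -/
def Pt (i : C.Idx) : Type u := {z : Spec (.of F) ⟶ C.Z i // z ≫ C.prF i = 𝟙 _}

/-- A point of `X_{μ,α}(F)` as an `F`-valued point of the `k`-scheme `Y μ`. -/
def Pt.toY {C : CoverFamily F s} {i : C.Idx} (z : C.Pt i) : Spec (.of F) ⟶ C.Y i.1 := z.1 ≫ C.prY i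

/-- The image in `X` of a point of `X_{μ,α}(F)`. -/
def Pt.toX {C : CoverFamily F s} {i : C.Idx} (z : C.Pt i) : Spec (.of F) ⟶ X := z.toY ≫ C.π i.1

/-- The geometric deck transformation group of `X_{μ,α}` over `X`: the automorphisms of
the `F`-variety `X_{μ,α}` over `X`. -/
def GDeck (i : C.Idx) : Type u :=
  {g : C.Z i ≅ C.Z i // g.hom ≫ C.prF i = C.prF i ∧
    g.hom ≫ C.prY i ≫ C.π i.1 = C.prY i ≫ C.π i.1}

/-- The action of deck transformations on points. -/
def GDeck.act {C : CoverFamily F s} {i : C.Idx} (g : C.GDeck i) (z : C.Pt i) : C.Pt i :=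
  ⟨z.1 ≫ g.1.hom, by rw [Category.assoc, g.2.1, z.2]⟩

/-- An intermediate morphism `X_{μ,α} ⟶ X_{ν,β}`: a morphism of the covers over `X`
which carries `X_{μ,α}` to `X_{ν,β}`. -/
structure Inter (i j : C.Idx) where
  /-- the morphism of `k`-schemes -/
  φ : C.Y i.1 ⟶ C.Y j.1
  comm : φ ≫ C.π j.1 = C.π i.1
  carries : (C.prY i ≫ φ) ≫ C.toConst j.1 = C.prF i ≫ C.embConst j

variable {C}

/-- The morphism of `F`-varieties given by an intermediate morphism. -/
def Inter.map {i j : C.Idx} (d : C.Inter i j) : C.Z i ⟶ C.Z j :=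
  pullback.lift (C.prY i ≫ d.φ) (C.prF i) d.carries

/-- The map on points given by an intermediate morphism. -/
def Inter.onPt {i j : C.Idx} (d : C.Inter i j) (z : C.Pt i) : C.Pt j :=
  ⟨z.1 ≫ d.map, by
    have h : d.map ≫ C.prF j = C.prF i := pullback.lift_snd _ _ _
    rw [Category.assoc, h, z.2]⟩

instance Inter.isDominant {i j : C.Idx} (d : C.Inter i j) : IsDominant d.φ := by
  have : Etale (d.φ ≫ C.π j.1) := by rw [d.comm]; infer_instance
  have : Etale d.φ := Etale.of_comp d.φ (C.π j.1)
  exact isDominant_of_etale d.φ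

/-- The identity as an intermediate morphism. -/
def Inter.id (i : C.Idx) : C.Inter i i where
  φ := 𝟙 _
  comm := Category.id_comp _
  carries := by rw [Category.comp_id]; exact pullback.condition

/-- Composition of intermediate morphisms. -/
def Inter.comp {i j l : C.Idx} (d : C.Inter i j) (e : C.Inter j l) : C.Inter i l where
  φ := d.φ ≫ e.φ
  comm := by rw [Category.assoc, e.comm, d.comm]
  carries := by
    have h1 : d.map ≫ C.prY j = C.prY i ≫ d.φ := pullback.lift_fst _ _ _
    have h2 : d.map ≫ C.prF j = C.prF i := pullback.lift_snd _ _ _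
    rw [← Category.assoc (C.prY i), ← h1, Category.assoc d.map, Category.assoc d.map, e.carries,
      ← Category.assoc, h2]

/-- `j ≤ i` iff there is an intermediate morphism from `i` to `j`. -/
instance : Preorder C.Idx where
  le j i := Nonempty (C.Inter i j)
  le_refl i := ⟨Inter.id i⟩
  le_trans _ _ _ := fun ⟨d⟩ ⟨e⟩ => ⟨e.comp d⟩

variable (C)

/-- The function field `K_{μ,α}`, as an abstract field extension of the function field of `X`: the
function field of the `k`-scheme `Y μ`, whose elements are functions on `X_{μ,α}` defined
over `k(α)`, with `a μ` being the constant function `α`. -/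
abbrev KK (i : C.Idx) : Type u := (C.Y i.1).functionField

/-- The choices on which the construction depends. First, a projective system of distinguished
morphisms: for any `i, j` such that there is an intermediate morphism from `i` to `j` one of them
is distinguished, identities and composites of distinguished morphisms being distinguished.
Second, for each cover, a rational function `b` such that `a` and `b` generate the function
field of the cover over that of `X`. -/
structure Choices where
  /-- the distinguished morphism -/
  mor : ∀ i j : C.Idx, j ≤ i → C.Inter i j
  id : ∀ i h, (mor i i h).φ = 𝟙 _
  comp : ∀ i j l hij hjl hil, (mor i j hij).φ ≫ (mor j l hjl).φ = (mor i l hil).φ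
  /-- the generator of the function field -/
  b : ∀ μ, (C.Y μ).functionField
  b_generates : ∀ μ, Subfield.closure
    (Set.range (pullFF (C.π μ)) ∪ {globFF (C.Y μ) (C.a μ), b μ}) = ⊤

end CoverFamily

/-- Names of the sorts of the structure `X̃^et(F)`. -/
inductive CovSort (ℳ : Type u) : Type u
  | U : CovSort ℳ
  | F : CovSort ℳ
  | p (μ : ℳ) : CovSort ℳ
  | X (μ : ℳ) : CovSort ℳ
  | G (μ : ℳ) : CovSort ℳ

/-- Names of all the sorts but the covering sort `U`. -/
inductive FinSort (ℳ : Type u) : Type u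
  | F : FinSort ℳ
  | p (μ : ℳ) : FinSort ℳ
  | X (μ : ℳ) : FinSort ℳ
  | G (μ : ℳ) : FinSort ℳ

/-- The inclusion of sorts. -/
def FinSort.toCov {ℳ : Type u} : FinSort ℳ → CovSort ℳ
  | .F => .F
  | .p μ => .p μ
  | .X μ => .X μ
  | .G μ => .G μ

namespace CoverFamily

variable {k F : Type u} [Field k] [Field F] [Algebra k F] {X : Scheme.{u}} [IsIntegral X]
  {s : X ⟶ Spec (.of k)} {C : CoverFamily F s}

namespace Choices

variable (D : C.Choices)

/-! ### The universal étale cover -/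

/-- The projective limit of the sets `X_{μ,α}(F)` along the distinguished morphisms. -/
def U : Type u := {u : ∀ i, C.Pt i // ∀ i j (h : j ≤ i), (D.mor i j h).onPt (u i) = u j}

/-- The set of maps `g ∘ 𝐩_{μ,α}`, with `𝐩_{μ,α}` the projection of the limit to
`X_{μ,α}(F)` and `g` a deck transformation. -/
def P (i : C.Idx) : Type u := {p : D.U → C.Pt i // ∃ g : C.GDeck i, ∀ u, p u = g.act (u.1 i)}

/-- The universes of the sorts: `U`, `F`, `p̃_μ = ⨆_α p̃_{μ,α}`, `X_μ(F) = ⨆_α X_{μ,α}(F)` and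
`⨆_α GDeck(X_{μ,α}/X)`. -/
def carrier : CovSort C.ℳ → Type u
  | .U => D.U
  | .F => F
  | .p μ => Σ α : C.Zeros μ, D.P ⟨μ, α⟩
  | .X μ => Σ α : C.Zeros μ, C.Pt ⟨μ, α⟩
  | .G μ => Σ α : C.Zeros μ, C.GDeck ⟨μ, α⟩

variable (C) in
/-- Names of the basic relations of `X̃^et(F)`. -/
inductive Rel : Type u
  /-- the graph of addition on `F` -/
  | add : Rel
  /-- the graph of multiplication on `F` -/
  | mul : Rel
  /-- the name of an element of `k` -/
  | const (c : k) : Rel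
  /-- the graph of a regular function, defined over `k`, on an open part of `X_μ` -/
  | reg (μ : C.ℳ) (V : (C.Y μ).Opens) (r : Γ(C.Y μ, V)) : Rel
  /-- the graph of a deck transformation -/
  | deck (μ : C.ℳ) : Rel
  /-- the relation `p ∈ p̃_{μ,α}` -/
  | mem (μ : C.ℳ) : Rel
  /-- the graph of the action of deck transformations on `p̃_{μ,α}` -/
  | act (μ : C.ℳ) : Rel
  /-- the relation `Φ_μ`, i.e. `p(u) = x` -/
  | phi (μ : C.ℳ) : Rel

/-- Number of arguments of the basic relations. -/
def len : Rel C → ℕ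
  | .add => 3
  | .mul => 3
  | .const _ => 1
  | .reg _ _ _ => 2
  | .deck _ => 3
  | .mem _ => 2
  | .act _ => 3
  | .phi _ => 3

/-- Sorts of the arguments of the basic relations. -/
def srt : ∀ r : Rel C, Fin (len r) → CovSort C.ℳ
  | .add => ![.F, .F, .F]
  | .mul => ![.F, .F, .F]
  | .const _ => ![.F]
  | .reg μ _ _ => ![.X μ, .F]
  | .deck μ => ![.G μ, .X μ, .X μ]
  | .mem μ => ![.p μ, .F]
  | .act μ => ![.G μ, .p μ, .p μ]
  | .phi μ => ![.p μ, .U, .X μ]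

/-- The basic relations. -/
def rel : ∀ r : Rel C, (∀ i, D.carrier (srt r i)) → Prop
  | .add, t =>
    let x : F := t (0 : Fin 3); let y : F := t (1 : Fin 3); let z : F := t (2 : Fin 3)
    x + y = z
  | .mul, t =>
    let x : F := t (0 : Fin 3); let y : F := t (1 : Fin 3); let z : F := t (2 : Fin 3)
    x * y = z
  | .const c, t =>
    let x : F := t (0 : Fin 1)
    x = algebraMap k F c
  | .reg μ V r, t =>
    let x : Σ α : C.Zeros μ, C.Pt ⟨μ, α⟩ := t (0 : Fin 2); let v : F := t (1 : Fin 2)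
    RegVal x.2.toY V r v
  | .deck μ, t =>
    let g : Σ α : C.Zeros μ, C.GDeck ⟨μ, α⟩ := t (0 : Fin 3)
    let x : Σ α : C.Zeros μ, C.Pt ⟨μ, α⟩ := t (1 : Fin 3)
    let y : Σ α : C.Zeros μ, C.Pt ⟨μ, α⟩ := t (2 : Fin 3)
    ∃ (α : C.Zeros μ) (g' : C.GDeck ⟨μ, α⟩) (x' : C.Pt ⟨μ, α⟩),
      g = ⟨α, g'⟩ ∧ x = ⟨α, x'⟩ ∧ y = ⟨α, g'.act x'⟩
  | .mem μ, t =>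
    let p : Σ α : C.Zeros μ, D.P ⟨μ, α⟩ := t (0 : Fin 2); let v : F := t (1 : Fin 2)
    p.1.1 = v
  | .act μ, t =>
    let g : Σ α : C.Zeros μ, C.GDeck ⟨μ, α⟩ := t (0 : Fin 3)
    let p : Σ α : C.Zeros μ, D.P ⟨μ, α⟩ := t (1 : Fin 3)
    let q : Σ α : C.Zeros μ, D.P ⟨μ, α⟩ := t (2 : Fin 3)
    ∃ (α : C.Zeros μ) (g' : C.GDeck ⟨μ, α⟩) (p' q' : D.P ⟨μ, α⟩),
      g = ⟨α, g'⟩ ∧ p = ⟨α, p'⟩ ∧ q = ⟨α, q'⟩ ∧ ∀ u, q'.1 u = g'.act (p'.1 u)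
  | .phi μ, t =>
    let p : Σ α : C.Zeros μ, D.P ⟨μ, α⟩ := t (0 : Fin 3); let u : D.U := t (1 : Fin 3)
    let x : Σ α : C.Zeros μ, C.Pt ⟨μ, α⟩ := t (2 : Fin 3)
    x = ⟨p.1, p.2.1 u⟩

/-- The structure `X̃^et(F)`. -/
def Xet : MStr.{u} where
  S := CovSort C.ℳ
  carrier := D.carrier
  Rel := Rel C
  len := len
  srt := srt
  rel := D.rel

/-- The structure `X̃^et_fin(F)`: the covering sort is removed, all induced relations are kept. -/
def Xfin : MStr.{u} := D.Xet.induced FinSort.toCov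

/-- The structure `p̃_X`: the sorts `p̃_μ` with all induced relations. -/
def ptilde : MStr.{u} := D.Xet.induced CovSort.p

/-! ### The fields of formal terms -/

/-- The relation `T(α, p_1, …, p_N) = 0` between the elements `p` of `p̃_{μ,α}`, for a polynomial
`T` over the function field of `X` (the variable `none` stands for `α`): the
rational function `T(α, b ∘ p_1, …, b ∘ p_N)` vanishes, i.e. has the value
`0` wherever the coefficients of `T` and all `b ∘ p` are regular. -/
def Vanishes (i : C.Idx) (T : MvPolynomial (Option (D.P i)) X.functionField) : Prop :=
  ∀ (u : D.U) (c : (Option (D.P i) →₀ ℕ) → F) (v : D.P i → F),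
    (∀ m ∈ T.support, RatVal (u.1 i).toX (T.coeff m) (c m)) →
    (∀ p : D.P i, RatVal (p.1 u).toY (D.b i.1) (v p)) →
    ∑ m ∈ T.support, c m * m.prod (fun o e => (o.elim i.2.1 v) ^ e) = 0

/-- The field `P_{μ,α}` of formal terms modulo the relations that hold for the `b ∘ p`. (The vanishing
terms form an ideal, as rational functions are determined by their values on a dense open set.) -/
abbrev PP (i : C.Idx) : Type u :=
  MvPolynomial (Option (D.P i)) X.functionField ⧸ Ideal.span {T | D.Vanishes i T}

/-- The class of a formal term. -/
def term (i : C.Idx) (T : MvPolynomial (Option (D.P i)) X.functionField) : D.PP i :=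
  Ideal.Quotient.mk _ T

/-- The interpretation of the family of the sets `P_μ = ⨆_α P_{μ,α}` on formal terms: for a
polynomial `T` over the function field of `X` in `N + 1` variables, `N > 0`, a tuple
`p_1, …, p_N` of elements of the same `p̃_{μ,α}` codes the class of `T(α, p_1, …, p_N)`.
Here `M` is a structure with sorts `e μ` containing the elements of `p̃_μ`. -/
def termCoding (M : MStr.{u}) (e : C.ℳ → M.S)
    (ι : ∀ μ, (Σ α : C.Zeros μ, D.P ⟨μ, α⟩) → M.carrier (e μ)) :
    MStr.Coding (fun μ : C.ℳ => Σ α : C.Zeros μ, D.PP ⟨μ, α⟩) M where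
  idx := fun _ => Σ N : ℕ, MvPolynomial (Option (Fin N)) X.functionField
  len := fun _ T => T.1
  srt := fun μ _ _ => e μ
  codes := fun μ T t x => 0 < T.1 ∧
    ∃ (α : C.Zeros μ) (p : Fin T.1 → D.P ⟨μ, α⟩), (∀ j, t j = ι μ ⟨α, p j⟩) ∧
      x = ⟨α, D.term ⟨μ, α⟩ (MvPolynomial.rename (Option.map p) T.2)⟩

/-- The multisorted structure `P_X` with sorts `P_μ` and all relations induced from `X̃^et(F)`. -/
def PX : MStr.{u} := (D.termCoding D.Xet CovSort.p (fun _ x => x)).interpreted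

/-- The interpretation of `P_X` in `p̃_X`. -/
def codingPtilde : MStr.Coding D.PX.carrier D.ptilde :=
  D.termCoding D.ptilde (fun μ => μ) (fun _ x => x)

/-- The interpretation of `P_X` in `X̃^et_fin(F)`. -/
def codingXfin : MStr.Coding D.PX.carrier D.Xfin :=
  D.termCoding D.Xfin FinSort.p (fun _ x => x)

/-! ### The limit of the function fields -/

/-- The embedding of function fields given by a distinguished morphism. -/
def trans (i j : C.Idx) (h : i ≤ j) : C.KK i →+* C.KK j := pullFF (D.mor j i h).φ

/-- The limit `K̃` of the function fields of the Galois étale covers. -/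
abbrev Ktilde : Type u := Ring.DirectLimit C.KK (fun i j h => D.trans i j h)

/-- The canonical map of the function field of a cover to the limit. -/
def toKtilde (i : C.Idx) : C.KK i →+* D.Ktilde :=
  Ring.DirectLimit.of C.KK (fun i j h => D.trans i j h) i

/-- Names of the basic relations of `K̃` as a field over the function field of `X`. -/
inductive KRel (X : Scheme.{u}) [IsIntegral X] : Type u
  | add : KRel X
  | mul : KRel X
  | const (c : X.functionField) : KRel X

/-- `K̃` as a structure: a field with names for the elements of the function field of `X`. -/
def KStr : MStr.{u} where
  S := PUnit
  carrier := fun _ => D.Ktilde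
  Rel := KRel X
  len := fun
    | .add => 3
    | .mul => 3
    | .const _ => 1
  srt := fun _ _ => PUnit.unit
  rel := fun
    | .add => fun t => t (0 : Fin 3) + t (1 : Fin 3) = t (2 : Fin 3)
    | .mul => fun t => t (0 : Fin 3) * t (1 : Fin 3) = t (2 : Fin 3)
    | .const c => fun t => ∃ i : C.Idx, t (0 : Fin 1) = D.toKtilde i (pullFF (C.π i.1) c)

/-- A family of ring isomorphisms `P_{μ,α} → K_{μ,α}` identifies `K̃` with the quotient of the
disjoint union of all the sorts of `P_X`: an element `(α, z)` of `P_μ` codes the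
image of `z` in `K̃`. -/
def glue (φ : ∀ i : C.Idx, D.PP i ≃+* C.KK i) : MStr.Coding D.KStr.carrier D.PX where
  idx := fun _ => C.ℳ
  len := fun _ _ => 1
  srt := fun _ μ _ => μ
  codes := fun _ μ t x =>
    let y : Σ α : C.Zeros μ, D.PP ⟨μ, α⟩ := t (0 : Fin 1)
    x = D.toKtilde ⟨μ, y.1⟩ (φ ⟨μ, y.1⟩ y.2)

/-- The family of ring isomorphisms `P_{μ,α} → K_{μ,α}` is the canonical one: it is the identity on
the function field of `X`, sends `α` to the constant function `a`, and sends
`p = g ∘ 𝐩_{μ,α}` to the rational function `b ∘ g`, i.e. to `r` with `r ∘ 𝐩_{μ,α} = b ∘ p`. -/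
structure IsCanonical (φ : ∀ i : C.Idx, D.PP i ≃+* C.KK i) : Prop where
  map_const : ∀ i (c : X.functionField),
    φ i (D.term i (MvPolynomial.C c)) = pullFF (C.π i.1) c
  map_alpha : ∀ i, φ i (D.term i (MvPolynomial.X none)) =
    globFF (C.Y i.1) (C.a i.1)
  map_p : ∀ i (p : D.P i) (u : D.U) (v w : F),
    RatVal (p.1 u).toY (D.b i.1) v →
    RatVal (u.1 i).toY (φ i (D.term i (MvPolynomial.X (some p)))) w → v = w

end Choices

end CoverFamily

end EtCov

end

/-!
The covers of the smooth scheme `X` are normal, and a morphism of covers of `X` is determined by its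
effect on one geometric point. These two facts, `EtCov.stalk_of_smooth` and
`EtCov.hom_ext_of_point`, govern the geometry. By normality every algebraic element of the function
field of a cover is a global constant, so `X_{μ,α}` is irreducible. By rigidity and the Galois
property, the deck transformations of `X_{μ,α}` are exactly the maps induced by endomorphisms of the
cover that preserve it (`GDeck.exists_inter`, `Inter.exists_gdeck`). Galois closures
(`exists_galoisClosure`) make the system of all `X_{μ,α}` directed; hence `K̃` is a directed limit of
fields, and the universal cover `U` surjects onto `X(F)`.

An element of `K̃` has values at the points `u` of `U` that lie over a suitable nonempty open part of
`X`, and is determined by these values (`Choices.Val`, `Choices.eq_of_val`). The value of the formal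
term `T(α, p_1, …, p_N)` at `u` is that of a rational function on `X_{μ,α}`, obtained by evaluating
`T` at `a` and the functions `b ∘ p_j`. A term vanishes iff this function is zero, and all elements
of the function field arise, since `a` and `b` generate it over that of `X`, over which it is
algebraic. This is the isomorphism `Choices.termIso` of `P_{μ,α}` with `K_{μ,α}`.

An automorphism `σ` of `X̃^et(F)` acts on `F` by a field automorphism over `k`, and on points of
covers through this action, as it preserves the values of regular functions. Therefore it carries
the values of a term to the values of the image term: in the sense of `Choices.Transports`, it acts
on elements of `K̃` through their values. It follows that the presentation of `P_X` by formal terms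
is an interpretation, with `P_X` carrying all induced relations by definition, and that `K̃` is
interpreted in `P_X`. For surjectivity, `p` is recovered from the term `p`, since `b` generates the
function field. An element of `F` is a polynomial in some `α`; points are determined by finitely many
elements of `F`, and deck transformations by a point and its image.

The converse is that each automorphism of `K̃` over the function field of `X` comes from an
automorphism of `X̃^et(F)` (`Choices.exists_aut_of_ringEquiv`). It restricts to the function field of
each cover, because homomorphisms between function fields of covers come from morphisms of covers
(`Inter.exists_of_ringHom`), and it restricts to `F`, the field of constants of `K̃`. The
automorphisms of the covers, composed with the action of the automorphism of `F` on points, preserve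
all `X_{μ,α}(F)` and the distinguished morphisms, so they act on `U`, and on all the other sorts.
This shows that relations on `K̃` definable in `P_X` are definable in `K̃`, and that every
automorphism of `P_X` is induced by one of `X̃^et(F)`. The latter is unique, since an automorphism
that fixes all points of covers fixes their projective limit `U`.
-/


open scoped TensorProduct

set_option linter.unusedSectionVars false

noncomputable section

/-! ### Local rings of smooth schemes over a field -/

/-- A reduced artinian ring without nontrivial idempotents is a field: `x ^ n * y ^ n` is idempotent
if `x ^ (n + 1) * y = x ^ n`. -/
theorem isField_of_artinian_of_idempotents {Q : Type*} [CommRing Q] [Nontrivial Q]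
    [IsArtinianRing Q]
    [_root_.IsReduced Q] (h : ∀ e : Q, e * e = e → e = 0 ∨ e = 1) : IsField Q := by
  refine ⟨exists_pair_ne Q, mul_comm, fun {x} hx => ?_⟩
  obtain ⟨n, y, hy⟩ := IsArtinian.exists_pow_succ_smul_dvd x (1 : Q)
  simp only [smul_eq_mul, mul_one, Nat.succ_eq_add_one] at hy
  have key : ∀ m, x ^ (n + m) * y ^ m = x ^ n := by
    intro m
    induction m with
    | zero => simp
    | succ m ih =>
      calc x ^ (n + (m + 1)) * y ^ (m + 1) = (x ^ (n + 1) * y) * (x ^ m * y ^ m) := by ring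
        _ = x ^ (n + m) * y ^ m := by rw [hy]; ring
        _ = _ := ih
  rcases h (x ^ n * y ^ n) (by
    calc x ^ n * y ^ n * (x ^ n * y ^ n) = (x ^ (n + n) * y ^ n) * y ^ n := by ring
      _ = _ := by rw [key]) with h0 | h1
  · exfalso
    apply hx
    have : x ^ n = 0 := by
      rw [← key n, pow_add, mul_assoc, h0, mul_zero]
    exact IsReduced.eq_zero _ ⟨n, this⟩
  · rcases n with _ | n
    · exact ⟨y, by simpa using hy⟩
    · exact ⟨x ^ n * y ^ (n + 1), by rw [← h1]; ring⟩

/-- A local ring `T` flat, unramified and essentially of finite type over an integrally closed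
domain `R` is an integrally closed domain if integral closure commutes with the base change from `R`
to `T`. Indeed `T ⊗ Frac R` is then a finite product of fields in which `T` is integrally closed; so
its idempotents lie in the local ring `T`, and it is a field. -/
theorem isIntegrallyClosed_of_bijective_toIntegralClosure {R T K : Type u} [CommRing R] [IsDomain R]
    [IsIntegrallyClosed R] [CommRing T] [IsLocalRing T]
    [Algebra R T] [Field K] [Algebra R K] [IsFractionRing R K]
    [Module.Flat R T] [Algebra.FormallyUnramified R T] [Algebra.EssFiniteType R T]
    (h : Function.Bijective (TensorProduct.toIntegralClosure R T K)) :
    IsDomain T ∧ IsIntegrallyClosed T := by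
  have hinj : Function.Injective (algebraMap T (T ⊗[R] K)) := by
    have := Module.Flat.lTensor_preserves_injective_linearMap (M := T) (Algebra.linearMap R K)
      (IsFractionRing.injective R K)
    intro x y hxy
    have h2 := @this (x ⊗ₜ 1) (y ⊗ₜ 1) (by simpa using hxy)
    simpa using congrArg (TensorProduct.rid R T) h2
  have hint : ∀ q : T ⊗[R] K, IsIntegral T q → ∃ t : T, algebraMap T _ t = q := by
    intro q hq
    obtain ⟨z, hz⟩ := h.2 ⟨q, hq⟩
    have e : ∀ z : T ⊗[R] integralClosure R K, ∃ t : T, z = t ⊗ₜ 1 := by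
      intro z
      induction z with
      | zero => exact ⟨0, by simp⟩
      | add x y hx hy =>
        obtain ⟨a, rfl⟩ := hx; obtain ⟨b, rfl⟩ := hy
        exact ⟨a + b, by rw [TensorProduct.add_tmul]⟩
      | tmul x y =>
        obtain ⟨r, hr⟩ := IsIntegrallyClosed.isIntegral_iff.mp y.2
        have : y = algebraMap R _ r := Subtype.ext hr.symm
        refine ⟨r • x, ?_⟩
        rw [this, Algebra.algebraMap_eq_smul_one, TensorProduct.tmul_smul, TensorProduct.smul_tmul']
    obtain ⟨t, rfl⟩ := e z
    refine ⟨t, ?_⟩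
    have := congrArg Subtype.val hz
    simpa [TensorProduct.toIntegralClosure] using this
  -- The generic fibre `K ⊗ T` is finite and reduced over `K`.
  have hu : Algebra.FormallyUnramified K (K ⊗[R] T) := inferInstance
  have hf : Algebra.EssFiniteType K (K ⊗[R] T) := inferInstance
  have hr := Algebra.FormallyUnramified.isReduced_of_field K (K ⊗[R] T)
  have := Algebra.FormallyUnramified.finite_of_free K (K ⊗[R] T)
  have hA : IsArtinianRing (K ⊗[R] T) := isArtinian_of_tower K inferInstance
  let e := (Algebra.TensorProduct.comm R K T)
  have : IsArtinianRing (T ⊗[R] K) := e.toRingEquiv.surjective.isArtinianRing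
  have : _root_.IsReduced (T ⊗[R] K) := isReduced_of_injective e.symm.toRingHom e.symm.injective
  have : Nontrivial (T ⊗[R] K) := hinj.nontrivial
  have hF : IsField (T ⊗[R] K) := by
    apply isField_of_artinian_of_idempotents
    intro e he
    obtain ⟨t, rfl⟩ := hint e ⟨Polynomial.X ^ 2 - Polynomial.X, by monicity!, by simp [sq, he]⟩
    have : t * t = t := hinj (by simpa using he)
    rcases IsLocalRing.isUnit_or_isUnit_one_sub_self t with h | h
    · right; rw [h.mul_left_cancel (this.trans (mul_one t).symm), map_one]
    · left
      have : (1 - t) * t = (1 - t) * 0 := by rw [sub_mul, this]; simp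
      rw [h.mul_left_cancel this, map_zero]
  let := hF.toField
  have hD : IsDomain T := hinj.isDomain (algebraMap T (T ⊗[R] K))
  refine ⟨hD, ?_⟩
  rw [isIntegrallyClosed_iff (FractionRing T)]
  intro q hq
  let l : FractionRing T →ₐ[T] T ⊗[R] K := IsLocalization.liftAlgHom (M := nonZeroDivisors T)
    (f := Algebra.ofId T (T ⊗[R] K)) fun y => by
      rw [isUnit_iff_ne_zero]
      intro h0
      exact nonZeroDivisors.ne_zero y.2 (hinj (by simpa [Algebra.ofId_apply] using h0))
  obtain ⟨t, ht⟩ := hint (l q) (hq.map l)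
  exact ⟨t, l.toRingHom.injective (by simpa using ht)⟩

/-- The local rings of a smooth algebra over a field are integrally closed domains: locally, the
algebra is étale over a polynomial ring, which is factorial. -/
theorem isIntegrallyClosed_localization_of_smooth {k A : Type u} [Field k] [CommRing A]
    [Algebra k A]
    [Algebra.Smooth k A] (p : Ideal A) [p.IsPrime] (T : Type u) [CommRing T] [Algebra A T]
    [IsLocalization.AtPrime T p] :
    IsDomain T ∧ IsIntegrallyClosed T := by
  obtain ⟨f, hfp, n, _, _, _⟩ :=
    Algebra.IsSmoothAt.exists_isStandardEtale_mvPolynomial (R := k) (p := p)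
  let R := MvPolynomial (Fin n) k
  let S := Localization.Away f
  have hT : IsLocalRing T := IsLocalization.AtPrime.isLocalRing T p
  let : Algebra S T := (IsLocalization.Away.lift (S := S) f (g := algebraMap A T)
    (IsLocalization.map_units T (⟨f, hfp⟩ : p.primeCompl))).toAlgebra
  have : IsScalarTower A S T := .of_algebraMap_eq fun x => by
    rw [RingHom.algebraMap_toAlgebra]; simp [S]
  let M : Submonoid S := p.primeCompl.map (algebraMap A S)
  have : IsLocalization M T := IsLocalization.isLocalization_of_submonoid_le S T
    (Submonoid.powers f) p.primeCompl (by
      rw [Submonoid.powers_le]; exact hfp)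
  let : Algebra R T := ((algebraMap S T).comp (algebraMap R S)).toAlgebra
  have : IsScalarTower R S T := .of_algebraMap_eq' rfl
  have : Algebra.Smooth R S := inferInstance
  have : Algebra.Etale R S := inferInstance
  have h1 : Algebra.FormallyEtale S T := .of_isLocalization M
  have : Algebra.FormallyEtale R T := .comp R S T
  have : Algebra.EssFiniteType S T := .of_isLocalization _ M
  have : Algebra.EssFiniteType R T := .comp R S T
  have : Module.Flat S T := IsLocalization.flat T M
  have : Module.Flat R T := .trans R S T
  exact isIntegrallyClosed_of_bijective_toIntegralClosure (K := FractionRing R)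
      (TensorProduct.toIntegralClosure_bijective_of_tower
    (S := S) (TensorProduct.toIntegralClosure_bijective_of_smooth (R := R) (S := S))
    (TensorProduct.toIntegralClosure_bijective_of_isLocalization M))

namespace EtCov

/-- Smooth schemes over a field are normal. -/
theorem stalk_of_smooth {k : Type u} [Field k] {W : Scheme.{u}} (s : W ⟶ Spec (.of k)) [Smooth s]
    (w : W) :
    IsDomain (W.presheaf.stalk w) ∧ IsIntegrallyClosed (W.presheaf.stalk w) := by
  obtain ⟨_, ⟨V, hV, rfl⟩, hwV, -⟩ :=
      W.isBasis_affineOpens.exists_subset_of_mem_open (Set.mem_univ w) isOpen_univ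
  have h : (s.appLE ⊤ V le_top).hom.Smooth := by
    exact HasRingHomProperty.appLE @Smooth s inferInstance ⟨⊤, isAffineOpen_top _⟩ ⟨V, hV⟩ le_top
  let e := (Scheme.ΓSpecIso (.of k)).inv ≫ s.appLE ⊤ V le_top
  have h' : e.hom.Smooth := by
    have := (RingHom.Smooth.respectsIso).2 (s.appLE ⊤ V le_top).hom
        (Scheme.ΓSpecIso (.of k)).symm.commRingCatIsoToRingEquiv h
    exact this
  let : Algebra k Γ(W, V) := e.hom.toAlgebra
  have : Algebra.Smooth k Γ(W, V) := h'
  let : Algebra Γ(W, V) (W.presheaf.stalk w) :=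
      TopCat.Presheaf.algebra_section_stalk W.presheaf (U := V) ⟨w, hwV⟩
  have : IsLocalization.AtPrime (W.presheaf.stalk w) (hV.primeIdealOf ⟨w, hwV⟩).asIdeal :=
    hV.isLocalization_stalk ⟨w, hwV⟩
  exact isIntegrallyClosed_localization_of_smooth (k := k) (hV.primeIdealOf ⟨w, hwV⟩).asIdeal
    (W.presheaf.stalk w)

/-- If the stalks of a locally noetherian scheme are domains, each point has an irreducible
neighbourhood: one on which sections inject into the stalk. -/
theorem exists_irreducible_nhd {W : Scheme.{u}} [IsLocallyNoetherian W]
    (h : ∀ w : W, IsDomain (W.presheaf.stalk w)) (w : W) :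
    ∃ U : W.Opens, w ∈ U ∧ IsPreirreducible (U : Set W) := by
  obtain ⟨U, hwU, hU, hinj⟩ := W.exists_germ_injective w
  have : IsDomain Γ(W, U) := hinj.isDomain (W.presheaf.germ U w hwU).hom
  have : IrreducibleSpace U := hU.isoSpec.hom.homeomorph.irreducibleSpace_iff.mpr inferInstance
  refine ⟨U, hwU, ?_⟩
  have := ((IrreducibleSpace.isIrreducible_univ U).image U.ι U.ι.continuous.continuousOn).2
  rwa [Set.image_univ, Scheme.Opens.range_ι] at this

/-- A connected locally noetherian scheme whose stalks are domains is integral. -/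
theorem isIntegral_of_isDomain_stalk {W : Scheme.{u}} [IsLocallyNoetherian W] [ConnectedSpace W]
    (h : ∀ w : W, IsDomain (W.presheaf.stalk w)) : IsIntegral W := by
  have : ∀ w : W, _root_.IsReduced (W.presheaf.stalk w) := fun w => inferInstance
  have := isReduced_of_isReduced_stalk W
  have : ExtremallyDisconnected W := by
    refine ⟨fun V hV => isOpen_iff_forall_mem_open.mpr fun w hw => ?_⟩
    obtain ⟨U, hwU, hirr⟩ := exists_irreducible_nhd h w
    refine ⟨U, ?_, U.isOpen, hwU⟩
    obtain ⟨v, hv⟩ := mem_closure_iff.mp hw U U.isOpen hwU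
    exact (subset_closure_inter_of_isPreirreducible_of_isOpen hirr hV ⟨v, hv⟩).trans
      (closure_mono Set.inter_subset_right)
  have := ExtremallyDisconnected.toPreirreducibleSpace (X := W)
  have : IrreducibleSpace W := ⟨inferInstance⟩
  exact isIntegral_of_irreducibleSpace_of_isReduced W

theorem isOpen_connectedComponent_of_isDomain_stalk {W : Scheme.{u}} [IsLocallyNoetherian W]
    (h : ∀ w : W, IsDomain (W.presheaf.stalk w)) (w : W) : IsOpen (connectedComponent w) := by
  refine isOpen_iff_forall_mem_open.mpr fun v hv => ?_
  obtain ⟨U, hvU, hirr⟩ := exists_irreducible_nhd h v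
  refine ⟨U, ?_, U.isOpen, hvU⟩
  rw [← connectedComponent_eq_iff_mem.mpr hv]
  exact hirr.isPreconnected.subset_connectedComponent hvU

/-! ### Geometric points of étale schemes -/

/-- Two lifts along a separated unramified morphism of a morphism with connected source coincide if
they coincide at one geometric point, as the locus of coincidence is open and closed. -/
theorem hom_ext_of_point {W Y X : Scheme.{u}} {f g : W ⟶ Y} (π : Y ⟶ X) [FormallyUnramified π]
    [LocallyOfFiniteType π] [IsSeparated π] [ConnectedSpace W] (h : f ≫ π = g ≫ π)
    {F : Type u} [Field F] (w : Spec (.of F) ⟶ W) (hw : w ≫ f = w ≫ g) : f = g := by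
  let l : W ⟶ pullback π π := pullback.lift f g h
  have hl1 : l ≫ pullback.fst π π = f := pullback.lift_fst _ _ _
  have hl2 : l ≫ pullback.snd π π = g := pullback.lift_snd _ _ _
  let e : pullback l (pullback.diagonal π) ⟶ W := pullback.fst _ _
  let n : Spec (.of F) ⟶ pullback l (pullback.diagonal π) := pullback.lift w (w ≫ f) (by
    apply pullback.hom_ext <;> simp [hl1, hl2, hw])
  have hr : Set.range e = Set.univ := by
    refine IsClopen.eq_univ ⟨e.isClosedEmbedding.isClosed_range, e.isOpenEmbedding.isOpen_range⟩ ?_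
    exact ⟨_, n (IsLocalRing.closedPoint F), rfl⟩
  have : IsIso e := isIso_of_isOpenImmersion_of_opensRange_eq_top e (TopologicalSpace.Opens.ext hr)
  rw [← cancel_epi e]
  have h1 : e ≫ l = pullback.snd _ _ ≫ pullback.diagonal π := pullback.condition
  calc e ≫ f = (e ≫ l) ≫ pullback.fst π π := by simp [hl1]
    _ = (e ≫ l) ≫ pullback.snd π π := by rw [h1]; simp
    _ = e ≫ g := by simp [hl2]

/-- In a scheme locally of finite type over an algebraically closed field, each nonempty open set
contains a rational point. -/
theorem exists_point_mem {Z : Scheme.{u}} {F : Type u} [Field F] [IsAlgClosed F]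
    (t : Z ⟶ Spec (.of F)) [LocallyOfFiniteType t] (V : Z.Opens) (hV : (V : Set Z).Nonempty) :
    ∃ z : Spec (.of F) ⟶ Z, z ≫ t = 𝟙 _ ∧ pt z ∈ V := by
  have : JacobsonSpace Z := LocallyOfFiniteType.jacobsonSpace t
  have : Dense (closedPoints Z) := by
    rw [dense_iff_closure_eq]; exact closure_closedPoints
  obtain ⟨z, hz, hc⟩ := this.inter_open_nonempty V V.isOpen hV
  have hc' : IsClosed {z} := hc
  have e : pt (pointOfClosedPoint t z hc') = z := pointOfClosedPoint_apply t z hc' _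
  refine ⟨pointOfClosedPoint t z hc', pointOfClosedPoint_comp t z hc', ?_⟩
  rw [e]
  exact hz

theorem surjective_of_finite_etale {N B : Scheme.{u}} (p : N ⟶ B) [IsFinite p] [Etale p]
    [Nonempty N]
    [ConnectedSpace B] : Surjective p := by
  refine ⟨Set.range_eq_univ.mp (IsClopen.eq_univ ⟨p.isClosedMap.isClosed_range,
    p.isOpenMap.isOpen_range⟩ (Set.range_nonempty _))⟩

/-- Geometric points lift along finite étale covers of connected schemes. -/
theorem exists_lift_point {N B : Scheme.{u}} (p : N ⟶ B) [IsFinite p] [Etale p] [Nonempty N]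
    [ConnectedSpace B] {F : Type u} [Field F] [IsAlgClosed F] (x : Spec (.of F) ⟶ B) :
    ∃ y : Spec (.of F) ⟶ N, y ≫ p = x := by
  have := surjective_of_finite_etale p
  have hs : Surjective (pullback.snd p x) := inferInstance
  obtain ⟨z, -⟩ := hs.1 (IsLocalRing.closedPoint F)
  obtain ⟨y, hy, -⟩ := exists_point_mem (pullback.snd p x) ⊤ ⟨z, trivial⟩
  refine ⟨y ≫ pullback.fst p x, ?_⟩
  rw [Category.assoc, pullback.condition, reassoc_of% hy]

/-- The connected component of a geometric point in a finite étale scheme over a smooth scheme is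
open, closed and integral. -/
theorem exists_component {k F : Type u} [Field k] [Field F] {W X : Scheme.{u}} (p : W ⟶ X)
    [IsFinite p] [Etale p]
    (s : X ⟶ Spec (.of k)) [Smooth s] (w : Spec (.of F) ⟶ W) :
    ∃ (N : Scheme.{u}) (ι : N ⟶ W) (n : Spec (.of F) ⟶ N), IsIntegral N ∧ IsOpenImmersion ι ∧
      IsClosedImmersion ι ∧ n ≫ ι = w := by
  have : IsLocallyNoetherian W := LocallyOfFiniteType.isLocallyNoetherian (p ≫ s)
  have hd : ∀ w : W, IsDomain (W.presheaf.stalk w) := fun w => (stalk_of_smooth (p ≫ s) w).1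
  let w0 := w (IsLocalRing.closedPoint F)
  let U : W.Opens := ⟨connectedComponent w0, isOpen_connectedComponent_of_isDomain_stalk hd w0⟩
  have : ConnectedSpace U := isConnected_iff_connectedSpace.mp isConnected_connectedComponent
  have hdU : ∀ v : U.toScheme, IsDomain (U.toScheme.presheaf.stalk v) := fun v =>
    (stalk_of_smooth (U.ι ≫ p ≫ s) v).1
  have hU : Set.range U.ι = (U : Set W) := by simp
  refine ⟨U, U.ι, IsOpenImmersion.lift U.ι w ?_, isIntegral_of_isDomain_stalk hdU, inferInstance,
      ?_,
    IsOpenImmersion.lift_fac _ _ _⟩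
  · rw [hU]
    rintro _ ⟨a, rfl⟩
    rw [Subsingleton.elim a (IsLocalRing.closedPoint F)]
    exact mem_connectedComponent
  · exact .of_isPreimmersion _ (by rw [hU]; exact isClosed_connectedComponent)

end EtCov

/-! ### Tensor products with algebraic extensions -/

/-- Minimal polynomials do not change under field extensions in which the ground field is
algebraically closed: the coefficients of the new one are polynomials in the conjugates, so
algebraic. -/
theorem natDegree_minpoly_eq_of_isIntegrallyClosedIn {E L Ω : Type*} [Field E] [Field L] [Field Ω]
    [Algebra E L]
    [Algebra E Ω] [Algebra L Ω] [IsScalarTower E L Ω]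
    (hL : ∀ x : L, IsIntegral E x → x ∈ (algebraMap E L).range) {t : Ω} (ht : IsIntegral E t) :
    (minpoly L t).natDegree = (minpoly E t).natDegree := by
  have htL : IsIntegral L t := ht.tower_top
  have hdvd : minpoly L t ∣ (minpoly E t).map (algebraMap E L) :=
      minpoly.dvd_map_of_isScalarTower E L t
  have hlift : minpoly L t ∈ Polynomial.lifts (algebraMap E L) := by
    rw [Polynomial.lifts_iff_coeff_lifts]
    intro n
    exact hL _ (Polynomial.isIntegral_coeff_of_dvd _ _ (minpoly.monic ht)
        (minpoly.monic htL) hdvd n)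
  obtain ⟨g, hg, hdeg, hmon⟩ := Polynomial.lifts_and_natDegree_eq_and_monic hlift
      (minpoly.monic htL)
  apply le_antisymm
  · rw [← (minpoly.monic ht).natDegree_map (algebraMap E L)]
    exact Polynomial.natDegree_le_of_dvd hdvd ((minpoly.monic ht).map _).ne_zero
  · rw [← hdeg]
    refine Polynomial.natDegree_le_of_dvd (minpoly.dvd E t ?_) hmon.ne_zero
    rw [← Polynomial.aeval_map_algebraMap L, hg, minpoly.aeval]

/-- In characteristic zero, extensions `L` and `F` of `E` are linearly disjoint if `E` is
algebraically closed in `L` and `F` is algebraic. By the primitive element theorem it suffices to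
compare minimal polynomials. -/
theorem isDomain_tensor_of_isIntegrallyClosedIn {E L F : Type u} [Field E] [CharZero E] [Field L]
    [Field F] [Algebra E L] [Algebra E F]
    [Algebra.IsAlgebraic E F] (hL : ∀ x : L, IsIntegral E x → x ∈ (algebraMap E L).range) :
    IsDomain (L ⊗[E] F) := by
  let Ω := AlgebraicClosure L
  have : Algebra.IsAlgebraic L Ω := AlgebraicClosure.isAlgebraic L
  let j : F →ₐ[E] Ω := IsAlgClosed.lift
  refine Subalgebra.LinearDisjoint.isDomain_of_injective (S := Ω)
      (fa := IsScalarTower.toAlgHom E L Ω) (fb := j)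
    (algebraMap L Ω).injective j.injective ?_
  have : Algebra.IsIntegral E j.range := ⟨fun x => by
    obtain ⟨y, hy⟩ := x.2
    rw [← isIntegral_algHom_iff j.range.val Subtype.val_injective]
    have h := (Algebra.IsIntegral.isIntegral (R := E) y).map j
    have hy' : j y = x := hy
    rwa [hy'] at h⟩
  refine Subalgebra.LinearDisjoint.of_linearDisjoint_finite_right _ _ fun B' hB' _ => ?_
  have hB : IsField B' := isField_of_isIntegral_of_isField' (Field.toIsField E)
  let B : IntermediateField E Ω := B'.toIntermediateField' hB
  have : FiniteDimensional E B := inferInstanceAs (Module.Finite E B')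
  suffices h : B.LinearDisjoint L from Subalgebra.LinearDisjoint.symm h
  let pb := Field.powerBasisOfFiniteOfSeparable E B
  refine IntermediateField.LinearDisjoint.of_basis_left pb.basis ?_
  have hg : IsIntegral E (pb.gen : Ω) := pb.isIntegral_gen.map B.val
  have hd : (minpoly L (pb.gen : Ω)).natDegree = pb.dim := by
    rw [natDegree_minpoly_eq_of_isIntegrallyClosedIn hL hg, ← pb.natDegree_minpoly]
    exact congrArg _ (minpoly.algHom_eq B.val B.val.injective pb.gen)
  have := linearIndependent_pow (K := L) (pb.gen : Ω)
  have := this.comp (Fin.cast hd.symm) (Fin.cast_injective _)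
  convert this using 1
  ext i
  simp

namespace EtCov

/-! ### Global functions on normal schemes -/

theorem algebraMap_germ {Y : Scheme.{u}} [IsIntegral Y] {U : Y.Opens} {y : Y} (hy : y ∈ U)
    (hη : genericPoint Y ∈ U) (g : Γ(Y, U)) :
    algebraMap (Y.presheaf.stalk y) Y.functionField ((Y.presheaf.germ U y hy).hom g) =
      (Y.presheaf.germ U (genericPoint Y) hη).hom g := by
  have := Y.presheaf.germ_stalkSpecializes (U := U) hy ((genericPoint_spec Y).specializes trivial)
  exact congr(($this).hom g)

theorem genericPoint_mem {Y : Scheme.{u}} [IsIntegral Y] {U : Y.Opens} {y : Y} (hy : y ∈ U) :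
    genericPoint Y ∈ U := (genericPoint_specializes y).mem_open U.isOpen hy

/-- A rational function that lies in all the local rings of an integral scheme is a global function.
-/
theorem exists_global_of_forall_stalk {Y : Scheme.{u}} [IsIntegral Y] (r : Y.functionField)
    (h : ∀ y : Y, r ∈ (algebraMap (Y.presheaf.stalk y) Y.functionField).range) :
    ∃ g : Γ(Y, ⊤), globFF Y g = r := by
  have hloc : ∀ y : Y, ∃ (U : Y.Opens) (hU : y ∈ U) (g : Γ(Y, U)),
      (Y.presheaf.germ U (genericPoint Y) (genericPoint_mem hU)).hom g = r := by
    intro y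
    obtain ⟨t, ht⟩ := h y
    obtain ⟨U, hyU, g, hg⟩ := Y.presheaf.exists_germ_eq t
    refine ⟨U, hyU, g, ?_⟩
    rw [← ht, ← hg]
    exact (algebraMap_germ hyU _ g).symm
  choose U hU g hg using hloc
  obtain ⟨s, hs, -⟩ := Y.sheaf.existsUnique_gluing' U ⊤ (fun y => homOfLE le_top) (fun y _ =>
    TopologicalSpace.Opens.mem_iSup.mpr ⟨y, hU y⟩) g (by
    intro y z
    have hm : genericPoint Y ∈ U y ⊓ U z := ⟨genericPoint_mem (hU y), genericPoint_mem (hU z)⟩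
    apply germ_injective_of_isIntegral _ (genericPoint Y) hm
    have h1 := Y.presheaf.germ_res_apply (TopologicalSpace.Opens.infLELeft (U y) (U z))
        (genericPoint Y) hm (g y)
    have h2 := Y.presheaf.germ_res_apply (TopologicalSpace.Opens.infLERight (U y) (U z))
        (genericPoint Y) hm (g z)
    exact h1.trans ((hg y).trans ((hg z).symm.trans h2.symm)))
  refine ⟨s, ?_⟩
  let y := genericPoint Y
  have h1 := Y.presheaf.germ_res_apply (homOfLE le_top : U y ⟶ ⊤) (genericPoint Y)
      (genericPoint_mem (hU y)) s
  exact h1.symm.trans ((congrArg _ (hs y)).trans (hg y))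

/-- In an integral scheme with integrally closed stalks, rational functions integral over a ring of
global functions are global. -/
theorem exists_global_of_isIntegralElem {Y : Scheme.{u}} [IsIntegral Y]
    (hY : ∀ y : Y, IsIntegrallyClosed (Y.presheaf.stalk y)) {R : Type u} [CommRing R]
    (c : R →+* Γ(Y, ⊤))
    (r : Y.functionField) (hr : ((globFF Y).comp c).IsIntegralElem r) :
    ∃ g : Γ(Y, ⊤), globFF Y g = r := by
  refine exists_global_of_forall_stalk r fun y => ?_
  have := hY y
  refine IsIntegrallyClosed.isIntegral_iff.mp ?_
  obtain ⟨p, hp, hpr⟩ := hr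
  refine ⟨p.map ((Y.presheaf.germ ⊤ y trivial).hom.comp c), hp.map _, ?_⟩
  rw [Polynomial.eval₂_map]
  convert hpr using 2
  ext x
  exact algebraMap_germ (U := ⊤) trivial trivial (c x)

end EtCov

namespace EtCov

/-! ### Values of functions at points -/

section

variable {F : Type u} [Field F] {Y X : Scheme.{u}}

theorem mem_of_pt_mem {y : Spec (.of F) ⟶ Y} {V : Y.Opens} (h : pt y ∈ V) : ⊤ ≤ y ⁻¹ᵁ V :=
  (Scheme.preimage_eq_top_of_closedPoint_mem (R := .of F) y h).ge

/-- The value of `r` at `y` is the image of `r` in the ring of global functions of `Spec F`. -/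
theorem regVal_iff {y : Spec (.of F) ⟶ Y} {V : Y.Opens} {r : Γ(Y, V)} {v : F} :
    RegVal y V r v ↔ ∃ h : ⊤ ≤ y ⁻¹ᵁ V, (y.appLE V ⊤ h ≫ (Scheme.ΓSpecIso (.of F)).hom).hom r =
    v := by
  have key : ∀ (h : pt y ∈ V) (h' : ⊤ ≤ y ⁻¹ᵁ V),
      Y.presheaf.germ V (pt y) h ≫ Scheme.stalkClosedPointTo y =
      y.appLE V ⊤ h' ≫ (Scheme.ΓSpecIso (.of F)).hom := by
    intro h h'
    refine (Scheme.germ_stalkClosedPointTo y V h).trans ?_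
    simp [Scheme.Hom.appLE]
    rfl
  constructor
  · rintro ⟨h, hv⟩
    exact ⟨mem_of_pt_mem h, by rw [← key h]; exact hv⟩
  · rintro ⟨h, hv⟩
    have hm : pt y ∈ V := h (show IsLocalRing.closedPoint (CommRingCat.of F) ∈
        (⊤ : (Spec (.of F)).Opens) from trivial)
    exact ⟨hm, by rw [← key hm h] at hv; exact hv⟩

theorem RegVal.unique {y : Spec (.of F) ⟶ Y} {V : Y.Opens} {r : Γ(Y, V)} {v w : F}
    (h : RegVal y V r v) (h' : RegVal y V r w) : v = w := by
  obtain ⟨_, rfl⟩ := h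
  obtain ⟨_, rfl⟩ := h'
  rfl

theorem exists_regVal {y : Spec (.of F) ⟶ Y} {V : Y.Opens} (h : pt y ∈ V) (r : Γ(Y, V)) :
    ∃ v, RegVal y V r v := ⟨_, h, rfl⟩

/-- Composing a point with the morphism of `Spec F` given by `σ` applies `σ` to the values. -/
theorem RegVal.twist {y : Spec (.of F) ⟶ Y} {V : Y.Opens} {r : Γ(Y, V)} {v : F} (h : RegVal y V r v)
    (σ : F →+* F) : RegVal (Spec.map (CommRingCat.ofHom σ) ≫ y) V r (σ v) := by
  rw [regVal_iff] at h ⊢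
  obtain ⟨h, rfl⟩ := h
  refine ⟨by rw [Scheme.Hom.comp_preimage]; intro x _; exact h trivial, ?_⟩
  rw [← Scheme.Hom.appLE_comp_appLE _ _ V ⊤ ⊤ h le_top, Category.assoc]
  have : (Spec.map (CommRingCat.ofHom σ)).appLE ⊤ ⊤ le_top ≫ (Scheme.ΓSpecIso (.of F)).hom =
      (Scheme.ΓSpecIso (.of F)).hom ≫ CommRingCat.ofHom σ := by
    rw [← Scheme.ΓSpecIso_naturality, Scheme.Hom.appTop, Scheme.Hom.app_eq_appLE]
    rfl
  rw [this]
  simp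

theorem RegVal.comp {y : Spec (.of F) ⟶ Y} {f : Y ⟶ X} {V : X.Opens} {r : Γ(X, V)} {v : F} :
    RegVal (y ≫ f) V r v ↔ RegVal y (f ⁻¹ᵁ V) ((f.app V).hom r) v := by
  rw [regVal_iff, regVal_iff]
  refine exists_congr fun h => ?_
  rw [Scheme.Hom.comp_appLE]
  simp

/-- Two `F`-points are equal if the functions on an affine neighbourhood of the first have the same
values at both. -/
theorem point_ext_of_isAffineOpen {y y' : Spec (.of F) ⟶ Y} {V : Y.Opens} (hV : IsAffineOpen V)
    (hyV : pt y ∈ V)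
    (h : ∀ r v, RegVal y V r v → RegVal y' V r v) : y = y' := by
  have e := IsAffineOpen.SpecMap_appLE_fromSpec y hV (isAffineOpen_top _) (mem_of_pt_mem hyV)
  obtain ⟨hy'V, -⟩ := h 0 _ ⟨hyV, rfl⟩
  have e' := IsAffineOpen.SpecMap_appLE_fromSpec y' hV (isAffineOpen_top _) (mem_of_pt_mem hy'V)
  rw [← cancel_epi (isAffineOpen_top (Spec (.of F))).fromSpec, ← e, ← e']
  congr 2
  ext r
  have h1 : RegVal y V r _ := regVal_iff.mpr ⟨mem_of_pt_mem hyV, rfl⟩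
  obtain ⟨_, h2⟩ := regVal_iff.mp (h r _ h1)
  have := (ConcreteCategory.bijective_of_isIso (Scheme.ΓSpecIso (.of F)).hom).1
  exact (this h2).symm

/-- An `F`-point is determined by the values of the regular functions. -/
theorem point_ext {y y' : Spec (.of F) ⟶ Y} (h : ∀ V r v, RegVal y V r v → RegVal y' V r v) :
    y = y' := by
  obtain ⟨_, ⟨V, hV, rfl⟩, hyV, -⟩ := Y.isBasis_affineOpens.exists_subset_of_mem_open
    (Set.mem_univ (pt y)) isOpen_univ
  exact point_ext_of_isAffineOpen hV hyV (h V)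

variable [IsIntegral Y]

/-- A rational function has a value at a point iff it is represented by a regular function that
does. -/
theorem ratVal_iff {y : Spec (.of F) ⟶ Y} {r : Y.functionField} {v : F} :
    RatVal y r v ↔ ∃ (V : Y.Opens) (h : genericPoint Y ∈ V) (g : Γ(Y, V)),
      (Y.presheaf.germ V (genericPoint Y) h).hom g = r ∧ RegVal y V g v := by
  constructor
  · rintro ⟨t, rfl, rfl⟩
    obtain ⟨V, hyV, g, rfl⟩ := Y.presheaf.exists_germ_eq t
    exact ⟨V, genericPoint_mem hyV, g, (algebraMap_germ hyV _ g).symm, hyV, rfl⟩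
  · rintro ⟨V, h, g, rfl, hyV, rfl⟩
    exact ⟨_, algebraMap_germ hyV _ g, rfl⟩

theorem RatVal.unique {y : Spec (.of F) ⟶ Y} {r : Y.functionField} {v w : F}
    (h : RatVal y r v) (h' : RatVal y r w) : v = w := by
  obtain ⟨t, rfl, rfl⟩ := h
  obtain ⟨t', ht, rfl⟩ := h'
  rw [IsFractionRing.injective _ _ ht]

theorem RatVal.add {y : Spec (.of F) ⟶ Y} {r s : Y.functionField} {v w : F}
    (h : RatVal y r v) (h' : RatVal y s w) : RatVal y (r + s) (v + w) := by
  obtain ⟨t, rfl, rfl⟩ := h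
  obtain ⟨t', rfl, rfl⟩ := h'
  exact ⟨t + t', map_add _ _ _, map_add _ _ _⟩

theorem RatVal.mul {y : Spec (.of F) ⟶ Y} {r s : Y.functionField} {v w : F}
    (h : RatVal y r v) (h' : RatVal y s w) : RatVal y (r * s) (v * w) := by
  obtain ⟨t, rfl, rfl⟩ := h
  obtain ⟨t', rfl, rfl⟩ := h'
  exact ⟨t * t', map_mul _ _ _, map_mul _ _ _⟩

theorem ratVal_zero (y : Spec (.of F) ⟶ Y) : RatVal y 0 0 := ⟨0, map_zero _, map_zero _⟩

theorem ratVal_one (y : Spec (.of F) ⟶ Y) : RatVal y 1 1 := ⟨1, map_one _, map_one _⟩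

theorem RatVal.twist {y : Spec (.of F) ⟶ Y} {r : Y.functionField} {v : F} (h : RatVal y r v)
    (σ : F →+* F) : RatVal (Spec.map (CommRingCat.ofHom σ) ≫ y) r (σ v) := by
  rw [ratVal_iff] at h ⊢
  obtain ⟨V, hV, g, hg, hv⟩ := h
  exact ⟨V, hV, g, hg, hv.twist σ⟩

theorem ratVal_globFF {y : Spec (.of F) ⟶ Y} {c : Γ(Y, ⊤)} {v : F} (h : RegVal y ⊤ c v) :
    RatVal y (globFF Y c) v := ratVal_iff.mpr ⟨⊤, trivial, c, rfl, h⟩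

variable [IsIntegral X]

theorem pullFF_germ (f : Y ⟶ X) [IsDominant f] {V : X.Opens} (hX : genericPoint X ∈ V)
    (hY : genericPoint Y ∈ f ⁻¹ᵁ V) (g : Γ(X, V)) :
    pullFF f ((X.presheaf.germ V _ hX).hom g) =
    (Y.presheaf.germ (f ⁻¹ᵁ V) _ hY).hom ((f.app V).hom g) := by
  have : X.presheaf.germ V _ hX ≫ X.presheaf.stalkSpecializes
      (specializes_of_eq (map_genericPoint f)) ≫
      f.stalkMap (genericPoint Y) = f.app V ≫ Y.presheaf.germ (f ⁻¹ᵁ V) _ hY := by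
    rw [TopCat.Presheaf.germ_stalkSpecializes_assoc, Scheme.Hom.germ_stalkMap]
  exact congr(($this).hom g)

theorem genericPoint_mem_preimage (f : Y ⟶ X) [IsDominant f] {V : X.Opens}
    (hX : genericPoint X ∈ V) :
    genericPoint Y ∈ f ⁻¹ᵁ V := by
  change f (genericPoint Y) ∈ V
  rwa [map_genericPoint]

theorem RatVal.pull {y : Spec (.of F) ⟶ Y} (f : Y ⟶ X) [IsDominant f] {r : X.functionField} {v : F}
    (h : RatVal (y ≫ f) r v) : RatVal y (pullFF f r) v := by
  rw [ratVal_iff] at h ⊢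
  obtain ⟨V, hV, g, rfl, hv⟩ := h
  exact ⟨f ⁻¹ᵁ V, genericPoint_mem_preimage f hV, _, (pullFF_germ f hV _ g).symm, RegVal.comp.mp hv⟩

theorem pullFF_id (h : IsDominant (𝟙 Y)) : pullFF (𝟙 Y) = RingHom.id _ := by
  ext r
  obtain ⟨V, hV, g, rfl⟩ := Y.presheaf.exists_germ_eq r
  exact (pullFF_germ (𝟙 Y) hV hV g).trans (by simp; rfl)

theorem pullFF_comp {Z : Scheme.{u}} [IsIntegral Z] (f : Y ⟶ X) (g : Z ⟶ Y) [IsDominant f]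
    [IsDominant g]
    (h : IsDominant (g ≫ f)) : pullFF (g ≫ f) = (pullFF g).comp (pullFF f) := by
  ext r
  obtain ⟨V, hV, t, rfl⟩ := X.presheaf.exists_germ_eq r
  have h1 := genericPoint_mem_preimage f hV
  have h2 := genericPoint_mem_preimage g h1
  refine (pullFF_germ (g ≫ f) hV h2 t).trans ?_
  refine .trans ?_ (congrArg (pullFF g) (pullFF_germ f hV h1 t)).symm
  refine .trans ?_ (pullFF_germ g h1 h2 _).symm
  simp
  rfl

end
end EtCov

namespace EtCov

/-! ### Morphisms to affine schemes -/

section SpecHom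
variable {T T' : Scheme.{u}} {R S : Type u} [CommRing R] [CommRing S]

/-- The ring homomorphism corresponding to a morphism to an affine scheme. -/
def specHom (g : T ⟶ Spec (.of R)) : R →+* Γ(T, ⊤) := ((Scheme.ΓSpecIso (.of R)).inv ≫ g.appTop).hom

theorem specHom_injective {g g' : T ⟶ Spec (.of R)} (h : specHom g = specHom g') : g = g' := by
  apply ext_of_isAffine
  have : (Scheme.ΓSpecIso (.of R)).inv ≫ g.appTop = (Scheme.ΓSpecIso (.of R)).inv ≫ g'.appTop :=
      CommRingCat.hom_ext h
  exact (cancel_epi _).mp this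

theorem specHom_comp (h : T' ⟶ T) (g : T ⟶ Spec (.of R)) :
    specHom (h ≫ g) = h.appTop.hom.comp (specHom g) := by
  rw [specHom, Scheme.Hom.comp_appTop]
  rfl

theorem specHom_comp_SpecMap (g : T ⟶ Spec (.of S)) (φ : R →+* S) :
    specHom (g ≫ Spec.map (CommRingCat.ofHom φ)) = (specHom g).comp φ := by
  have h := Scheme.ΓSpecIso_inv_naturality (CommRingCat.ofHom φ)
  rw [specHom, Scheme.Hom.comp_appTop, ← Category.assoc, ← h]
  rfl

theorem specHom_toSpecΓ (φ : R →+* Γ(T, ⊤)) :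
    specHom (T.toSpecΓ ≫ Spec.map (CommRingCat.ofHom φ)) = φ := by
  have h := Scheme.ΓSpecIso_inv_naturality (CommRingCat.ofHom φ)
  rw [specHom, Scheme.Hom.comp_appTop, ← Category.assoc, ← h, Scheme.toSpecΓ_appTop,
    Category.assoc]
  have e : (Scheme.ΓSpecIso Γ(T, ⊤)).inv ≫ (Scheme.ΓSpecIso Γ(T, ⊤)).hom = 𝟙 _ := Iso.inv_hom_id _
  refine (congrArg CommRingCat.Hom.hom ((congrArg (CommRingCat.ofHom φ ≫ ·) e).trans
    (Category.comp_id _))).trans rfl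

theorem specHom_SpecMap (φ : R →+* S) (x : R) :
    (Scheme.ΓSpecIso (.of S)).hom.hom (specHom (Spec.map (CommRingCat.ofHom φ)) x) = φ x := by
  have h := Scheme.ΓSpecIso_inv_naturality (CommRingCat.ofHom φ)
  rw [specHom, ← h]
  have e : (Scheme.ΓSpecIso (.of S)).inv ≫ (Scheme.ΓSpecIso (.of S)).hom = 𝟙 _ := Iso.inv_hom_id _
  exact congr(($e).hom (φ x))

variable {F : Type u} [Field F]

theorem regVal_top_iff {y : Spec (.of F) ⟶ T} {c : Γ(T, ⊤)} {v : F} :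
    RegVal y ⊤ c v ↔ (Scheme.ΓSpecIso (.of F)).hom.hom (y.appTop.hom c) = v := by
  rw [regVal_iff]
  have : (⊤ : (Spec (.of F)).Opens) ≤ y ⁻¹ᵁ ⊤ := le_rfl
  rw [exists_prop_of_true this]
  rw [Scheme.Hom.appTop, Scheme.Hom.app_eq_appLE]
  rfl

/-- An `F`-point `y` of `T` lies over the `F`-point `φ` of `Spec R` iff the functions coming from
`R` have at `y` the values given by `φ`. -/
theorem comp_eq_SpecMap_iff {y : Spec (.of F) ⟶ T} {g : T ⟶ Spec (.of R)} {φ : R →+* F} :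
    y ≫ g = Spec.map (CommRingCat.ofHom φ) ↔ ∀ x, RegVal y ⊤ (specHom g x) (φ x) := by
  simp_rw [regVal_top_iff]
  constructor
  · intro h x
    refine Eq.trans ?_ (specHom_SpecMap φ x)
    rw [← h, specHom_comp]; rfl
  · intro h
    apply specHom_injective
    ext x
    apply (ConcreteCategory.bijective_of_isIso (Scheme.ΓSpecIso (.of F)).hom).1
    rw [specHom_comp]
    exact (h x).trans (specHom_SpecMap φ x).symm
end SpecHom

/-! ### The points of `X_{μ,α}` -/

namespace CoverFamily

variable {k F : Type u} [Field k] [Field F] [Algebra k F] {X : Scheme.{u}} [IsIntegral X]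
  {s : X ⟶ Spec (.of k)} {C : CoverFamily F s}

variable (k F) in
/-- The `k`-structure of `Spec F`. -/
def base : Spec (.of F) ⟶ Spec (.of k) := Spec.map (CommRingCat.ofHom (algebraMap k F))

instance isFinite_π (μ : C.ℳ) : IsFinite (C.π μ) := (C.galois μ).isFinite

instance fact_irreducible (μ : C.ℳ) : Fact (Irreducible (C.f μ)) := ⟨C.irreducible μ⟩

theorem specHom_toConst (μ : C.ℳ) : specHom (C.toConst μ) =
    AdjoinRoot.lift (constants (C.π μ ≫ s)) (C.a μ) (C.a_root μ) := specHom_toSpecΓ _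

theorem toConst_of (μ : C.ℳ) : C.toConst μ ≫ Spec.map (CommRingCat.ofHom (AdjoinRoot.of (C.f μ))) =
    C.π μ ≫ s := by
  apply specHom_injective
  rw [specHom_comp_SpecMap, specHom_toConst]
  exact RingHom.ext fun x => AdjoinRoot.lift_of (C.a_root μ)

theorem embConst_of (i : C.Idx) : C.embConst i
    ≫ Spec.map (CommRingCat.ofHom (AdjoinRoot.of (C.f i.1))) =
    base k F := by
  rw [embConst, ← Spec.map_comp, base]
  congr 1
  ext x
  exact AdjoinRoot.lift_of i.2.2

/-- An `F`-point of the cover lies on `X_{μ,α}` iff it is a point over `k` at which `a` has the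
value `α`. -/
theorem comp_toConst_iff (i : C.Idx) (y : Spec (.of F) ⟶ C.Y i.1) :
    y ≫ C.toConst i.1 = C.embConst i ↔ y ≫ C.π i.1 ≫ s = base k F ∧ RegVal y ⊤ (C.a i.1) i.2.1 := by
  constructor
  · intro h
    refine ⟨by rw [← toConst_of, reassoc_of% h, embConst_of], ?_⟩
    have := comp_eq_SpecMap_iff.mp h (AdjoinRoot.root _)
    rwa [specHom_toConst, AdjoinRoot.lift_root, AdjoinRoot.lift_root] at this
  · rintro ⟨h1, h2⟩
    refine comp_eq_SpecMap_iff.mpr fun x => ?_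
    rw [regVal_top_iff]
    have : ((Scheme.ΓSpecIso (.of F)).hom.hom.comp (y.appTop.hom)).comp (specHom (C.toConst i.1)) =
        AdjoinRoot.lift (algebraMap k F) i.2.1 i.2.2 := by
      apply AdjoinRoot.ringHom_ext
      · ext c
        have := comp_eq_SpecMap_iff.mp h1 c
        rw [regVal_top_iff] at this
        simp only [RingHom.comp_apply, specHom_toConst, AdjoinRoot.lift_of]
        exact this
      · rw [regVal_top_iff] at h2
        simp only [RingHom.comp_apply, specHom_toConst, AdjoinRoot.lift_root]
        exact h2
    exact congr($this x)

namespace Pt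

theorem toY_toConst {i : C.Idx} (z : C.Pt i) : z.toY ≫ C.toConst i.1 = C.embConst i := by
  have h : C.prY i ≫ C.toConst i.1 = C.prF i ≫ C.embConst i := pullback.condition
  rw [toY, Category.assoc, h, reassoc_of% z.2]

theorem toX_s {i : C.Idx} (z : C.Pt i) : z.toX ≫ s = base k F := by
  rw [toX, Category.assoc]; exact ((comp_toConst_iff i _).mp z.toY_toConst).1

theorem regVal_a {i : C.Idx} (z : C.Pt i) : RegVal z.toY ⊤ (C.a i.1) i.2.1 :=
  ((comp_toConst_iff i _).mp z.toY_toConst).2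

theorem ext_toY {i : C.Idx} {z z' : C.Pt i} (h : z.toY = z'.toY) : z = z' :=
  Subtype.ext (pullback.hom_ext h (z.2.trans z'.2.symm))

/-- A point of `X_{μ,α}(F)` from an `F`-point of the cover. -/
def mk' {i : C.Idx} (y : Spec (.of F) ⟶ C.Y i.1) (h : y ≫ C.toConst i.1 = C.embConst i) : C.Pt i :=
  ⟨pullback.lift y (𝟙 _) (by rw [h, Category.id_comp]), pullback.lift_snd _ _ _⟩

@[simp] theorem toY_mk' {i : C.Idx} (y : Spec (.of F) ⟶ C.Y i.1)
    (h : y ≫ C.toConst i.1 = C.embConst i) :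
    (mk' y h).toY = y := pullback.lift_fst _ _ _

end Pt

theorem Inter.toY_onPt {i j : C.Idx} (d : C.Inter i j) (z : C.Pt i) :
    (d.onPt z).toY = z.toY ≫ d.φ := by
  have h : d.map ≫ C.prY j = C.prY i ≫ d.φ := pullback.lift_fst _ _ _
  simp only [Pt.toY, Inter.onPt, Category.assoc, h]

theorem Inter.toX_onPt {i j : C.Idx} (d : C.Inter i j) (z : C.Pt i) : (d.onPt z).toX = z.toX := by
  rw [Pt.toX, toY_onPt, Category.assoc, d.comm, Pt.toX]

theorem GDeck.toX_act {i : C.Idx} (g : C.GDeck i) (z : C.Pt i) : (g.act z).toX = z.toX := by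
  simp only [Pt.toX, Pt.toY, act, Category.assoc, g.2.2]

/-- A morphism of covers maps constants to constants, as it preserves integrality over `k`. -/
theorem exists_const_hom {μ ν : C.ℳ} (φ : C.Y μ ⟶ C.Y ν) (h : φ ≫ C.π ν = C.π μ) :
    ∃ θ : AdjoinRoot (C.f ν) →+* AdjoinRoot (C.f μ),
      φ ≫ C.toConst ν = C.toConst μ ≫ Spec.map (CommRingCat.ofHom θ) := by
  have hc : φ.appTop.hom.comp (constants (C.π ν ≫ s)) = constants (C.π μ ≫ s) := by
    have := specHom_comp φ (C.π ν ≫ s)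
    rw [← Category.assoc, h] at this
    exact this.symm
  obtain ⟨q, hq⟩ := C.a_generates μ (φ.appTop.hom (C.a ν)) ⟨C.f ν, C.monic ν, by
    rw [← hc, ← Polynomial.hom_eval₂, C.a_root, map_zero]⟩
  have hinj : Function.Injective (AdjoinRoot.lift (constants (C.π μ ≫ s)) (C.a μ) (C.a_root μ)) :=
    RingHom.injective _
  have hθ : (C.f ν).eval₂ (AdjoinRoot.of (C.f μ)) (AdjoinRoot.mk (C.f μ) q) = 0 := by
    apply hinj
    rw [Polynomial.hom_eval₂, map_zero, AdjoinRoot.lift_mk, ← hq, AdjoinRoot.lift_comp_of, ← hc,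
      ← Polynomial.hom_eval₂, C.a_root, map_zero]
  refine ⟨AdjoinRoot.lift (AdjoinRoot.of (C.f μ)) (AdjoinRoot.mk (C.f μ) q) hθ, ?_⟩
  apply specHom_injective
  rw [specHom_comp, specHom_comp_SpecMap, specHom_toConst, specHom_toConst]
  apply AdjoinRoot.ringHom_ext
  · ext c
    simp only [RingHom.comp_apply, AdjoinRoot.lift_of]
    exact congr($hc c)
  · simp only [RingHom.comp_apply, AdjoinRoot.lift_root, AdjoinRoot.lift_mk, hq]

/-- Constants are determined by their values at one point, so a morphism of covers carries `X_{μ,α}`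
to `X_{ν,β}` if it does so with one point. -/
theorem carries_of_point {i j : C.Idx} (φ : C.Y i.1 ⟶ C.Y j.1) (h : φ ≫ C.π j.1 = C.π i.1)
    (z : C.Pt i)
    (z' : C.Pt j) (hz : z.toY ≫ φ = z'.toY) :
    (C.prY i ≫ φ) ≫ C.toConst j.1 = C.prF i ≫ C.embConst j := by
  obtain ⟨θ, hθ⟩ := exists_const_hom φ h
  have hi : C.prY i ≫ C.toConst i.1 = C.prF i ≫ C.embConst i := pullback.condition
  have : C.embConst i ≫ Spec.map (CommRingCat.ofHom θ) = C.embConst j := by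
    rw [← z.toY_toConst, Category.assoc, ← hθ, reassoc_of% hz, z'.toY_toConst]
  rw [Category.assoc, hθ, reassoc_of% hi, this]

/-- A morphism of covers that maps a point of `X_{μ,α}` into `X_{ν,β}` is an intermediate morphism.
-/
def Inter.ofPoint {i j : C.Idx} (φ : C.Y i.1 ⟶ C.Y j.1) (h : φ ≫ C.π j.1 = C.π i.1) (z : C.Pt i)
    (z' : C.Pt j) (hz : z.toY ≫ φ = z'.toY) : C.Inter i j := ⟨φ, h, carries_of_point φ h z z' hz⟩

end CoverFamily
end EtCov

namespace EtCov

/-! ### Irreducibility of `X_{μ,α}` -/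

theorem globFF_injective (Y : Scheme.{u}) [IsIntegral Y] : Function.Injective (globFF Y) :=
  germ_injective_of_isIntegral Y (U := ⊤) (genericPoint Y) trivial

/-- The preimage of the generic point under an open morphism meets each nonempty open set, so
irreducibility can be checked on the generic fibre. -/
theorem irreducibleSpace_of_genericFibre {Z Y : Scheme.{u}} [IsIntegral Y] (p : Z ⟶ Y)
    (hp : IsOpenMap p)
    (h : IrreducibleSpace ↥(pullback (Y.fromSpecStalk (genericPoint Y)) p)) :
    IrreducibleSpace Z := by
  let g : pullback (Y.fromSpecStalk (genericPoint Y)) p ⟶ Z := pullback.snd _ _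
  have hr : Set.range g = p ⁻¹' Set.range (Y.fromSpecStalk (genericPoint Y)) :=
    Scheme.Pullback.range_snd _ _
  have hd : Dense (Set.range g) := by
    rw [dense_iff_inter_open]
    intro V hV hne
    obtain ⟨v, hv⟩ : genericPoint Y ∈ p '' V :=
      ((genericPoint_spec Y).mem_open_set_iff (hp V hV)).mpr (by simpa using hne)
    refine ⟨v, hv.1, ?_⟩
    rw [hr, Set.mem_preimage, hv.2, Scheme.range_fromSpecStalk]
    exact specializes_rfl
  have hirr : IsIrreducible (Set.range g) := by
    rw [← Set.image_univ]
    exact (IrreducibleSpace.isIrreducible_univ _).image g g.continuous.continuousOn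
  have := hirr.closure
  rw [hd.closure_eq] at this
  have : Nonempty Z := ⟨this.1.some⟩
  have : PreirreducibleSpace Z := ⟨‹IsIrreducible (Set.univ : Set Z)›.2⟩
  exact ⟨‹_›⟩

theorem etale_SpecMap_algebraMap (k E : Type u) [Field k] [CharZero k] [Field E] [Algebra k E]
    [Module.Finite k E] : Etale (Spec.map (CommRingCat.ofHom (algebraMap k E))) := by
  have : Algebra.FinitePresentation k E := Algebra.FinitePresentation.of_finiteType.mp inferInstance
  have : Algebra.Etale k E := {
    formallyEtale := Algebra.FormallyEtale.of_isSeparable k _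
    finitePresentation := inferInstance }
  rw [HasRingHomProperty.Spec_iff (P := @Etale)]
  exact RingHom.etale_algebraMap.mpr this

theorem isFinite_SpecMap_algebraMap (k E : Type u) [CommRing k] [CommRing E] [Algebra k E]
    [Module.Finite k E] : IsFinite (Spec.map (CommRingCat.ofHom (algebraMap k E))) := by
  rw [IsFinite.SpecMap_iff]
  exact RingHom.finite_algebraMap.mpr ‹_›

namespace CoverFamily

variable {k F : Type u} [Field k] [Field F] [Algebra k F] {X : Scheme.{u}} [IsIntegral X]
  {s : X ⟶ Spec (.of k)} (C : CoverFamily F s)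
variable [CharZero k] [IsAlgClosure k F] [Smooth s]

theorem stalk_Y (μ : C.ℳ) (y : C.Y μ) :
    IsDomain ((C.Y μ).presheaf.stalk y) ∧ IsIntegrallyClosed ((C.Y μ).presheaf.stalk y) :=
  stalk_of_smooth (C.π μ ≫ s) y

/-- Rational functions on a cover that are algebraic over `k` are polynomials in `a`, by normality
of the cover. -/
theorem exists_const_of_isIntegral (μ : C.ℳ) (x : (C.Y μ).functionField)
    (hx : ((globFF (C.Y μ)).comp (constants (C.π μ ≫ s))).IsIntegralElem x) :
    ∃ e : AdjoinRoot (C.f μ), globFF (C.Y μ)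
      (AdjoinRoot.lift (constants (C.π μ ≫ s)) (C.a μ) (C.a_root μ) e) = x := by
  obtain ⟨g, rfl⟩ := exists_global_of_isIntegralElem (fun y => (C.stalk_Y μ y).2) _ x hx
  obtain ⟨q, hq, h0⟩ := hx
  obtain ⟨r, hr⟩ := C.a_generates μ g ⟨q, hq, globFF_injective _ (by
    rw [Polynomial.hom_eval₂, h0, map_zero])⟩
  exact ⟨AdjoinRoot.mk _ r, by rw [AdjoinRoot.lift_mk, ← hr]⟩

/-- The generic fibre of `X_{μ,α} ⟶ Y μ` is the spectrum of the tensor product over `k[a]` of the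
function field of `Y μ` with `F`. It is a domain, since `k[a]` is algebraically closed in that
function field. -/
instance irreducibleSpace_Z (i : C.Idx) : IrreducibleSpace (C.Z i) := by
  have hE : UniversallyOpen (C.embConst i) := inferInstance
  have : UniversallyOpen (C.prY i) :=
    UniversallyOpen.fst (C.toConst i.1) (C.embConst i)
  refine irreducibleSpace_of_genericFibre (C.prY i) (C.prY i).isOpenMap ?_
  let E := AdjoinRoot (C.f i.1)
  let L := (C.Y i.1).functionField
  let lf : E →+* Γ(C.Y i.1, ⊤) := AdjoinRoot.lift (constants (C.π i.1 ≫ s)) (C.a i.1) (C.a_root i.1)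
  let eL : E →+* L := (globFF _).comp lf
  let eF : E →+* F := AdjoinRoot.lift (algebraMap k F) i.2.1 i.2.2
  let : Algebra E L := eL.toAlgebra
  let : Algebra E F := eF.toAlgebra
  let : Algebra k L := ((globFF (C.Y i.1)).comp (constants (C.π i.1 ≫ s))).toAlgebra
  have : IsScalarTower k E L := IsScalarTower.of_algebraMap_eq' (by
    ext c; exact congrArg (globFF _) (AdjoinRoot.lift_of (C.a_root i.1)).symm)
  have : IsScalarTower k E F := IsScalarTower.of_algebraMap_eq' (by
    ext c; exact (AdjoinRoot.lift_of i.2.2).symm)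
  have : CharZero E := charZero_of_injective_algebraMap (algebraMap k E).injective
  have : Algebra.IsAlgebraic k F := IsAlgClosure.isAlgebraic
  have : Algebra.IsAlgebraic E F := Algebra.IsAlgebraic.tower_top (K := k) E
  have hfE : Module.Finite k E := (C.monic i.1).finite_adjoinRoot
  have hdom : IsDomain (L ⊗[E] F) := isDomain_tensor_of_isIntegrallyClosedIn fun x hx => by
    have hx' : IsIntegral k x := isIntegral_trans (R := k) (A := E) x hx
    obtain ⟨e, he⟩ := C.exists_const_of_isIntegral i.1 x hx'
    exact ⟨e, he⟩
  have hgen : (C.Y i.1).fromSpecStalk (genericPoint (C.Y i.1)) ≫ C.toConst i.1 =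
      Spec.map (CommRingCat.ofHom (algebraMap E L)) := by
    rw [toConst, ← Category.assoc, Scheme.fromSpecStalk_toSpecΓ, ← Spec.map_comp]
    rfl
  let e : pullback ((C.Y i.1).fromSpecStalk (genericPoint (C.Y i.1))) (C.prY i) ≅
      Spec (.of (L ⊗[E] F)) :=
    pullbackRightPullbackFstIso _ _ _ ≪≫ pullback.congrHom hgen rfl ≪≫ pullbackSpecIso E L F
  have : IrreducibleSpace (Spec (.of (L ⊗[E] F))) := inferInstance
  exact e.inv.homeomorph.irreducibleSpace_iff.mp this

instance nonempty_pt (i : C.Idx) : Nonempty (C.Pt i) := by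
  have : IsAlgClosed F := IsAlgClosure.isAlgClosed k
  have : LocallyOfFiniteType (C.toConst i.1) := by
    have : LocallyOfFiniteType (C.toConst i.1 ≫
      Spec.map (CommRingCat.ofHom (AdjoinRoot.of (C.f i.1)))) := by
      rw [toConst_of]; infer_instance
    exact locallyOfFiniteType_of_comp _ (Spec.map (CommRingCat.ofHom (AdjoinRoot.of (C.f i.1))))
  have : LocallyOfFiniteType (C.prF i) :=
    inferInstanceAs (LocallyOfFiniteType (pullback.snd (C.toConst i.1) (C.embConst i)))
  obtain ⟨z, hz, -⟩ := exists_point_mem (C.prF i) ⊤ ⟨Classical.arbitrary _, trivial⟩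
  exact ⟨z, hz⟩

/-- The map `X_{μ,α}(F) → X(F)` is surjective: the cover is étale over the base change of `X` to its
field of constants, which is connected. -/
theorem exists_pt_toX [GeometricallyConnected s] (i : C.Idx) (x : Spec (.of F) ⟶ X)
    (hx : x ≫ s = base k F) :
    ∃ z : C.Pt i, z.toX = x := by
  have : IsAlgClosed F := IsAlgClosure.isAlgClosed k
  let e := Spec.map (CommRingCat.ofHom (AdjoinRoot.of (C.f i.1)))
  have : Module.Finite k (AdjoinRoot (C.f i.1)) := (C.monic i.1).finite_adjoinRoot
  have : Etale e := etale_SpecMap_algebraMap k (AdjoinRoot (C.f i.1))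
  have : IsFinite e := isFinite_SpecMap_algebraMap k (AdjoinRoot (C.f i.1))
  let t : C.Y i.1 ⟶ pullback s e := pullback.lift (C.π i.1) (C.toConst i.1) (C.toConst_of i.1).symm
  have h1 : t ≫ pullback.fst s e = C.π i.1 := pullback.lift_fst _ _ _
  have : Etale t := by
    have : Etale (t ≫ pullback.fst s e) := by rw [h1]; infer_instance
    exact Etale.of_comp t (pullback.fst s e)
  have : IsFinite t := by
    have : IsFinite (t ≫ pullback.fst s e) := by rw [h1]; infer_instance
    exact IsFinite.of_comp t (pullback.fst s e)
  have : ConnectedSpace ↥(pullback s e) :=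
    GeometricallyConnected.geometrically_connectedSpace _ _ _ (.of_hasPullback _ _)
  obtain ⟨y, hy⟩ := exists_lift_point t (pullback.lift x (C.embConst i) (by rw [hx, embConst_of]))
  refine ⟨Pt.mk' y ?_, ?_⟩
  · have h2 : t ≫ pullback.snd s e = C.toConst i.1 := pullback.lift_snd _ _ _
    rw [← h2, reassoc_of% hy, pullback.lift_snd]
  · rw [Pt.toX, Pt.toY_mk', ← h1, reassoc_of% hy, pullback.lift_fst]

/-! ### Intermediate morphisms and deck transformations -/

variable {C}

omit [CharZero k] [IsAlgClosure k F] [Smooth s] in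
theorem Z_hom_ext {W : Scheme.{u}} {i : C.Idx} {f g : W ⟶ C.Z i} (h : f ≫ C.prY i = g ≫ C.prY i)
    (h' : f ≫ C.prF i = g ≫ C.prF i) : f = g := pullback.hom_ext h h'

/-- Intermediate morphisms that agree at one point are equal. -/
theorem Inter.φ_eq_of_point {i j : C.Idx} (d d' : C.Inter i j) (z : C.Pt i)
    (h : d.onPt z = d'.onPt z) :
    d.φ = d'.φ := by
  refine hom_ext_of_point (C.π j.1) (d.comm.trans d'.comm.symm) z.toY ?_
  rw [← toY_onPt, h, toY_onPt]

omit [CharZero k] [IsAlgClosure k F] [Smooth s] in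
theorem Inter.ext_φ {i j : C.Idx} {d d' : C.Inter i j} (h : d.φ = d'.φ) : d = d' := by
  cases d; cases d'; cases h; rfl

theorem Inter.ext_of_point {i j : C.Idx} {d d' : C.Inter i j} (z : C.Pt i)
    (h : d.onPt z = d'.onPt z) :
    d = d' := ext_φ (φ_eq_of_point d d' z h)

theorem Inter.onPt_comp {i j l : C.Idx} (d : C.Inter i j) (e : C.Inter j l) (z : C.Pt i) :
    (d.comp e).onPt z = e.onPt (d.onPt z) := by
  apply Pt.ext_toY; rw [toY_onPt, toY_onPt, toY_onPt, comp, Category.assoc]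

theorem Inter.onPt_id {i : C.Idx} (z : C.Pt i) : (Inter.id i).onPt z = z := by
  apply Pt.ext_toY; rw [toY_onPt, Inter.id, Category.comp_id]

/-- Points of the same cover over the same point of `X` are related by an intermediate morphism,
although they may lie on `X_{μ,α}` for different `α`. -/
theorem exists_iso_of_toX_eq {i j : C.Idx} (h : i.1 = j.1) (z : C.Pt i) (z' : C.Pt j)
    (hx : z.toX = z'.toX) :
    ∃ d : C.Inter i j, d.onPt z = z' := by
  obtain ⟨μ, α⟩ := i; obtain ⟨ν, β⟩ := j
  obtain rfl : μ = ν := h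
  obtain ⟨φ, h1, h2⟩ := (C.galois μ).transitive z.toY z'.toY hx
  refine ⟨Inter.ofPoint φ.hom h1 z z' h2, ?_⟩
  exact Pt.ext_toY ((Inter.toY_onPt _ z).trans h2)

/-- Deck transformations that agree at one point are equal. -/
theorem GDeck.ext_of_point {i : C.Idx} {g g' : C.GDeck i} (z : C.Pt i) (h : g.act z = g'.act z) :
    g = g' := by
  have e : g.1.hom ≫ C.prY i = g'.1.hom ≫ C.prY i := by
    refine hom_ext_of_point (C.π i.1) (by simp only [Category.assoc, g.2.2, g'.2.2]) z.1 ?_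
    have := congr(Pt.toY $h)
    simpa only [Pt.toY, GDeck.act, Category.assoc] using this
  refine Subtype.ext (Iso.ext (Z_hom_ext e ?_))
  exact g.2.1.trans g'.2.1.symm

/-- Intermediate endomorphisms are invertible, and induce deck transformations. -/
theorem Inter.exists_gdeck {i : C.Idx} (d : C.Inter i i) :
    ∃ g : C.GDeck i, ∀ z, g.act z = d.onPt z := by
  obtain ⟨z⟩ := C.nonempty_pt i
  obtain ⟨e, he⟩ := exists_iso_of_toX_eq rfl (d.onPt z) z (d.toX_onPt z)
  have hde : d.comp e = Inter.id i := ext_of_point z (by rw [onPt_comp, he, onPt_id])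
  have hed : e.comp d = Inter.id i := ext_of_point (d.onPt z) (by rw [onPt_comp, he, onPt_id])
  have hm : ∀ a b : C.Inter i i, a.comp b = Inter.id i → a.map ≫ b.map = 𝟙 _ := by
    intro a b hab
    have hφ : a.φ ≫ b.φ = 𝟙 _ := congr(($hab).φ)
    have h1 : ∀ d : C.Inter i i, d.map ≫ C.prY i = C.prY i ≫ d.φ := fun _ => pullback.lift_fst _ _ _
    have h2 : ∀ d : C.Inter i i, d.map ≫ C.prF i = C.prF i := fun _ => pullback.lift_snd _ _ _
    apply Z_hom_ext
    · rw [Category.assoc, h1 b, reassoc_of% h1 a, hφ, Category.comp_id, Category.id_comp]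
    · rw [Category.assoc, h2 b, h2 a, Category.id_comp]
  refine ⟨⟨⟨d.map, e.map, hm d e hde, hm e d hed⟩, pullback.lift_snd _ _ _, ?_⟩, fun z => rfl⟩
  have h1 : d.map ≫ C.prY i = C.prY i ≫ d.φ := pullback.lift_fst _ _ _
  rw [reassoc_of% h1, d.comm]

/-- Each deck transformation is induced by a morphism of covers: it moves a point within its fibre
over `X`, and the Galois property gives a morphism of covers that moves it likewise. -/
theorem GDeck.exists_inter {i : C.Idx} (g : C.GDeck i) :
    ∃ d : C.Inter i i, ∀ z, d.onPt z = g.act z := by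
  obtain ⟨z⟩ := C.nonempty_pt i
  obtain ⟨d, hd⟩ := exists_iso_of_toX_eq rfl z (g.act z) (g.toX_act z).symm
  obtain ⟨g', hg'⟩ := d.exists_gdeck
  have : g' = g := ext_of_point z (by rw [hg', hd])
  exact ⟨d, fun z => by rw [← hg', this]⟩

end CoverFamily
end EtCov

namespace EtCov

/-! ### Galois closures -/

section Galois

variable {k F : Type u} [Field k] [Field F] [IsAlgClosed F]

/-- The fibre of a finite morphism over a geometric point is finite. -/
theorem finite_lifts {W X : Scheme.{u}} (p : W ⟶ X) [IsFinite p] (x : Spec (.of F) ⟶ X) :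
    Finite {w : Spec (.of F) ⟶ W // w ≫ p = x} := by
  let q : pullback p x ⟶ Spec (.of F) := pullback.snd p x
  have : Finite ↥(pullback p x) := by
    have := q.finite_preimage_singleton (IsLocalRing.closedPoint F)
    exact Set.finite_univ_iff.mp
      (this.subset fun z _ => Subsingleton.elim (α := PrimeSpectrum F) _ _)
  let l : {w : Spec (.of F) ⟶ W // w ≫ p = x} → (Spec (.of F) ⟶ pullback p x) :=
    fun w => pullback.lift w.1 (𝟙 _) (by rw [w.2, Category.id_comp])
  refine Finite.of_injective (fun w => pt (l w)) fun w w' h => ?_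
  have : l w = l w' := ext_of_apply_closedPoint_eq q (pullback.lift_snd _ _ _)
      (pullback.lift_snd _ _ _) h
  have := congr($this ≫ pullback.fst p x)
  refine Subtype.ext ?_
  rwa [pullback.lift_fst, pullback.lift_fst] at this

omit [IsAlgClosed F] in
/-- The `n`-fold fibre power of a finite étale cover, with its universal property and a prescribed
point. -/
theorem exists_fibrePower {W X : Scheme.{u}} (p : W ⟶ X) [IsFinite p] [Etale p]
    (x : Spec (.of F) ⟶ X) (n : ℕ) (w : Fin n → (Spec (.of F) ⟶ W)) (hw : ∀ j, w j ≫ p = x) :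
    ∃ (V : Scheme.{u}) (q : V ⟶ X) (pr : Fin n → (V ⟶ W)) (v : Spec (.of F) ⟶ V),
      IsFinite q ∧ Etale q ∧ (∀ j, pr j ≫ p = q) ∧ v ≫ q = x ∧ (∀ j, v ≫ pr j = w j) ∧
      (∀ (T : Scheme.{u}) (t : T ⟶ X) (f : Fin n → (T ⟶ W)), (∀ j, f j ≫ p = t) →
        ∃ g : T ⟶ V, g ≫ q = t ∧ ∀ j, g ≫ pr j = f j) ∧
      (∀ (T : Scheme.{u}) (g g' : T ⟶ V), g ≫ q = g' ≫ q → (∀ j, g ≫ pr j = g' ≫ pr j) → g =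
          g') := by
  induction n with
  | zero => exact ⟨X, 𝟙 X, nofun, x, inferInstance, inferInstance, nofun, Category.comp_id _, nofun,
      fun T t f _ => ⟨t, Category.comp_id _, nofun⟩, fun T g g' h _ => by simpa using h⟩
  | succ n ih =>
    obtain ⟨V, q, pr, v, h1, h2, h3, h4, h5, h6, h7⟩ := ih (fun j => w j.succ) (fun j => hw _)
    refine ⟨pullback p q, pullback.snd p q ≫ q, Fin.cons (pullback.fst p q) fun j =>
        pullback.snd p q ≫ pr j,
      pullback.lift (w 0) v (by rw [hw, h4]), inferInstance, inferInstance, ?_, ?_, ?_, ?_, ?_⟩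
    · refine Fin.cases ?_ fun j => ?_
      · exact pullback.condition
      · rw [Fin.cons_succ, Category.assoc, h3]
    · rw [pullback.lift_snd_assoc, h4]
    · refine Fin.cases ?_ fun j => ?_
      · rw [Fin.cons_zero, pullback.lift_fst]
      · rw [Fin.cons_succ, pullback.lift_snd_assoc, h5]
    · intro T t f hf
      obtain ⟨g, hg1, hg2⟩ := h6 T t (fun j => f j.succ) fun j => hf _
      refine ⟨pullback.lift (f 0) g (by rw [hf, hg1]), by rw [pullback.lift_snd_assoc, hg1], ?_⟩
      refine Fin.cases ?_ fun j => ?_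
      · rw [Fin.cons_zero, pullback.lift_fst]
      · rw [Fin.cons_succ, pullback.lift_snd_assoc, hg2]
    · intro T g g' h h'
      refine pullback.hom_ext (h' 0) (h7 _ _ _ (by simpa only [Category.assoc] using h) fun j => ?_)
      simpa only [Category.assoc, Fin.cons_succ] using h' j.succ

variable {X : Scheme.{u}}

/-- Automorphisms of a cover may be replaced by endomorphisms in the definition of a Galois cover,
as these are invertible by rigidity. -/
theorem isGaloisCover_of_hom {N : Scheme.{u}} (f : N ⟶ X) [IsIntegral N] [IsFinite f] [Etale f]
    (h : ∀ y y' : Spec (.of F) ⟶ N, y ≫ f = y' ≫ f → ∃ φ : N ⟶ N, φ ≫ f = f ∧ y ≫ φ = y') :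
    IsGaloisCover F f where
  isIntegral := ‹_›
  isFinite := ‹_›
  etale := ‹_›
  transitive y y' hy := by
    obtain ⟨φ, h1, h2⟩ := h y y' hy
    obtain ⟨ψ, h3, h4⟩ := h y' y hy.symm
    refine ⟨⟨φ, ψ, hom_ext_of_point f ?_ y ?_, hom_ext_of_point f ?_ y' ?_⟩, h1, h2⟩
    · rw [Category.assoc, h3, h1, Category.id_comp]
    · rw [reassoc_of% h2, h4, Category.comp_id]
    · rw [Category.assoc, h1, h3, Category.id_comp]
    · rw [reassoc_of% h4, h2, Category.comp_id]

/-- Every pointed finite étale cover is dominated by a pointed Galois cover: the connected component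
of the point of the fibre power of the cover that enumerates the fibre. -/
theorem exists_galoisClosure (s : X ⟶ Spec (.of k)) [Smooth s] {W : Scheme.{u}} (p : W ⟶ X)
    [IsFinite p] [Etale p] (w : Spec (.of F) ⟶ W) :
    ∃ (N : Scheme.{u}) (f : N ⟶ X) (n : Spec (.of F) ⟶ N) (h : N ⟶ W),
      IsGaloisCover F f ∧ h ≫ p = f ∧ n ≫ h = w := by
  have : IsSeparated p := inferInstance
  have := finite_lifts p (w ≫ p)
  obtain ⟨m, ⟨e⟩⟩ := Finite.exists_equiv_fin {w' : Spec (.of F) ⟶ W // w' ≫ p = w ≫ p}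
  obtain ⟨V, q, pr, v, hq, hq', hpr, hvq, hv, hlift, hext⟩ :=
    exists_fibrePower p (w ≫ p) m (fun j => (e.symm j).1) fun j => (e.symm j).2
  obtain ⟨N, ι, n, hN, hι, hι', hn⟩ := exists_component q s v
  let f := ι ≫ q
  have : IsFinite f := inferInstance
  have : Etale f := inferInstance
  let c : Fin m → (N ⟶ W) := fun j => ι ≫ pr j
  have hc : ∀ j, c j ≫ p = f := fun j => by simp only [c, f, Category.assoc, hpr]
  have hnc : ∀ j, n ≫ c j = (e.symm j).1 := fun j => by simp only [c, reassoc_of% hn, hv]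
  have hnf : n ≫ f = w ≫ p := by simp only [f, reassoc_of% hn, hvq]
  -- The coordinates of each point `y` of `N` exhaust the fibre: the component of `(y, w')` in the fibre
  -- product of `N` and `W` is the graph of a coordinate, since it has a point over `n`.
  have hexh : ∀ (y : Spec (.of F) ⟶ N) (w' : Spec (.of F) ⟶ W), w' ≫ p = y ≫ f → ∃ j, y ≫ c j =
      w' := by
    intro y w' h
    obtain ⟨M, κ, z, hM, hκ, hκ', hz⟩ := exists_component (pullback.fst f p ≫ f) s
      (pullback.lift y w' h.symm)
    let a : M ⟶ N := κ ≫ pullback.fst f p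
    let b : M ⟶ W := κ ≫ pullback.snd f p
    have hab : b ≫ p = a ≫ f := by simp only [a, b, Category.assoc, pullback.condition]
    obtain ⟨z0, hz0⟩ := exists_lift_point a n
    have h0 : (z0 ≫ b) ≫ p = w ≫ p := by rw [Category.assoc, hab, reassoc_of% hz0, hnf]
    have hb : b = a ≫ c (e ⟨z0 ≫ b, h0⟩) := by
      refine hom_ext_of_point p ((hab.trans (by rw [hc])).trans (Category.assoc _ _ _).symm) z0 ?_
      rw [reassoc_of% hz0, hnc, Equiv.symm_apply_apply]
    refine ⟨e ⟨z0 ≫ b, h0⟩, ?_⟩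
    have h1 : z ≫ a = y := by simp only [a, reassoc_of% hz, pullback.lift_fst]
    have h2 : z ≫ b = w' := by simp only [b, reassoc_of% hz, pullback.lift_snd]
    rw [← h1, ← h2, Category.assoc, ← hb]
  refine ⟨N, f, n, c (e ⟨w, rfl⟩), isGaloisCover_of_hom f ?_, hc _,
      by rw [hnc, Equiv.symm_apply_apply]⟩
  intro y y' hy
  -- The automorphism that maps `y` to `y'` permutes the coordinates of the fibre power.
  choose τ hτ using fun j => hexh y (y' ≫ c j) (by rw [Category.assoc, hc, hy])
  obtain ⟨g, hg1, hg2⟩ := hlift N f (fun j => c (τ j)) fun j => hc _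
  have hyg : y ≫ g = y' ≫ ι := by
    refine hext _ _ _ ?_ fun j => ?_
    · rw [Category.assoc, hg1, hy, Category.assoc]
    · rw [Category.assoc, hg2, hτ, Category.assoc]
  have hr : Set.range g ⊆ Set.range ι := by
    have hcl : IsClopen (Set.range ι) :=
        ⟨ι.isClosedEmbedding.isClosed_range, ι.isOpenEmbedding.isOpen_range⟩
    refine (isPreconnected_range g.continuous).subset_isClopen hcl ⟨g (pt y), ⟨_, rfl⟩, pt y', ?_⟩
    have := congr($hyg (IsLocalRing.closedPoint F))
    exact this.symm
  refine ⟨IsOpenImmersion.lift ι g hr, ?_, ?_⟩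
  · exact (IsOpenImmersion.lift_fac_assoc ι g hr q).trans hg1
  · rw [← cancel_mono ι, Category.assoc, IsOpenImmersion.lift_fac, hyg]

end Galois

/-! ### Directedness of the system of covers -/

namespace CoverFamily

variable {k F : Type u} [Field k] [Field F] [Algebra k F] {X : Scheme.{u}} [IsIntegral X]
  {s : X ⟶ Spec (.of k)} (C : CoverFamily F s)

/-- An `F`-point of a cover over `k` lies on `X_{μ,α}` for `α` the value of `a μ` at this point. -/
theorem exists_pt {μ : C.ℳ} (y : Spec (.of F) ⟶ C.Y μ) (hy : y ≫ C.π μ ≫ s = base k F) :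
    ∃ (i : C.Idx) (h : i.1 = μ) (z : C.Pt i), z.toY ≫ eqToHom (by rw [h]) = y := by
  obtain ⟨v, hv⟩ := exists_regVal (y := y) (V := ⊤) trivial (C.a μ)
  have hroot : (C.f μ).eval₂ (algebraMap k F) v = 0 := by
    rw [regVal_top_iff] at hv
    have h := congrArg ((Scheme.ΓSpecIso (.of F)).hom.hom.comp y.appTop.hom) (C.a_root μ)
    rw [Polynomial.hom_eval₂, map_zero] at h
    have e : ((Scheme.ΓSpecIso (.of F)).hom.hom.comp y.appTop.hom).comp (constants (C.π μ ≫ s)) =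
        algebraMap k F := by
      ext c
      have := comp_eq_SpecMap_iff.mp hy c
      rw [regVal_top_iff] at this
      exact this
    rw [e] at h
    rw [← hv]; exact h
  let i : C.Idx := ⟨μ, v, hroot⟩
  have h : y ≫ C.toConst i.1 = C.embConst i := (comp_toConst_iff i y).mpr ⟨hy, hv⟩
  exact ⟨i, rfl, Pt.mk' y h, (Category.comp_id _).trans (Pt.toY_mk' (i := i) y h)⟩

variable [IsAlgClosed F] [Smooth s]

/-- Every pointed finite étale cover of `X` is dominated by some `X_{μ,α}`. -/
theorem exists_dominating {W : Scheme.{u}} (p : W ⟶ X) [IsFinite p] [Etale p] (w : Spec (.of F) ⟶ W)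
    (hw : w ≫ p ≫ s = base k F) :
    ∃ (i : C.Idx) (z : C.Pt i) (h : C.Y i.1 ⟶ W), h ≫ p = C.π i.1 ∧ z.toY ≫ h = w := by
  obtain ⟨N, f, n, h, hN, hp, hn⟩ := exists_galoisClosure s p w
  obtain ⟨μ, φ, hφ⟩ := C.complete N f hN
  have h1 : (n ≫ φ.hom) ≫ C.π μ ≫ s = base k F := by
    rw [Category.assoc, reassoc_of% hφ, ← hw, ← hp, ← hn]; simp only [Category.assoc]
  obtain ⟨i, rfl, z, hz⟩ := C.exists_pt (n ≫ φ.hom) h1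
  refine ⟨i, z, φ.inv ≫ h, ?_, ?_⟩
  · rw [Category.assoc, hp, ← hφ, Iso.inv_hom_id_assoc]
  · have hz' : z.toY = n ≫ φ.hom := (Category.comp_id _).symm.trans hz
    rw [hz', Category.assoc, Iso.hom_inv_id_assoc, hn]

variable {C}

/-- Points of two covers over the same point of `X` come from one point of a common cover: one that
dominates the fibre product. -/
theorem exists_upper_bound {i j : C.Idx} (z : C.Pt i) (z' : C.Pt j) (h : z.toX = z'.toX) :
    ∃ (l : C.Idx) (y : C.Pt l) (d : C.Inter l i) (e : C.Inter l j), d.onPt y = z ∧ e.onPt y =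
    z' := by
  obtain ⟨w, hw1, hw2⟩ : ∃ w : Spec (.of F) ⟶ pullback (C.π i.1) (C.π j.1),
      w ≫ pullback.fst _ _ = z.toY ∧ w ≫ pullback.snd _ _ = z'.toY :=
    ⟨pullback.lift z.toY z'.toY h, pullback.lift_fst _ _ _, pullback.lift_snd _ _ _⟩
  obtain ⟨l, y, f, hf, hy⟩ := C.exists_dominating (pullback.fst (C.π i.1) (C.π j.1) ≫ C.π i.1) w (by
    rw [Category.assoc, reassoc_of% hw1, ← Category.assoc]; exact z.toX_s)
  have h1 : y.toY ≫ f ≫ pullback.fst _ _ = z.toY := by rw [reassoc_of% hy, hw1]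
  have h2 : y.toY ≫ f ≫ pullback.snd _ _ = z'.toY := by rw [reassoc_of% hy, hw2]
  refine ⟨l, y, Inter.ofPoint (f ≫ pullback.fst _ _) (by rw [Category.assoc, hf]) y z h1,
    Inter.ofPoint (f ≫ pullback.snd _ _) (by rw [Category.assoc, ← pullback.condition, hf]) y z' h2,
        ?_, ?_⟩
  · exact Pt.ext_toY ((Inter.toY_onPt _ _).trans h1)
  · exact Pt.ext_toY ((Inter.toY_onPt _ _).trans h2)

variable [CharZero k] [IsAlgClosure k F] [GeometricallyConnected s]

theorem isDirected_idx : IsDirectedOrder C.Idx := by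
  refine ⟨fun i j => ?_⟩
  obtain ⟨z⟩ := C.nonempty_pt i
  obtain ⟨z', hz'⟩ := C.exists_pt_toX j z.toX z.toX_s
  obtain ⟨l, y, d, e, -, -⟩ := exists_upper_bound z z' hz'.symm
  exact ⟨l, ⟨d⟩, ⟨e⟩⟩

variable (C) in
omit [IsAlgClosed F] in
/-- Every element of `F` is a polynomial, over `k`, in some `α` that occurs as an index: base change
of `X` to finite extensions of `k` gives covers with prescribed constants. -/
theorem exists_eval_zero (x : Spec (.of F) ⟶ X) (hx : x ≫ s = base k F) (v : F) :
    ∃ (i : C.Idx) (q : k[X]),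
    q.eval₂ (algebraMap k F) i.2.1 = v := by
  have : IsAlgClosed F := IsAlgClosure.isAlgClosed k
  have : Algebra.IsAlgebraic k F := IsAlgClosure.isAlgebraic
  have hv : IsIntegral k v := Algebra.IsIntegral.isIntegral v
  have : Fact (Irreducible (minpoly k v)) := ⟨minpoly.irreducible hv⟩
  let E := AdjoinRoot (minpoly k v)
  let e := Spec.map (CommRingCat.ofHom (AdjoinRoot.of (minpoly k v)))
  let em : E →+* F := AdjoinRoot.lift (algebraMap k F) v (minpoly.aeval k v)
  have : Module.Finite k E := (minpoly.monic hv).finite_adjoinRoot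
  have : Etale e := etale_SpecMap_algebraMap k E
  have : IsFinite e := isFinite_SpecMap_algebraMap k E
  have he : Spec.map (CommRingCat.ofHom em) ≫ e = base k F := by
    rw [← Spec.map_comp, base]
    congr 1
    ext c
    exact AdjoinRoot.lift_of (minpoly.aeval k v)
  obtain ⟨i, z, h, h1, h2⟩ := C.exists_dominating (pullback.fst s e)
    (pullback.lift x (Spec.map (CommRingCat.ofHom em)) (by rw [hx, he])) (by
      rw [pullback.lift_fst_assoc, hx])
  let t := h ≫ pullback.snd s e
  have ht : t ≫ e = C.π i.1 ≫ s := by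
    rw [← h1, Category.assoc, Category.assoc, pullback.condition]
  obtain ⟨q, hq⟩ := C.a_generates i.1 (specHom t (AdjoinRoot.root _))
      ⟨minpoly k v, minpoly.monic hv, by
    have : constants (C.π i.1 ≫ s) = (specHom t).comp (AdjoinRoot.of _) := by
      rw [← specHom_comp_SpecMap, ht]; rfl
    rw [this, ← Polynomial.hom_eval₂, AdjoinRoot.eval₂_root, map_zero]⟩
  refine ⟨i, q, ?_⟩
  have hz : z.toY ≫ t = Spec.map (CommRingCat.ofHom em) := by
    simp only [t, reassoc_of% h2, pullback.lift_snd]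
  have r1 := comp_eq_SpecMap_iff.mp hz (AdjoinRoot.root _)
  have r2 := comp_eq_SpecMap_iff.mp z.toY_toConst (AdjoinRoot.mk _ q)
  rw [specHom_toConst, AdjoinRoot.lift_mk, AdjoinRoot.lift_mk, ← hq] at r2
  have r3 : em (AdjoinRoot.root _) = v := AdjoinRoot.lift_root _
  rw [r3] at r1
  exact r2.unique r1

end CoverFamily
end EtCov

namespace EtCov

/-! ### Function fields of covers -/

section FunctionField

variable {Y X : Scheme.{u}} [IsIntegral Y] [IsIntegral X]

/-- The generic points of source and target of a dominant morphism form a commutative square. -/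
theorem SpecMap_pullFF (f : Y ⟶ X) [IsDominant f] :
    Spec.map (CommRingCat.ofHom (pullFF f)) ≫ X.fromSpecStalk (genericPoint X) =
      Y.fromSpecStalk (genericPoint Y) ≫ f := by
  rw [← Scheme.SpecMap_stalkMap_fromSpecStalk,
    ← Scheme.SpecMap_stalkSpecializes_fromSpecStalk (specializes_of_eq (map_genericPoint f)),
    ← Category.assoc, ← Spec.map_comp]
  rfl

/-- The fibre of a finite dominant morphism over the generic point is the generic point, as there
are no specializations within a finite fibre. -/
theorem eq_genericPoint (f : Y ⟶ X) [IsFinite f] [IsDominant f] {y : Y} (h : f y = genericPoint X) :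
    y = genericPoint Y := by
  have hd := (f.isDiscrete_preimage_singleton (genericPoint X)).to_subtype
  have : (⟨genericPoint Y, map_genericPoint f⟩ : f ⁻¹' {genericPoint X}) ⤳ ⟨y, h⟩ := by
    rw [Topology.IsInducing.subtypeVal.specializes_iff.symm]
    exact genericPoint_specializes y
  exact congrArg Subtype.val this.eq.symm

/-- A rational function on a finite cover is regular over some nonempty open part of the base: the
complement of the image of its poles. -/
theorem exists_regular_over {F : Type u} [Field F] (f : Y ⟶ X) [IsFinite f] [IsDominant f]
    (r : Y.functionField) : ∃ V : X.Opens, genericPoint X ∈ V ∧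
      ∀ y : Spec (.of F) ⟶ Y, pt (y ≫ f) ∈ V → ∃ v, RatVal y r v := by
  obtain ⟨W, hW, g, rfl⟩ := Y.presheaf.exists_germ_eq r
  have hc : IsClosed (f '' (W : Set Y)ᶜ) := f.isClosedMap _ W.isOpen.isClosed_compl
  refine ⟨⟨_, hc.isOpen_compl⟩, ?_, fun y hy => ?_⟩
  · rintro ⟨y, hy, h⟩
    exact hy (eq_genericPoint f h ▸ hW)
  · have : pt y ∈ W := by
      by_contra h
      exact hy ⟨pt y, h, rfl⟩
    obtain ⟨v, hv⟩ := exists_regVal this g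
    exact ⟨v, ratVal_iff.mpr ⟨W, hW, g, rfl, hv⟩⟩

/-- Finite dominant morphisms induce algebraic extensions of function fields. -/
theorem isAlgebraic_pullFF (f : Y ⟶ X) [IsFinite f] [IsDominant f] :
    letI := (pullFF f).toAlgebra
    Algebra.IsAlgebraic X.functionField Y.functionField := by
  let := (pullFF f).toAlgebra
  obtain ⟨_, ⟨U, hU, rfl⟩, hη, -⟩ := X.isBasis_affineOpens.exists_subset_of_mem_open
    (Set.mem_univ (genericPoint X)) isOpen_univ
  have hV : IsAffineOpen (f ⁻¹ᵁ U) := hU.preimage f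
  have hηV : genericPoint Y ∈ f ⁻¹ᵁ U := genericPoint_mem_preimage f hη
  have : Nonempty (f ⁻¹ᵁ U) := ⟨⟨_, hηV⟩⟩
  have := functionField_isFractionRing_of_isAffineOpen Y _ hV
  have hint : ∀ a : Γ(Y, f ⁻¹ᵁ U), IsAlgebraic X.functionField
      (algebraMap Γ(Y, f ⁻¹ᵁ U) Y.functionField a) := by
    intro a
    obtain ⟨q, hq, h0⟩ := (f.finite_app U hU).to_isIntegral a
    refine IsIntegral.isAlgebraic ⟨q.map (X.presheaf.germ U _ hη).hom, hq.map _, ?_⟩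
    rw [Polynomial.eval₂_map]
    have : (algebraMap X.functionField Y.functionField).comp (X.presheaf.germ U _ hη).hom =
        (algebraMap Γ(Y, f ⁻¹ᵁ U) Y.functionField).comp (f.app U).hom := by
      ext c; exact pullFF_germ f hη hηV c
    rw [this, ← Polynomial.hom_eval₂, h0, map_zero]
  refine ⟨fun r => ?_⟩
  obtain ⟨a, b, hb, rfl⟩ := IsFractionRing.div_surjective (A := Γ(Y, f ⁻¹ᵁ U)) r
  exact (hint a).mul (hint b).inv

end FunctionField

namespace CoverFamily

variable {k F : Type u} [Field k] [Field F] [Algebra k F] {X : Scheme.{u}} [IsIntegral X]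
  {s : X ⟶ Spec (.of k)} {C : CoverFamily F s}

variable (F s) in
/-- Each nonempty open part of a scheme locally of finite type over `k` contains an `F`-point. -/
theorem exists_point_base [IsAlgClosed F] [LocallyOfFiniteType s] (V : X.Opens)
    (hV : genericPoint X ∈ V) :
    ∃ x : Spec (.of F) ⟶ X, x ≫ s = base k F ∧ pt x ∈ V := by
  have hb : Surjective (base k F) := ⟨fun x =>
      ⟨IsLocalRing.closedPoint F, Subsingleton.elim (α := PrimeSpectrum k) _ _⟩⟩
  have hs : Surjective (pullback.fst s (base k F)) := inferInstance
  obtain ⟨z, hz⟩ := hs.1 (genericPoint X)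
  obtain ⟨y, hy, hy'⟩ := exists_point_mem (pullback.snd s (base k F))
      (pullback.fst s (base k F) ⁻¹ᵁ V)
    ⟨z, by change _ ∈ V; rwa [hz]⟩
  refine ⟨y ≫ pullback.fst _ _, ?_, hy'⟩
  rw [Category.assoc, pullback.condition, reassoc_of% hy]

theorem Inter.pullFF_π {i j : C.Idx} (d : C.Inter i j) :
    (pullFF d.φ).comp (pullFF (C.π j.1)) = pullFF (C.π i.1) := by
  have : IsDominant (d.φ ≫ C.π j.1) := by rw [d.comm]; infer_instance
  rw [← pullFF_comp _ _ this]
  simp only [d.comm]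

theorem Inter.pullFF_comp {i j l : C.Idx} (d : C.Inter i j) (e : C.Inter j l) :
    pullFF (d.comp e).φ = (pullFF d.φ).comp (pullFF e.φ) :=
  EtCov.pullFF_comp _ _ (d.comp e).isDominant

theorem Inter.pullFF_id (i : C.Idx) : pullFF (Inter.id i).φ = RingHom.id (C.KK i) :=
  EtCov.pullFF_id (Inter.id i).isDominant

/-- Morphisms of covers of `X` are determined by their effect on rational functions: they agree at
the point of the source with values in the function field. -/
theorem hom_ext_pullFF {μ ν : C.ℳ} {f g : C.Y μ ⟶ C.Y ν} [IsDominant f] [IsDominant g]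
    (h : f ≫ C.π ν = g ≫ C.π ν) (hp : pullFF f = pullFF g) : f = g := by
  refine hom_ext_of_point (F := (C.Y μ).functionField) (C.π ν) h
    ((C.Y μ).fromSpecStalk (genericPoint _)) ?_
  have h1 := SpecMap_pullFF f
  have h2 := SpecMap_pullFF g
  rw [hp] at h1
  exact h1.symm.trans h2

theorem Inter.ext_pullFF {i j : C.Idx} {d e : C.Inter i j} (h : pullFF d.φ = pullFF e.φ) : d = e :=
  Inter.ext_φ (hom_ext_pullFF (d.comm.trans e.comm.symm) h)

variable [IsAlgClosed F] [Smooth s]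

/-- Homomorphisms between the function fields of two covers, the second of which dominates the
first, come from automorphisms of the first cover: they define a point of the fibre product of the
two covers, whose component is the graph of a morphism by rigidity. -/
theorem Inter.exists_of_ringHom [CharZero k] [IsAlgClosure k F] {l i : C.Idx} (d : C.Inter l i)
    (h : C.KK i →+* C.KK l)
    (hh : h.comp (pullFF (C.π i.1)) = pullFF (C.π l.1)) :
    ∃ ψ : C.Y i.1 ≅ C.Y i.1, ψ.hom ≫ C.π i.1 = C.π i.1 ∧ ∃ _ : IsDominant ψ.hom,
      h = (pullFF d.φ).comp (pullFF ψ.hom) := by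
  let ηl : Spec (.of (C.KK l)) ⟶ C.Y l.1 := (C.Y l.1).fromSpecStalk (genericPoint _)
  let ηi : Spec (.of (C.KK i)) ⟶ C.Y i.1 := (C.Y i.1).fromSpecStalk (genericPoint _)
  have hη : (Spec.map (CommRingCat.ofHom h) ≫ ηi) ≫ C.π i.1 = ηl ≫ C.π l.1 := by
    have h1 := SpecMap_pullFF (C.π i.1)
    have h2 := SpecMap_pullFF (C.π l.1)
    rw [← hh, CommRingCat.ofHom_comp, Spec.map_comp, Category.assoc, h1] at h2
    rw [Category.assoc]
    exact h2
  obtain ⟨q, hq1, hq2⟩ : ∃ q : Spec (.of (C.KK l)) ⟶ pullback (C.π l.1) (C.π i.1),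
      q ≫ pullback.fst _ _ = ηl ∧ q ≫ pullback.snd _ _ = Spec.map (CommRingCat.ofHom h) ≫ ηi :=
    ⟨pullback.lift _ _ hη.symm, pullback.lift_fst _ _ _, pullback.lift_snd _ _ _⟩
  obtain ⟨N, ι, n, hN, hι, hι', hn⟩ :=
    exists_component (pullback.fst (C.π l.1) (C.π i.1) ≫ C.π l.1) s q
  let a : N ⟶ C.Y l.1 := ι ≫ pullback.fst _ _
  let b : N ⟶ C.Y i.1 := ι ≫ pullback.snd _ _
  have hab : b ≫ C.π i.1 = a ≫ C.π l.1 := by simp only [a, b, Category.assoc, pullback.condition]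
  obtain ⟨y⟩ := C.nonempty_pt l
  obtain ⟨z, hz⟩ := exists_lift_point a y.toY
  obtain ⟨ψ, hψ, hψz⟩ := (C.galois i.1).transitive (z ≫ a ≫ d.φ) (z ≫ b) (by
    simp only [Category.assoc, d.comm, hab])
  have hb : a ≫ d.φ ≫ ψ.hom = b := by
    refine hom_ext_of_point (C.π i.1) ?_ z ?_
    · simp only [Category.assoc, hψ, d.comm, hab]
    · rw [← hψz]; simp only [Category.assoc]
  have hna : n ≫ a = ηl := by simp only [a, reassoc_of% hn, hq1]
  have hnb : n ≫ b = Spec.map (CommRingCat.ofHom h) ≫ ηi := by simp only [b, reassoc_of% hn, hq2]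
  have hdom : IsDominant ψ.hom := inferInstance
  refine ⟨ψ, hψ, hdom, ?_⟩
  have hdom' : IsDominant (d.φ ≫ ψ.hom) := inferInstance
  have key : Spec.map (CommRingCat.ofHom h) ≫ ηi =
      Spec.map (CommRingCat.ofHom (pullFF (d.φ ≫ ψ.hom))) ≫ ηi := by
    rw [← hnb, ← hb, reassoc_of% hna]
    exact (SpecMap_pullFF _).symm
  have hmono : Mono ηi := inferInstanceAs (Mono ((C.Y i.1).fromSpecStalk (genericPoint _)))
  have := Spec.map_injective ((cancel_mono ηi).mp key)
  rw [← EtCov.pullFF_comp _ _ hdom']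
  exact congr(($this).hom)

end CoverFamily

/-! ### Points of the universal cover -/

namespace CoverFamily.Choices

variable {k F : Type u} [Field k] [Field F] [Algebra k F] {X : Scheme.{u}} [IsIntegral X]
  {s : X ⟶ Spec (.of k)} {C : CoverFamily F s} (D : C.Choices)
  [CharZero k] [IsAlgClosure k F] [Smooth s] [GeometricallyConnected s]

/-- The universal cover surjects onto `X(F)`: a projective limit of finite nonempty fibres is
nonempty. -/
theorem exists_U (x : Spec (.of F) ⟶ X) (hx : x ≫ s = base k F) :
    ∃ u : D.U, ∀ i, (u.1 i).toX = x := by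
  have : IsAlgClosed F := IsAlgClosure.isAlgClosed k
  have := isDirected_idx (C := C)
  let G : C.Idxᵒᵖ ⥤ Type u :=
    { obj := fun i => {z : C.Pt i.unop // z.toX = x}
      map := fun {i j} f => TypeCat.ofHom fun z =>
        ⟨(D.mor i.unop j.unop f.unop.le).onPt z.1, by rw [Inter.toX_onPt, z.2]⟩
      map_id := fun i => by
        ext z
        apply Pt.ext_toY
        refine (Inter.toY_onPt _ _).trans ?_
        rw [D.id]; exact Category.comp_id _
      map_comp := fun {i j l} f g => by
        ext z
        apply Pt.ext_toY
        refine (Inter.toY_onPt _ _).trans ?_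
        refine .trans ?_ (Inter.toY_onPt _ _).symm
        refine .trans ?_ (congrArg (· ≫ _) (Inter.toY_onPt _ _).symm)
        rw [Category.assoc]
        exact congrArg _ (D.comp _ _ _ _ _ _).symm }
  have : ∀ i, Finite (G.obj i) := fun i => by
    have := finite_lifts (C.π i.unop.1) x
    exact Finite.of_injective (β := {w : Spec (.of F) ⟶ C.Y i.unop.1 // w ≫ C.π i.unop.1 = x})
      (fun z => ⟨z.1.toY, z.2⟩) fun z z' h => Subtype.ext (Pt.ext_toY congr(($h).1))
  have : ∀ i, Nonempty (G.obj i) := fun i => by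
    obtain ⟨z, hz⟩ := C.exists_pt_toX i.unop x hx
    exact ⟨⟨z, hz⟩⟩
  obtain ⟨u, hu⟩ := nonempty_sections_of_finite_inverse_system G
  exact ⟨⟨fun i => (u (.op i)).1, fun i j h => congr(Subtype.val $(hu (homOfLE h).op))⟩, fun i =>
      (u (.op i)).2⟩

/-- The components of a point of the universal cover all lie over the same point of `X`. -/
theorem U_toX (u : D.U) (i j : C.Idx) : (u.1 i).toX = (u.1 j).toX := by
  have : IsAlgClosed F := IsAlgClosure.isAlgClosed k
  have := isDirected_idx (C := C)
  obtain ⟨l, hi, hj⟩ := exists_ge_ge i j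
  rw [← u.2 l i hi, ← u.2 l j hj, Inter.toX_onPt, Inter.toX_onPt]

/-- Points of the universal cover exist over each nonempty open part of `X`. -/
theorem exists_U_mem (V : X.Opens) (hV : genericPoint X ∈ V) :
    ∃ u : D.U, ∀ i, pt (u.1 i).toX ∈ V := by
  have : IsAlgClosed F := IsAlgClosure.isAlgClosed k
  obtain ⟨x, hx, hxV⟩ := exists_point_base F s V hV
  obtain ⟨u, hu⟩ := D.exists_U x hx
  exact ⟨u, fun i => by rwa [hu i]⟩

end CoverFamily.Choices
end EtCov

/-! ### Interpretations and automorphism groups -/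

namespace MStr

variable {N M : MStr.{u}}

namespace IsInterpretation

variable {c : Coding N.carrier M} (hc : IsInterpretation c)

/-- The image of an element of the interpreted structure under an automorphism of the ambient one.
-/
def image (σ : M.Aut) {a : N.S} (x : N.carrier a) : N.carrier a :=
  (hc.dom_definable σ.1 σ.2 (hc.surjective x).choose ⟨x, (hc.surjective x).choose_spec⟩).choose

theorem rep_image (σ : M.Aut) {a : N.S} {d : c.Tup a} {x : N.carrier a} (h : c.Rep d x) :
    c.Rep (c.move σ.1 d) (hc.image σ x) := by
  have h' := (hc.dom_definable σ.1 σ.2 (hc.surjective x).choose ⟨x,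
      (hc.surjective x).choose_spec⟩).choose_spec
  obtain ⟨y, hy⟩ := hc.dom_definable σ.1 σ.2 d ⟨x, h⟩
  have := hc.eqv_definable σ.1 σ.2 _ _ x _ _ (hc.surjective x).choose_spec h h' hy
  rw [image, this]
  exact hy

theorem image_eq (σ : M.Aut) {a : N.S} {d : c.Tup a} {x y : N.carrier a} (h : c.Rep d x)
    (hy : c.Rep (c.move σ.1 d) y) : hc.image σ x = y :=
  hc.functional _ _ _ (hc.rep_image σ h) hy

theorem image_mul (σ τ : M.Aut) {a : N.S} (x : N.carrier a) :
    hc.image (σ * τ) x = hc.image σ (hc.image τ x) := by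
  obtain ⟨d, hd⟩ := hc.surjective x
  exact hc.image_eq _ hd (hc.rep_image σ (hc.rep_image τ hd))

theorem image_one {a : N.S} (x : N.carrier a) : hc.image 1 x = x := by
  obtain ⟨d, hd⟩ := hc.surjective x
  exact hc.image_eq _ hd hd

/-- The homomorphism between automorphism groups given by an interpretation. -/
def autHom : M.Aut →* N.Aut where
  toFun σ := ⟨fun a =>
    { toFun := hc.image σ
      invFun := hc.image σ⁻¹
      left_inv := fun x => by rw [← image_mul, inv_mul_cancel, image_one]
      right_inv := fun x => by rw [← image_mul, mul_inv_cancel, image_one] }, fun r t => by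
    choose d hd using fun i => hc.surjective (t i)
    exact hc.rel_definable r σ.1 σ.2 d t _ hd fun i => hc.rep_image σ (hd i)⟩
  map_one' := Subtype.ext <| funext fun a => Equiv.ext fun x => hc.image_one x
  map_mul' σ τ := Subtype.ext <| funext fun a => Equiv.ext fun x => hc.image_mul σ τ x

theorem induces_autHom (σ : M.Aut) : Induces c σ (hc.autHom σ) := fun _ _ h => hc.rep_image σ h

end IsInterpretation

/-- The orbit of a finite tuple is definable, so an automorphism of the induced structure on some
sorts agrees on any finite tuple with the restriction of an automorphism. -/
theorem exists_lift_induced {A : Type u} {e : A → M.S} (σ' : (M.induced e).Aut) {ι : Type*}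
    [Finite ι]
    (w : ι → A) (t : ∀ i, M.carrier (e (w i))) :
    ∃ σ : M.Aut, ∀ i, σ.1 (e (w i)) (t i) = σ'.1 (w i) (t i) := by
  obtain ⟨n, ⟨f⟩⟩ := Finite.exists_equiv_fin ι
  let R : (∀ j : Fin n, M.carrier (e (w (f.symm j)))) → Prop :=
    fun t' => ∃ σ : M.Aut, ∀ j, σ.1 _ (t (f.symm j)) = t' j
  have hR : M.Definable (fun j => e (w (f.symm j))) R := by
    intro σ hσ t'
    constructor
    · rintro ⟨σ₁, h⟩
      refine ⟨(⟨σ, hσ⟩ : M.Aut) * σ₁, fun j => ?_⟩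
      exact congrArg (σ _) (h j)
    · rintro ⟨σ₁, h⟩
      refine ⟨⟨σ, hσ⟩⁻¹ * σ₁, fun j => ?_⟩
      exact (congrArg (σ _).symm (h j)).trans (Equiv.symm_apply_apply _ _)
  obtain ⟨σ, hσ⟩ := (σ'.2 ⟨⟨n, fun j => w (f.symm j), R⟩, hR⟩ fun j => t (f.symm j)).mp ⟨1, fun _ =>
      rfl⟩
  refine ⟨σ, fun i => ?_⟩
  obtain ⟨j, rfl⟩ := f.symm.surjective i
  exact hσ j

/-- An automorphism of the image of an embedding agrees on any finite tuple with one that is induced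
by an automorphism of the ambient structure. -/
theorem exists_lift_interpreted {c : Coding N.carrier M} (hc : IsInterpretation c)
    (hc' : IsEmbedding c)
    (τ : N.Aut) {ι : Type*} [Finite ι] (w : ι → N.S) (t : ∀ i, N.carrier (w i)) :
    ∃ σ : M.Aut, ∀ i, hc.image σ (t i) = τ.1 (w i) (t i) := by
  obtain ⟨n, ⟨f⟩⟩ := Finite.exists_equiv_fin ι
  let R : (∀ j : Fin n, N.carrier (w (f.symm j))) → Prop :=
    fun t' => ∃ σ : M.Aut, ∀ j, hc.image σ (t (f.symm j)) = t' j
  have hR : c.DefRel (fun j => w (f.symm j)) R := by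
    intro σ hσ d x y hx hy
    have hxy : ∀ j, hc.image ⟨σ, hσ⟩ (x j) = y j := fun j => hc.image_eq ⟨σ, hσ⟩ (hx j) (hy j)
    constructor
    · rintro ⟨σ₁, h⟩
      exact ⟨⟨σ, hσ⟩ * σ₁, fun j => by rw [hc.image_mul, h, hxy]⟩
    · rintro ⟨σ₁, h⟩
      exact ⟨⟨σ, hσ⟩⁻¹ * σ₁, fun j => by
        rw [hc.image_mul, h, ← hxy, ← hc.image_mul, inv_mul_cancel, hc.image_one]⟩
  obtain ⟨σ, hσ⟩ := (hc' n _ R hR τ.1 τ.2 fun j => t (f.symm j)).mp ⟨1, fun _ => hc.image_one _⟩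
  refine ⟨σ, fun i => ?_⟩
  obtain ⟨j, rfl⟩ := f.symm.surjective i
  exact hσ j

/-- A structure that carries all relations induced from `M` is embedded, by definition. -/
theorem isEmbedding_interpreted {A : Type u} {car : A → Type u} (c : Coding car M) :
    IsEmbedding (N := c.interpreted) c := by
  intro n w R hR τ hτ t
  exact hτ ⟨⟨n, w, R⟩, hR⟩ t

/-- A coding in some of the sorts, considered as a coding in the whole structure. -/
def Coding.extend {A B : Type u} {car : B → Type u} {e : A → M.S} (c : Coding car (M.induced e)) :
    Coding car M where
  idx := c.idx
  len := c.len
  srt := fun a i j => e (c.srt a i j)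
  codes := c.codes

/-- An interpretation that uses only some sorts of `M` is an interpretation in the structure induced
on these sorts. This involves finite tuples of codes, on which automorphisms of the induced
structure agree with automorphisms of `M`. -/
theorem isInterpretation_of_extend {A : Type u} {e : A → M.S} {c : Coding N.carrier (M.induced e)}
    (h : IsInterpretation c.extend) : IsInterpretation c where
  functional d x y hx hy := h.functional (c := c.extend) d x y hx hy
  surjective x := h.surjective (c := c.extend) x
  dom_definable σ' hσ' a d hd := by
    obtain ⟨σ, hσ⟩ := exists_lift_induced ⟨σ', hσ'⟩ (c.srt a d.1) d.2
    have e1 : c.move σ' d = c.extend.move σ.1 d := congrArg (Sigma.mk d.1)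
        (funext fun j => (hσ j).symm)
    rw [e1]
    exact h.dom_definable (c := c.extend) σ.1 σ.2 d hd
  eqv_definable σ' hσ' a d d' x y y' hx hx' hy hy' := by
    obtain ⟨σ, hσ⟩ := exists_lift_induced ⟨σ', hσ'⟩ (Sum.elim (c.srt a d.1) (c.srt a d'.1))
      (fun i => i.rec d.2 d'.2)
    have e1 : c.move σ' d = c.extend.move σ.1 d :=
      congrArg (Sigma.mk d.1) (funext fun j => (hσ (.inl j)).symm)
    have e2 : c.move σ' d' = c.extend.move σ.1 d' :=
      congrArg (Sigma.mk d'.1) (funext fun j => (hσ (.inr j)).symm)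
    rw [e1] at hy; rw [e2] at hy'
    exact h.eqv_definable (c := c.extend) σ.1 σ.2 d d' x y y' hx hx' hy hy'
  rel_definable r σ' hσ' d x y hx hy := by
    obtain ⟨σ, hσ⟩ := exists_lift_induced ⟨σ', hσ'⟩
      (fun p : Σ i, Fin (c.len (N.srt r i) (d i).1) => c.srt _ (d p.1).1 p.2)
          (fun p => (d p.1).2 p.2)
    have e1 : ∀ i, c.move σ' (d i) = c.extend.move σ.1 (d i) := fun i =>
      congrArg (Sigma.mk (d i).1) (funext fun j => (hσ ⟨i, j⟩).symm)
    refine h.rel_definable r σ.1 σ.2 d x y hx fun i => ?_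
    have := hy i
    rwa [e1] at this

theorem isEmbedding_of_extend {A : Type u} {e : A → M.S} {c : Coding N.carrier (M.induced e)}
    (h : IsEmbedding c.extend) : IsEmbedding c := by
  intro n w R hR
  exact h n w R fun σ hσ d x y hx hy =>
      hR (M.restrict e ⟨σ, hσ⟩).1 (M.restrict e ⟨σ, hσ⟩).2 d x y hx hy

end MStr

namespace EtCov.CoverFamily

variable {k F : Type u} [Field k] [Field F] [Algebra k F] {X : Scheme.{u}} [IsIntegral X]
  {s : X ⟶ Spec (.of k)}

theorem nonempty_idx (C : CoverFamily F s) [IsAlgClosure k F] [Smooth s] : Nonempty C.Idx := by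
  have : IsAlgClosed F := IsAlgClosure.isAlgClosed k
  obtain ⟨x, hx, -⟩ := exists_point_base F s ⊤ trivial
  obtain ⟨i, -⟩ := C.exists_dominating (𝟙 X) x (by rw [Category.id_comp, hx])
  exact ⟨i⟩

namespace Choices

variable {C : CoverFamily F s} (D : C.Choices)

/-! ### The field `K̃` -/

theorem toKtilde_trans {i j : C.Idx} (h : i ≤ j) (r : C.KK i) :
    D.toKtilde j (D.trans i j h r) = D.toKtilde i r := Ring.DirectLimit.of_f h r

theorem directedSystem : DirectedSystem C.KK (fun i j h => D.trans i j h) where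
  map_self i x := by
    have h : D.mor i i le_rfl = Inter.id i := Inter.ext_φ (D.id i le_rfl)
    change pullFF (D.mor i i le_rfl).φ x = x
    simp only [h, Inter.pullFF_id, RingHom.id_apply]
  map_map l j i hij hjl x := by
    have h : (D.mor l j hjl).comp (D.mor j i hij) = D.mor l i (hij.trans hjl) :=
      Inter.ext_φ (D.comp _ _ _ _ _ _)
    change pullFF (D.mor l j hjl).φ (pullFF (D.mor j i hij).φ x) =
        pullFF (D.mor l i (hij.trans hjl)).φ x
    rw [← h, Inter.pullFF_comp, RingHom.comp_apply]

variable [CharZero k] [IsAlgClosure k F] [Smooth s] [GeometricallyConnected s]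

theorem isDirectedOrder_idx : IsDirectedOrder C.Idx :=
  have : IsAlgClosed F := IsAlgClosure.isAlgClosed k
  isDirected_idx

/-- The ring `K̃` is a directed limit of fields. -/
theorem isField_Ktilde : IsField D.Ktilde := by
  have := isDirectedOrder_idx (C := C)
  have := C.nonempty_idx
  have := D.directedSystem
  have hn := Field.DirectLimit.nontrivial C.KK (fun i j h => D.trans i j h)
  exact ⟨hn.exists_pair_ne, mul_comm, fun {x} hx => Field.DirectLimit.exists_inv C.KK _ hx⟩

theorem toKtilde_injective (i : C.Idx) : Function.Injective (D.toKtilde i) := by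
  have : Nontrivial D.Ktilde := D.isField_Ktilde.nontrivial
  exact (D.toKtilde i).injective

theorem exists_toKtilde (x : D.Ktilde) : ∃ i r, D.toKtilde i r = x := by
  have := isDirectedOrder_idx (C := C)
  have := C.nonempty_idx
  exact Ring.DirectLimit.exists_of x

theorem toKtilde_const (i j : C.Idx) (c : X.functionField) :
    D.toKtilde i (pullFF (C.π i.1) c) = D.toKtilde j (pullFF (C.π j.1) c) := by
  have := isDirectedOrder_idx (C := C)
  obtain ⟨l, hi, hj⟩ := exists_ge_ge i j
  rw [← D.toKtilde_trans hi, ← D.toKtilde_trans hj]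
  have hi' := congr($((D.mor l i hi).pullFF_π) c)
  have hj' := congr($((D.mor l j hj).pullFF_π) c)
  exact congrArg (D.toKtilde l) (hi'.trans hj'.symm)

/-- The embedding of the function field of `X` into `K̃`. -/
def coeff : X.functionField →+* D.Ktilde :=
  (D.toKtilde C.nonempty_idx.some).comp (pullFF (C.π _))

theorem coeff_eq (i : C.Idx) (c : X.functionField) :
    D.coeff c = D.toKtilde i (pullFF (C.π i.1) c) :=
  D.toKtilde_const _ _ c

/-! ### Generic points of the universal cover -/

omit [CharZero k] [IsAlgClosure k F] [Smooth s] [GeometricallyConnected s] in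
/-- A statement holds for generic points of the universal cover if it holds for the points over
some nonempty open part of `X`. -/
def generic : Filter D.U where
  sets := {S | ∃ V : X.Opens, genericPoint X ∈ V ∧ ∀ u : D.U, (∀ i, pt (u.1 i).toX ∈ V) → u ∈ S}
  univ_sets := ⟨⊤, trivial, fun _ _ => trivial⟩
  sets_of_superset := fun ⟨V, hV, h⟩ hST => ⟨V, hV, fun u hu => hST (h u hu)⟩
  inter_sets := fun ⟨V, hV, h⟩ ⟨V', hV', h'⟩ =>
    ⟨V ⊓ V', ⟨hV, hV'⟩, fun u hu => ⟨h u fun i => (hu i).1, h' u fun i => (hu i).2⟩⟩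

instance : D.generic.NeBot := by
  refine ⟨fun h => ?_⟩
  obtain ⟨V, hV, h⟩ := Filter.empty_mem_iff_bot.mpr h
  obtain ⟨u, hu⟩ := D.exists_U_mem V hV
  exact h u hu

/-- A rational function on `X_{μ,α}` is regular on the whole fibre over a generic point of `X`, in
particular at the images of a generic `u` under all `g ∘ 𝐩_{μ,α}`. -/
theorem eventually_ratVal (i : C.Idx) (r : C.KK i) :
    ∀ᶠ u in D.generic, ∀ z : C.Pt i, z.toX = (u.1 i).toX → ∃ v, RatVal z.toY r v := by
  obtain ⟨V, hV, h⟩ := exists_regular_over (F := F) (C.π i.1) r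
  refine ⟨V, hV, fun u hu z hz => h z.toY ?_⟩
  change pt z.toX ∈ V
  rw [hz]; exact hu i

theorem eventually_ratVal_toX (c : X.functionField) :
    ∀ᶠ u in D.generic, ∀ i, ∃ v, RatVal (u.1 i).toX c v := by
  obtain ⟨V, hV, h⟩ := exists_regular_over (F := F) (𝟙 X) c
  refine ⟨V, hV, fun u hu i => h _ ?_⟩
  rw [Category.comp_id]; exact hu i

/-! ### Values of elements of `K̃` -/

/-- The element `x` of `K̃` is regular at the point `u` of the universal cover, and has the
value `v` there. -/
def Val (u : D.U) (x : D.Ktilde) (v : F)  : Prop :=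
  ∃ i r, D.toKtilde i r = x ∧ RatVal (u.1 i).toY r v

theorem ratVal_trans {u : D.U} {i j : C.Idx} (h : i ≤ j) {r : C.KK i} {v : F}
    (hv : RatVal (u.1 i).toY r v) :
    RatVal (u.1 j).toY (D.trans i j h r) v := by
  rw [← u.2 j i h, Inter.toY_onPt] at hv
  exact hv.pull _

variable {D}

/-- Two elements with values at `u` come with representatives at a common level. -/
theorem Val.common {u : D.U} {x y : D.Ktilde} {v w : F} (hx : D.Val u x v) (hy : D.Val u y w) :
    ∃ i r r', D.toKtilde i r = x ∧ D.toKtilde i r' = y ∧ RatVal (u.1 i).toY r v ∧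
    RatVal (u.1 i).toY r' w := by
  have := isDirectedOrder_idx (C := C)
  obtain ⟨i, r, rfl, hr⟩ := hx
  obtain ⟨j, r', rfl, hr'⟩ := hy
  obtain ⟨l, hi, hj⟩ := exists_ge_ge i j
  exact ⟨l, _, _, D.toKtilde_trans hi r, D.toKtilde_trans hj r', D.ratVal_trans hi hr,
      D.ratVal_trans hj hr'⟩

theorem Val.unique {u : D.U} {x : D.Ktilde} {v w : F} (h : D.Val u x v) (h' : D.Val u x w) :
    v = w := by
  obtain ⟨i, r, r', h1, h2, hv, hw⟩ := h.common h'
  obtain rfl : r = r' := D.toKtilde_injective i (h1.trans h2.symm)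
  exact hv.unique hw

theorem Val.add {u : D.U} {x y : D.Ktilde} {v w : F} (h : D.Val u x v) (h' : D.Val u y w) :
    D.Val u (x + y) (v + w) := by
  obtain ⟨i, r, r', rfl, rfl, hv, hw⟩ := h.common h'
  exact ⟨i, _, map_add _ _ _, hv.add hw⟩

theorem Val.mul {u : D.U} {x y : D.Ktilde} {v w : F} (h : D.Val u x v) (h' : D.Val u y w) :
    D.Val u (x * y) (v * w) := by
  obtain ⟨i, r, r', rfl, rfl, hv, hw⟩ := h.common h'
  exact ⟨i, _, map_mul _ _ _, hv.mul hw⟩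

theorem RatVal.val {u : D.U} {i : C.Idx} {r : C.KK i} {v : F} (h : RatVal (u.1 i).toY r v) :
    D.Val u (D.toKtilde i r) v := ⟨i, r, rfl, h⟩

variable (D)

theorem val_zero (u : D.U) : D.Val u 0 0 :=
  ⟨C.nonempty_idx.some, 0, map_zero _, ratVal_zero _⟩

theorem val_one (u : D.U) : D.Val u 1 1 :=
  ⟨C.nonempty_idx.some, 1, map_one _, ratVal_one _⟩

theorem eventually_val (x : D.Ktilde) : ∀ᶠ u in D.generic, ∃ v, D.Val u x v := by
  obtain ⟨i, r, rfl⟩ := D.exists_toKtilde x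
  filter_upwards [D.eventually_ratVal i r] with u hu
  obtain ⟨v, hv⟩ := hu _ rfl
  exact ⟨v, RatVal.val hv⟩

/-- Elements of `K̃` are determined by their values at generic points. -/
theorem eq_of_val {x y : D.Ktilde} (h : ∃ᶠ u in D.generic, ∃ v, D.Val u x v ∧ D.Val u y v) :
    x = y := by
  by_contra hxy
  obtain ⟨z, hz⟩ := D.isField_Ktilde.mul_inv_cancel (sub_ne_zero.mpr hxy)
  obtain ⟨u, ⟨v, hx, hy⟩, ⟨w, hw⟩, a, ha⟩ := (h.and_eventually
    ((D.eventually_val (x - y)).and (D.eventually_val z))).exists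
  have h1 : v = w + v := hx.unique (by simpa using hw.add hy)
  have h2 : w * a = 1 := (hw.mul ha).unique (by rw [hz]; exact D.val_one u)
  have h3 : w = 0 := by simpa using h1
  rw [h3, zero_mul] at h2
  exact zero_ne_one h2

theorem val_coeff {u : D.U} {i : C.Idx} {c : X.functionField} {v : F} (h : RatVal (u.1 i).toX c v) :
    D.Val u (D.coeff c) v := by
  rw [D.coeff_eq i]
  exact RatVal.val (h.pull _)

/-- The generator of the constants of a cover has constant values. -/
theorem ratVal_a {i : C.Idx} (z : C.Pt i) : RatVal z.toY (globFF (C.Y i.1) (C.a i.1)) i.2.1 :=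
  ratVal_globFF z.regVal_a

/-! ### The maps `g ∘ 𝐩_{μ,α}` -/

variable {D}

/-- The elements of `p̃_{μ,α}` are compositions of projections with morphisms of covers. -/
theorem P.exists_inter {i : C.Idx} (p : D.P i) :
    ∃ d : C.Inter i i, ∀ u, p.1 u = d.onPt (u.1 i) := by
  obtain ⟨g, hg⟩ := p.2
  obtain ⟨d, hd⟩ := g.exists_inter
  exact ⟨d, fun u => by rw [hg, hd]⟩

/-- The morphism of covers which defines an element of `p̃_{μ,α}`. -/
def P.inter {i : C.Idx} (p : D.P i) : C.Inter i i := p.exists_inter.choose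

theorem P.apply_eq {i : C.Idx} (p : D.P i) (u : D.U) : p.1 u = p.inter.onPt (u.1 i) :=
  p.exists_inter.choose_spec u

theorem P.toX_apply {i : C.Idx} (p : D.P i) (u : D.U) : (p.1 u).toX = (u.1 i).toX := by
  rw [p.apply_eq, Inter.toX_onPt]

variable (D) in
/-- The element of `p̃_{μ,α}` given by a morphism of covers. -/
def P.ofInter {i : C.Idx} (d : C.Inter i i) : D.P i :=
  ⟨fun u => d.onPt (u.1 i), d.exists_gdeck.choose, fun _ => (d.exists_gdeck.choose_spec _).symm⟩

theorem P.ext_inter {i : C.Idx} {p q : D.P i} (h : p.inter = q.inter) : p = q := by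
  apply Subtype.ext
  funext u
  rw [p.apply_eq, q.apply_eq, h]

variable (D) in
theorem nonempty_U : Nonempty D.U := (Filter.nonempty_of_neBot D.generic)

theorem P.inter_ofInter {i : C.Idx} (d : C.Inter i i) : (P.ofInter D d).inter = d := by
  obtain ⟨u⟩ := D.nonempty_U
  refine Inter.ext_of_point (u.1 i) ?_
  rw [← P.apply_eq]; rfl

instance P.nonempty (i : C.Idx) : Nonempty (D.P i) := ⟨P.ofInter D (Inter.id i)⟩

instance P.finite (i : C.Idx) : Finite (D.P i) := by
  have : IsAlgClosed F := IsAlgClosure.isAlgClosed k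
  obtain ⟨z⟩ := C.nonempty_pt i
  have := finite_lifts (C.π i.1) z.toX
  refine Finite.of_injective (β := {w : Spec (.of F) ⟶ C.Y i.1 // w ≫ C.π i.1 = z.toX})
    (fun p => ⟨(p.inter.onPt z).toY, p.inter.toX_onPt z⟩) fun p q h => ?_
  exact P.ext_inter (Inter.ext_of_point z (Pt.ext_toY congr(($h).1)))

end Choices
end EtCov.CoverFamily

namespace EtCov

theorem RatVal.pow {F : Type u} [Field F] {Y : Scheme.{u}} [IsIntegral Y] {y : Spec (.of F) ⟶ Y}
    {r : Y.functionField} {v : F}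
    (h : RatVal y r v) (n : ℕ) : RatVal y (r ^ n) (v ^ n) := by
  induction n with
  | zero => simpa using ratVal_one y
  | succ n ih => rw [pow_succ, pow_succ]; exact ih.mul h

theorem RatVal.sum {F : Type u} [Field F] {Y : Scheme.{u}} [IsIntegral Y] {y : Spec (.of F) ⟶ Y}
    {ι : Type*}
    (t : Finset ι) {r : ι → Y.functionField} {v : ι → F} (h : ∀ i ∈ t, RatVal y (r i) (v i)) :
    RatVal y (∑ i ∈ t, r i) (∑ i ∈ t, v i) := by
  classical
  induction t using Finset.induction_on with
  | empty => simpa using ratVal_zero y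
  | insert i t hi ih =>
    rw [Finset.sum_insert hi, Finset.sum_insert hi]
    exact (h i (Finset.mem_insert_self _ _)).add (ih fun j hj => h j (Finset.mem_insert_of_mem hj))

theorem RatVal.prod {F : Type u} [Field F] {Y : Scheme.{u}} [IsIntegral Y] {y : Spec (.of F) ⟶ Y}
    {ι : Type*}
    (t : Finset ι) {r : ι → Y.functionField} {v : ι → F} (h : ∀ i ∈ t, RatVal y (r i) (v i)) :
    RatVal y (∏ i ∈ t, r i) (∏ i ∈ t, v i) := by
  classical
  induction t using Finset.induction_on with
  | empty => simpa using ratVal_one y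
  | insert i t hi ih =>
    rw [Finset.prod_insert hi, Finset.prod_insert hi]
    exact (h i (Finset.mem_insert_self _ _)).mul (ih fun j hj => h j (Finset.mem_insert_of_mem hj))

namespace CoverFamily.Choices

variable {k F : Type u} [Field k] [Field F] [Algebra k F] {X : Scheme.{u}} [IsIntegral X]
  {s : X ⟶ Spec (.of k)} {C : CoverFamily F s} (D : C.Choices)
variable [CharZero k] [IsAlgClosure k F] [Smooth s] [GeometricallyConnected s]

/-! ### Formal terms as rational functions -/

/-- The rational function `b ∘ p`, more precisely the `r` with `r ∘ 𝐩_{μ,α} = b ∘ p`. -/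
def bFun {i : C.Idx} (p : D.P i) : C.KK i := pullFF p.inter.φ (D.b i.1)

/-- Evaluation of terms at `a` and the functions `b ∘ p_j`. -/
def termFun (i : C.Idx) {N : Type*} (p : N → D.P i) :
    MvPolynomial (Option N) X.functionField →+* C.KK i :=
  MvPolynomial.eval₂Hom (pullFF (C.π i.1)) fun o => o.elim (globFF (C.Y i.1) (C.a i.1)) fun j =>
      D.bFun (p j)

theorem termFun_rename {i : C.Idx} {N : Type*} (p : N → D.P i)
    (T : MvPolynomial (Option N) X.functionField) :
    D.termFun i _root_.id (MvPolynomial.rename (Option.map p) T) = D.termFun i p T := by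
  refine (MvPolynomial.eval₂_rename _ _ _ _).trans ?_
  refine congrArg (fun g => MvPolynomial.eval₂ _ g T) (funext fun o => ?_)
  cases o <;> rfl

/-- The term `T(α, p_1, …, p_N)` is defined at the point `u` of the universal cover and takes the
value `v` there. -/
def TermVal (u : D.U) (i : C.Idx) {N : Type*} (p : N → D.P i)
    (T : MvPolynomial (Option N) X.functionField)
    (v : F) : Prop :=
  ∃ (c : (Option N →₀ ℕ) → F) (w : N → F), (∀ m ∈ T.support, RatVal (u.1 i).toX (T.coeff m) (c m)) ∧
    (∀ j, RatVal ((p j).1 u).toY (D.b i.1) (w j)) ∧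
    ∑ m ∈ T.support, c m * m.prod (fun o e => (o.elim i.2.1 w) ^ e) = v

variable {D}

/-- The value of a term is the value of the rational function which it defines. -/
theorem TermVal.ratVal {u : D.U} {i : C.Idx} {N : Type*} {p : N → D.P i}
    {T : MvPolynomial (Option N) X.functionField}
    {v : F} (h : D.TermVal u i p T v) : RatVal (u.1 i).toY (D.termFun i p T) v := by
  obtain ⟨c, w, hc, hw, rfl⟩ := h
  have e : D.termFun i p T = ∑ m ∈ T.support, pullFF (C.π i.1) (T.coeff m) *
      ∏ o ∈ m.support, (o.elim (globFF (C.Y i.1) (C.a i.1)) fun j => D.bFun (p j)) ^ m o :=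
    MvPolynomial.eval₂_eq _ _ _
  rw [e]
  refine RatVal.sum _ fun m hm => ((hc m hm).pull _).mul (RatVal.prod _ fun o _ => RatVal.pow ?_ _)
  cases o with
  | none => exact ratVal_a _
  | some j =>
    have := hw j
    rw [(p j).apply_eq, Inter.toY_onPt] at this
    exact this.pull _

theorem eventually_termVal {i : C.Idx} {N : Type*} (p : N → D.P i)
    (T : MvPolynomial (Option N) X.functionField) :
    ∀ᶠ u in D.generic, ∃ v, D.TermVal u i p T v := by
  have h1 : ∀ᶠ u in D.generic, ∀ m ∈ T.support, ∀ i, ∃ v, RatVal (u.1 i).toX (T.coeff m) v :=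
    (Filter.eventually_all_finset _).mpr fun m _ => D.eventually_ratVal_toX _
  filter_upwards [h1, D.eventually_ratVal i (D.b i.1)] with u hu hb
  choose! c hc using fun m hm => hu m hm i
  choose w hw using fun j => hb ((p j).1 u) ((p j).toX_apply u)
  exact ⟨_, c, w, hc, hw, rfl⟩

variable (D)

/-- A term vanishes iff the rational function which it defines is zero. -/
theorem termFun_eq_zero_iff {i : C.Idx} {T : MvPolynomial (Option (D.P i)) X.functionField} :
    D.termFun i _root_.id T = 0 ↔ D.Vanishes i T := by
  constructor
  · intro h u c v hc hv
    have h' : D.TermVal u i _root_.id T _ := ⟨c, v, hc, hv, rfl⟩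
    exact h'.ratVal.unique (h ▸ ratVal_zero _)
  · intro h
    apply D.toKtilde_injective i
    rw [map_zero]
    refine D.eq_of_val (Filter.Eventually.frequently ?_)
    filter_upwards [eventually_termVal _root_.id T] with u ⟨v, hv⟩
    have ⟨c, w, hc, hw, hcw⟩ := hv
    have h0 := h u c w hc hw
    refine ⟨v, RatVal.val hv.ratVal, ?_⟩
    rw [← hcw, h0]
    exact D.val_zero u

/-- All elements of the function field are polynomials in `a` and `b` over the function field of
`X`, over which they are algebraic. -/
theorem termFun_surjective (i : C.Idx) : Function.Surjective (D.termFun i _root_.id) := by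
  let _ := (pullFF (C.π i.1)).toAlgebra
  have := isAlgebraic_pullFF (C.π i.1)
  let A : Subalgebra X.functionField (C.Y i.1).functionField :=
    { (D.termFun i _root_.id).range with
      algebraMap_mem' := fun c => ⟨MvPolynomial.C c, MvPolynomial.eval₂Hom_C _ _ _⟩ }
  have hA : IsField A := A.isField_of_algebraic
  let B : Subfield (C.Y i.1).functionField :=
    { A.toSubring with
      inv_mem' := fun x hx => by
        by_cases h0 : x = 0
        · rw [h0, inv_zero]; exact A.zero_mem
        · obtain ⟨y, hy⟩ := hA.mul_inv_cancel (a := ⟨x, hx⟩) fun h => h0 congr(($h).1)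
          rw [inv_eq_of_mul_eq_one_right (b := y.1) congr(($hy).1)]
          exact y.2 }
  have hB : B = ⊤ := by
    rw [eq_top_iff, ← D.b_generates i.1, Subfield.closure_le]
    rintro x (⟨c, rfl⟩ | rfl | rfl)
    · exact ⟨MvPolynomial.C c, MvPolynomial.eval₂Hom_C _ _ _⟩
    · exact ⟨MvPolynomial.X none, MvPolynomial.eval₂Hom_X' _ _ _⟩
    · refine ⟨MvPolynomial.X (some (P.ofInter D (Inter.id i))),
          (MvPolynomial.eval₂Hom_X' _ _ _).trans ?_⟩
      change pullFF (P.ofInter D (Inter.id i)).inter.φ (D.b i.1) = _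
      rw [P.inter_ofInter, Inter.pullFF_id, RingHom.id_apply]
  intro x
  have : x ∈ B := hB ▸ trivial
  exact this

/-- The canonical isomorphism of the ring of formal terms with the function field of the cover. -/
def termIso (i : C.Idx) : D.PP i ≃+* C.KK i :=
  (Ideal.quotEquivOfEq (by
    have : {T | D.Vanishes i T} = ↑(RingHom.ker (D.termFun i _root_.id)) := by
      ext T; exact D.termFun_eq_zero_iff.symm
    rw [this, Ideal.span_eq])).trans
  (RingHom.quotientKerEquivOfSurjective (D.termFun_surjective i))

theorem isCanonical_termIso : D.IsCanonical D.termIso where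
  map_const i c := MvPolynomial.eval₂Hom_C _ _ _
  map_alpha i := MvPolynomial.eval₂Hom_X' _ _ _
  map_p i p u v w hv hw := by
    have e : D.termIso i (D.term i (MvPolynomial.X (some p))) = D.bFun p :=
        MvPolynomial.eval₂Hom_X' _ _ _
    rw [e] at hw
    rw [p.apply_eq, Inter.toY_onPt] at hv
    exact (hv.pull _).unique hw

end CoverFamily.Choices
end EtCov

namespace EtCov

theorem pt_twist {F : Type u} [Field F] {Y : Scheme.{u}} (σ : F →+* F) (y : Spec (.of F) ⟶ Y) :
    pt (Spec.map (CommRingCat.ofHom σ) ≫ y) = pt y :=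
  congrArg y (Subsingleton.elim (α := PrimeSpectrum F) _ _)

theorem RatVal.congr_point {F : Type u} [Field F] {Y : Scheme.{u}} [IsIntegral Y]
    {y y' : Spec (.of F) ⟶ Y}
    {r : Y.functionField} {v : F} (h : RatVal y r v) (e : y = y') : RatVal y' r v := e ▸ h

namespace CoverFamily

variable {k F : Type u} [Field k] [Field F] [Algebra k F] {X : Scheme.{u}} [IsIntegral X]
  {s : X ⟶ Spec (.of k)} {C : CoverFamily F s}

/-! ### Tuples and points -/

/-- A point of `⨆_α X_{μ,α}(F)` is determined by the underlying point of the cover. -/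
theorem sigma_pt_ext {μ : C.ℳ} {x y : Σ α : C.Zeros μ, C.Pt ⟨μ, α⟩} (h : x.2.toY = y.2.toY) :
    x = y := by
  obtain ⟨α, x⟩ := x
  obtain ⟨β, y⟩ := y
  obtain rfl : α = β := by
    have h1 := x.regVal_a
    have h2 := y.regVal_a
    rw [← h] at h2
    exact Subtype.ext (h1.unique h2)
  exact congrArg (Sigma.mk α) (Pt.ext_toY h)

namespace Choices

variable {D : C.Choices}

section Tuples

variable {w : Fin 3 → CovSort C.ℳ} {w' : Fin 2 → CovSort C.ℳ} {w'' : Fin 1 → CovSort C.ℳ}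

variable (D) in
/-- A triple as a tuple of elements of sorts. -/
def triple (x : D.carrier (w 0)) (y : D.carrier (w 1)) (z : D.carrier (w 2)) :
    ∀ i, D.carrier (w i) :=
  Fin.cons x (Fin.cons y (Fin.cons z finZeroElim))

variable (D) in
/-- A pair as a tuple of elements of sorts. -/
def pair (x : D.carrier (w' 0)) (y : D.carrier (w' 1)) : ∀ i, D.carrier (w' i) :=
  Fin.cons x (Fin.cons y finZeroElim)

variable (D) in
/-- An element as a one-element tuple. -/
def single (x : D.carrier (w'' 0)) : ∀ i, D.carrier (w'' i) := Fin.cons x finZeroElim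

end Tuples

/-! ### Automorphisms of `X̃^et(F)` -/

section Aut

variable (σ : D.Xet.Aut)

/-- The field automorphism of `F` underlying an automorphism of `X̃^et(F)`. -/
def autF : F ≃ₐ[k] F :=
  AlgEquiv.ofRingEquiv (f :=
    { (σ.1 CovSort.F : Equiv.Perm F) with
      map_add' := fun x y =>
        ((σ.2 Rel.add (D.triple (w := srt .add) x y (x + y : F))).mp rfl).symm
      map_mul' := fun x y =>
        ((σ.2 Rel.mul (D.triple (w := srt .mul) x y (x * y : F))).mp rfl).symm })
    fun c => (σ.2 (Rel.const c) (D.single (w'' := srt (.const c)) (algebraMap k F c))).mp rfl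

/-- The action of an automorphism on the universal cover. -/
def autU : Equiv.Perm D.U := σ.1 CovSort.U

/-- The action of an automorphism on points of covers. -/
def autX (μ : C.ℳ) : Equiv.Perm (Σ α : C.Zeros μ, C.Pt ⟨μ, α⟩) := σ.1 (CovSort.X μ)

/-- The action of an automorphism on `p̃_μ`. -/
def autP (μ : C.ℳ) : Equiv.Perm (Σ α : C.Zeros μ, D.P ⟨μ, α⟩) := σ.1 (CovSort.p μ)

/-- The action of an automorphism on deck transformations. -/
def autG (μ : C.ℳ) : Equiv.Perm (Σ α : C.Zeros μ, C.GDeck ⟨μ, α⟩) := σ.1 (CovSort.G μ)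

theorem regVal_autX {μ : C.ℳ} {x : Σ α : C.Zeros μ, C.Pt ⟨μ, α⟩} {V : (C.Y μ).Opens}
    {r : Γ(C.Y μ, V)}
    {v : F} (h : RegVal x.2.toY V r v) : RegVal (autX σ μ x).2.toY V r (autF σ v) :=
  (σ.2 (Rel.reg μ V r) (D.pair (w' := srt (.reg μ V r)) x v)).mp h

/-- Automorphisms of `X̃^et(F)` act on points through the action on `F`, since points are determined
by the values of regular functions. -/
theorem toY_autX {μ : C.ℳ} (x : Σ α : C.Zeros μ, C.Pt ⟨μ, α⟩) :
    (autX σ μ x).2.toY = Spec.map (CommRingCat.ofHom (autF σ : F →+* F)) ≫ x.2.toY := by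
  refine (point_ext fun V r w h => ?_).symm
  have hV : pt x.2.toY ∈ V := by
    obtain ⟨h, -⟩ := h
    rwa [pt_twist] at h
  obtain ⟨v, hv⟩ := exists_regVal hV r
  rw [h.unique (hv.twist (autF σ : F →+* F))]
  exact regVal_autX σ hv

theorem fst_autP {μ : C.ℳ} (p : Σ α : C.Zeros μ, D.P ⟨μ, α⟩) : (autP σ μ p).1.1 = autF σ p.1.1 :=
  (σ.2 (Rel.mem μ) (D.pair (w' := srt (.mem μ)) p p.1.1)).mp rfl

/-- Automorphisms respect the relation `p(u) = x`. -/
theorem autX_apply {μ : C.ℳ} (p : Σ α : C.Zeros μ, D.P ⟨μ, α⟩) (u : D.U) :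
    autX σ μ ⟨p.1, p.2.1 u⟩ = ⟨(autP σ μ p).1, (autP σ μ p).2.1 (autU σ u)⟩ :=
  (σ.2 (Rel.phi μ) (D.triple (w := srt (.phi μ)) p u ⟨p.1, p.2.1 u⟩)).mp rfl

theorem toY_autP {μ : C.ℳ} {p p' : Σ α : C.Zeros μ, D.P ⟨μ, α⟩} (h : autP σ μ p = p') (u : D.U) :
    (p'.2.1 (autU σ u)).toY = Spec.map (CommRingCat.ofHom (autF σ : F →+* F)) ≫ (p.2.1 u).toY := by
  subst h
  rw [← toY_autX σ ⟨p.1, p.2.1 u⟩, autX_apply]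

theorem autX_deck {μ : C.ℳ} {α : C.Zeros μ} (g : C.GDeck ⟨μ, α⟩) (z : C.Pt ⟨μ, α⟩) :
    ∃ (β : C.Zeros μ) (g' : C.GDeck ⟨μ, β⟩) (z' : C.Pt ⟨μ, β⟩), autG σ μ ⟨α, g⟩ = ⟨β, g'⟩ ∧
      autX σ μ ⟨α, z⟩ = ⟨β, z'⟩ ∧ autX σ μ ⟨α, g.act z⟩ = ⟨β, g'.act z'⟩ :=
  (σ.2 (Rel.deck μ) (D.triple (w := srt (.deck μ)) ⟨α, g⟩ ⟨α, z⟩ ⟨α, g.act z⟩)).mp ⟨α, g, z, rfl,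
      rfl, rfl⟩

variable [CharZero k] [IsAlgClosure k F] [Smooth s] [GeometricallyConnected s]

theorem toX_autU (u : D.U) (i : C.Idx) :
    ((autU σ u).1 i).toX = Spec.map (CommRingCat.ofHom (autF σ : F →+* F)) ≫ (u.1 i).toX := by
  obtain ⟨p⟩ := P.nonempty (D := D) i
  have h := toY_autP σ (μ := i.1) (p := ⟨i.2, p⟩) rfl u
  have h' := congrArg (· ≫ C.π i.1) h
  have h1 := P.toX_apply (autP σ i.1 ⟨i.2, p⟩).2 (autU σ u)
  have h2 := P.toX_apply p u
  rw [D.U_toX _ _ ⟨i.1, (autP σ i.1 ⟨i.2, p⟩).1⟩, ← h1, ← h2]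
  exact h'.trans (Category.assoc _ _ _)

/-- Automorphisms preserve generic points, as they do not move the underlying points of the scheme
`X`. -/
theorem tendsto_autU : Filter.Tendsto (autU σ) D.generic D.generic := by
  rintro S ⟨V, hV, h⟩
  refine ⟨V, hV, fun u hu => h _ fun i => ?_⟩
  rw [toX_autU, pt_twist]
  exact hu i

/-- Automorphisms carry values of terms to values of the image terms, with the same coefficients. -/
theorem TermVal.aut {u : D.U} {μ : C.ℳ} {α β : C.Zeros μ} {N : Type*} {p : N → D.P ⟨μ, α⟩}
    {p' : N → D.P ⟨μ, β⟩}
    {T : MvPolynomial (Option N) X.functionField} {v : F} (h : D.TermVal u ⟨μ, α⟩ p T v)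
    (hβ : β.1 = autF σ α.1) (hp : ∀ j, autP σ μ ⟨α, p j⟩ = ⟨β, p' j⟩) :
    D.TermVal (autU σ u) ⟨μ, β⟩ p' T (autF σ v) := by
  obtain ⟨c, w, hc, hw, rfl⟩ := h
  refine ⟨fun m => autF σ (c m), fun j => autF σ (w j), fun m hm => ?_, fun j => ?_, ?_⟩
  · have := (hc m hm).twist (autF σ : F →+* F)
    exact this.congr_point ((toX_autU σ u ⟨μ, α⟩).symm.trans (D.U_toX _ _ ⟨μ, β⟩))
  · have := (hw j).twist (autF σ : F →+* F)
    rw [← toY_autP σ (hp j) u] at this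
    exact this
  · rw [map_sum]
    refine Finset.sum_congr rfl fun m _ => ?_
    rw [map_mul, Finsupp.prod, Finsupp.prod, map_prod]
    congr 1
    refine Finset.prod_congr rfl fun o _ => ?_
    rw [map_pow]
    congr 1
    cases o with
    | none => exact hβ
    | some j => rfl

theorem Val.congr {u : D.U} {x y : D.Ktilde} {v : F} (h : D.Val u x v) (e : x = y) :
    D.Val u y v := e ▸ h

/-- The automorphism carries values of `x` to values of `y`. For each `x` there is at most one such
`y`, which makes this a way to speak of the action of `σ` on `K̃` before it is known to exist. -/
def Transports (x y : D.Ktilde) : Prop :=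
  ∀ᶠ u in D.generic, ∃ v, D.Val u x v ∧ D.Val (autU σ u) y (autF σ v)

variable {σ}

theorem Transports.right_unique {x y y' : D.Ktilde} (h : Transports σ x y)
    (h' : Transports σ x y') : y = y' := by
  refine D.eq_of_val ((tendsto_autU σ).frequently (p := fun u => ∃ v, D.Val u y v ∧ D.Val u y' v)
    (Filter.Eventually.frequently ?_))
  filter_upwards [h, h'] with u ⟨v, h1, h2⟩ ⟨v', h3, h4⟩
  rw [h3.unique h1] at h4
  exact ⟨_, h2, h4⟩

theorem Transports.left_unique {x x' y : D.Ktilde} (h : Transports σ x y) (h' : Transports σ x' y) :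
    x = x' := by
  refine D.eq_of_val (Filter.Eventually.frequently ?_)
  filter_upwards [h, h'] with u ⟨v, h1, h2⟩ ⟨v', h3, h4⟩
  rw [(autF σ).injective (h4.unique h2)] at h3
  exact ⟨_, h1, h3⟩

theorem Transports.eq_iff {x x' y y' : D.Ktilde} (h : Transports σ x y) (h' : Transports σ x' y') :
    x = x' ↔ y = y' :=
  ⟨fun e => (e ▸ h).right_unique h', fun e => (e ▸ h).left_unique h'⟩

theorem Transports.add {x x' y y' : D.Ktilde} (h : Transports σ x y) (h' : Transports σ x' y') :
    Transports σ (x + x') (y + y') := by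
  filter_upwards [h, h'] with u ⟨v, h1, h2⟩ ⟨v', h3, h4⟩
  exact ⟨v + v', h1.add h3, by rw [map_add]; exact h2.add h4⟩

theorem Transports.mul {x x' y y' : D.Ktilde} (h : Transports σ x y) (h' : Transports σ x' y') :
    Transports σ (x * x') (y * y') := by
  filter_upwards [h, h'] with u ⟨v, h1, h2⟩ ⟨v', h3, h4⟩
  exact ⟨v * v', h1.mul h3, by rw [map_mul]; exact h2.mul h4⟩

variable (σ) in
theorem transports_coeff (c : X.functionField) : Transports σ (D.coeff c) (D.coeff c) := by
  obtain ⟨i⟩ := C.nonempty_idx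
  filter_upwards [D.eventually_ratVal_toX c] with u hu
  obtain ⟨v, hv⟩ := hu i
  have := hv.twist (autF σ : F →+* F)
  rw [← toX_autU] at this
  exact ⟨v, D.val_coeff hv, D.val_coeff this⟩

/-! ### The interpretation of the formal terms -/

variable (D) in
/-- The presentation of `P_X` by formal terms in `X̃^et(F)`. -/
def codingXet : MStr.Coding D.PX.carrier D.Xet := D.termCoding D.Xet CovSort.p (fun _ x => x)

/-- The element of `K̃` given by an element of `P_μ`. -/
def toK {μ : C.ℳ} (y : Σ α : C.Zeros μ, D.PP ⟨μ, α⟩) : D.Ktilde :=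
  D.toKtilde ⟨μ, y.1⟩ (D.termIso ⟨μ, y.1⟩ y.2)

theorem toK_term {μ : C.ℳ} {α : C.Zeros μ} {N : Type*} (p : N → D.P ⟨μ, α⟩)
    (T : MvPolynomial (Option N) X.functionField) :
    toK ⟨α, D.term ⟨μ, α⟩ (MvPolynomial.rename (Option.map p) T)⟩ =
      D.toKtilde ⟨μ, α⟩ (D.termFun ⟨μ, α⟩ p T) :=
  congrArg (D.toKtilde _) (D.termFun_rename p T)

/-- Within one `P_{μ,α}`, elements are determined by their images in `K̃`. -/
theorem toK_inj {μ : C.ℳ} {y y' : Σ α : C.Zeros μ, D.PP ⟨μ, α⟩} (h : y.1 = y'.1)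
    (h' : toK y = toK y') : y = y' := by
  obtain ⟨α, y⟩ := y
  obtain ⟨β, y'⟩ := y'
  obtain rfl : α = β := h
  exact congrArg (Sigma.mk α) ((D.termIso _).injective (D.toKtilde_injective _ h'))

variable (σ) in
/-- Automorphisms that move codes of `y` to codes of `y'` transport `y` to `y'`; so `y'` depends
only on `y`. -/
theorem transports_of_rep {μ : C.ℳ} {d : D.codingXet.Tup μ} {y y' : Σ α : C.Zeros μ, D.PP ⟨μ, α⟩}
    (h : D.codingXet.Rep d y) (h' : D.codingXet.Rep (D.codingXet.move σ.1 d) y') :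
    y'.1.1 = autF σ y.1.1 ∧ Transports σ (toK y) (toK y') := by
  obtain ⟨⟨N, T⟩, t⟩ := d
  obtain ⟨hN, α, p, hp, rfl⟩ := h
  obtain ⟨-, β, p', hp', rfl⟩ := h'
  have hj : ∀ j, autP σ μ ⟨α, p j⟩ = ⟨β, p' j⟩ := fun j =>
      (congrArg (autP σ μ) (hp j)).symm.trans (hp' j)
  have hβ : β.1 = autF σ α.1 := by
    have := fst_autP σ ⟨α, p ⟨0, hN⟩⟩
    rw [hj] at this
    exact this
  refine ⟨hβ, ?_⟩
  filter_upwards [eventually_termVal p T] with u ⟨v, hv⟩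
  refine ⟨v, ?_, ?_⟩
  · exact (RatVal.val hv.ratVal).congr (toK_term p T).symm
  · exact (RatVal.val (hv.aut σ hβ hj).ratVal).congr (toK_term p' T).symm

/-- Every class of formal terms has a code, whose tuple enumerates the finite set `p̃_{μ,α}`. -/
theorem exists_rep {μ : C.ℳ} (y : Σ α : C.Zeros μ, D.PP ⟨μ, α⟩) :
    ∃ d : D.codingXet.Tup μ, D.codingXet.Rep d y := by
  obtain ⟨α, q⟩ := y
  obtain ⟨T, rfl⟩ := Ideal.Quotient.mk_surjective q
  have := P.finite (D := D) ⟨μ, α⟩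
  obtain ⟨N, ⟨e⟩⟩ := Finite.exists_equiv_fin (D.P ⟨μ, α⟩)
  obtain ⟨p0⟩ := P.nonempty (D := D) ⟨μ, α⟩
  refine ⟨⟨⟨N, MvPolynomial.rename (Option.map e) T⟩, fun j => ⟨α, e.symm j⟩⟩, Fin.pos (e p0), α,
      e.symm, fun _ => rfl, ?_⟩
  refine congrArg (Sigma.mk α) ?_
  rw [MvPolynomial.rename_rename, Option.map_comp_map, Equiv.symm_comp_self, Option.map_id,
      MvPolynomial.rename_id]
  rfl

variable (D) in
theorem isInterpretation_codingXet : MStr.IsInterpretation D.codingXet where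
  functional := by
    rintro μ ⟨⟨N, T⟩, t⟩ x y ⟨hN, α, p, hp, rfl⟩ ⟨-, β, p', hp', rfl⟩
    obtain rfl : α = β := congrArg Sigma.fst ((hp ⟨0, hN⟩).symm.trans (hp' ⟨0, hN⟩))
    obtain rfl : p = p' := funext fun j => eq_of_heq (Sigma.mk.inj ((hp j).symm.trans (hp' j))).2
    rfl
  surjective y := exists_rep y
  dom_definable := by
    rintro σ hσ μ ⟨⟨N, T⟩, t⟩ ⟨x, hN, α, p, hp, rfl⟩
    -- The images of the `p j` belong to the same `p̃_{μ,β}`, with `β = σ α`.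
    let β := (autP ⟨σ, hσ⟩ μ ⟨α, p ⟨0, hN⟩⟩).1
    have h : ∀ j, ∃ q : D.P ⟨μ, β⟩, autP ⟨σ, hσ⟩ μ ⟨α, p j⟩ = ⟨β, q⟩ := by
      intro j
      have hβ : (autP ⟨σ, hσ⟩ μ ⟨α, p j⟩).1 = β :=
        Subtype.ext ((fst_autP ⟨σ, hσ⟩ ⟨α, p j⟩).trans (fst_autP ⟨σ, hσ⟩ ⟨α, p ⟨0, hN⟩⟩).symm)
      generalize autP ⟨σ, hσ⟩ μ ⟨α, p j⟩ = y at hβ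
      obtain ⟨γ, q⟩ := y
      obtain rfl : γ = β := hβ
      exact ⟨q, rfl⟩
    choose q hq using h
    exact ⟨_, hN, β, q, fun j => (congrArg (autP ⟨σ, hσ⟩ μ) (hp j)).trans (hq j), rfl⟩
  eqv_definable σ hσ μ d d' x y y' hx hx' hy hy' := by
    have h := transports_of_rep ⟨σ, hσ⟩ hx hy
    have h' := transports_of_rep ⟨σ, hσ⟩ hx' hy'
    exact toK_inj (Subtype.ext (h.1.trans h'.1.symm)) (h.2.right_unique h'.2)
  rel_definable r := r.2

variable (D) in
theorem isEmbedding_codingXet : MStr.IsEmbedding D.codingXet := MStr.isEmbedding_interpreted _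

end Aut

end Choices
end CoverFamily
end EtCov

/-- An automorphism that acts trivially on the image of a surjective interpretation is trivial. -/
theorem MStr.IsInterpretation.autHom_injective {N M : MStr.{u}} {c : MStr.Coding N.carrier M}
    (hc : MStr.IsInterpretation c) (hs : MStr.IsSurjection c) : Function.Injective hc.autHom := by
  rw [injective_iff_map_eq_one]
  intro σ hσ
  apply Subtype.ext
  funext s
  ext m
  obtain ⟨B, hB⟩ := hs s m
  refine hB σ.1 σ.2 fun x _ d hd => ?_
  have h := hc.induces_autHom σ d x.2 hd
  rwa [hσ] at h

namespace EtCov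

/-- An `F`-point of a scheme locally of finite type is fixed by the automorphisms of `F` that fix
the finitely many values of generators of the ring of an affine neighbourhood. -/
theorem exists_finset_fixing {k F : Type u} [Field k] [Field F] [Algebra k F] {Y : Scheme.{u}}
    (t : Y ⟶ Spec (.of k)) [LocallyOfFiniteType t] (y : Spec (.of F) ⟶ Y)
    (hy : y ≫ t = CoverFamily.base k F) :
    ∃ S : Finset F, ∀ σ : F ≃ₐ[k] F, (∀ v ∈ S, σ v = v) →
      Spec.map (CommRingCat.ofHom (σ : F →+* F)) ≫ y = y := by
  classical
  obtain ⟨_, ⟨V, hV, rfl⟩, hyV, -⟩ := Y.isBasis_affineOpens.exists_subset_of_mem_open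
    (Set.mem_univ (pt y)) isOpen_univ
  let ρ : Γ(Y, ⊤) →+* Γ(Y, V) := (Y.presheaf.map (homOfLE le_top).op).hom
  let f : k →+* Γ(Y, V) := ρ.comp (specHom t)
  have hf : f.FiniteType := by
    have h1 := t.finiteType_appLE (isAffineOpen_top (Spec (.of k))) hV le_top
    have h2 : Function.Surjective (Scheme.ΓSpecIso (.of k)).inv.hom :=
      (ConcreteCategory.bijective_of_isIso (Scheme.ΓSpecIso (.of k)).inv).2
    exact h1.comp (RingHom.FiniteType.of_surjective _ h2)
  let φ : Γ(Y, V) →+* F := (y.appLE V ⊤ (mem_of_pt_mem hyV) ≫ (Scheme.ΓSpecIso (.of F)).hom).hom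
  have hφ : ∀ r, RegVal y V r (φ r) := fun r => regVal_iff.mpr ⟨mem_of_pt_mem hyV, rfl⟩
  have hφf : ∀ c, φ (f c) = algebraMap k F c := by
    intro c
    have h := comp_eq_SpecMap_iff.mp hy c
    refine (hφ (f c)).unique ?_
    obtain ⟨h', h⟩ := h
    refine ⟨hyV, ?_⟩
    rw [← h]
    refine congrArg _ ?_
    exact congr($(Y.presheaf.germ_res (homOfLE le_top) (pt y) hyV).hom (specHom t c))
  let _ := f.toAlgebra
  obtain ⟨G, hG⟩ := (show Algebra.FiniteType k Γ(Y, V) from hf).out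
  refine ⟨G.image φ, fun σ hσ => (point_ext_of_isAffineOpen hV hyV fun r v hv => ?_).symm⟩
  have key : ∀ r, σ (φ r) = φ r := by
    intro r
    have hr : r ∈ Algebra.adjoin k (G : Set Γ(Y, V)) := hG ▸ trivial
    induction hr using Algebra.adjoin_induction with
    | mem x hx => exact hσ _ (Finset.mem_image_of_mem φ hx)
    | algebraMap c =>
      have : φ (algebraMap k Γ(Y, V) c) = algebraMap k F c := hφf c
      rw [this, σ.commutes]
    | add x y _ _ hx hy => rw [map_add, map_add, hx, hy]
    | mul x y _ _ hx hy => rw [map_mul, map_mul, hx, hy]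
  have := (hφ r).twist (σ : F →+* F)
  rw [hv.unique (hφ r), ← key r]
  exact this

namespace CoverFamily.Choices

variable {k F : Type u} [Field k] [Field F] [Algebra k F] {X : Scheme.{u}} [IsIntegral X]
  {s : X ⟶ Spec (.of k)} {C : CoverFamily F s} {D : C.Choices}
variable [CharZero k] [IsAlgClosure k F] [Smooth s] [GeometricallyConnected s]

/-- Intermediate endomorphisms of `X_{μ,α}` fix the generator of the constants, which has the value
`α` everywhere on `X_{μ,α}`. -/
theorem Inter.pullFF_a {i : C.Idx} (D : C.Choices) (d : C.Inter i i) :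
    pullFF d.φ (globFF (C.Y i.1) (C.a i.1)) = globFF (C.Y i.1) (C.a i.1) := by
  apply D.toKtilde_injective i
  refine D.eq_of_val (Filter.Eventually.frequently (Filter.Eventually.of_forall fun u =>
      ⟨i.2.1, ?_, ?_⟩))
  · have := ratVal_a (d.onPt (u.1 i))
    rw [Inter.toY_onPt] at this
    exact RatVal.val (this.pull _)
  · exact RatVal.val (ratVal_a _)

/-- An element of `p̃_{μ,α}` is determined by the function `b ∘ p`, since `b` generates the function
field over functions that are fixed by intermediate morphisms. -/
theorem bFun_injective (i : C.Idx) : Function.Injective (D.bFun (i := i)) := by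
  intro p q h
  apply P.ext_inter
  apply Inter.ext_pullFF
  have heq : Set.EqOn (pullFF p.inter.φ) (pullFF q.inter.φ)
      (Set.range (pullFF (C.π i.1)) ∪ {globFF (C.Y i.1) (C.a i.1), D.b i.1}) := by
    rintro x (⟨c, rfl⟩ | rfl | rfl)
    · exact (congr($(p.inter.pullFF_π) c)).trans (congr($(q.inter.pullFF_π) c)).symm
    · exact (Inter.pullFF_a D _).trans (Inter.pullFF_a D _).symm
    · exact h
  have := RingHom.eqOn_field_closure heq
  rw [D.b_generates] at this
  exact RingHom.ext fun x => this trivial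

theorem termFun_X_some {i : C.Idx} {N : Type*} (p : N → D.P i) (j : N) :
    D.termFun i p (MvPolynomial.X (some j)) = D.bFun (p j) :=
  MvPolynomial.eval₂Hom_X' _ _ _

/-! ### Surjectivity of the interpretations -/

/-- The class of the term `p`. -/
def termP {μ : C.ℳ} (p : Σ α : C.Zeros μ, D.P ⟨μ, α⟩) : Σ α : C.Zeros μ, D.PP ⟨μ, α⟩ :=
  ⟨p.1, D.term ⟨μ, p.1⟩ (MvPolynomial.X (some p.2))⟩

variable (D) in
/-- The class of the term `α`. -/
def termAlpha (i : C.Idx) : Σ α : C.Zeros i.1, D.PP ⟨i.1, α⟩ :=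
  ⟨i.2, D.term i (MvPolynomial.X none)⟩

section

variable {M : MStr.{u}} {e : C.ℳ → M.S} {ι : ∀ μ, (Σ α : C.Zeros μ, D.P ⟨μ, α⟩) → M.carrier (e μ)}

theorem rep_termP {μ : C.ℳ} (p : Σ α : C.Zeros μ, D.P ⟨μ, α⟩) :
    (D.termCoding M e ι).Rep (a := μ) ⟨⟨1, MvPolynomial.X (some 0)⟩, fun _ => ι μ p⟩ (termP p) :=
  ⟨one_pos, p.1, fun _ => p.2, fun _ => rfl, congrArg (Sigma.mk p.1) (congrArg (D.term _)
    (MvPolynomial.rename_X (Option.map fun _ : Fin 1 => p.2) (some 0)).symm)⟩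

/-- The element `p` can be recovered from the class of the term `p`. -/
theorem eq_of_rep_termP {μ : C.ℳ} {p : Σ α : C.Zeros μ, D.P ⟨μ, α⟩} {y : M.carrier (e μ)}
    (h : (D.termCoding M e ι).Rep (a := μ) ⟨⟨1, MvPolynomial.X (some 0)⟩, fun _ => y⟩ (termP p)) :
    y = ι μ p := by
  obtain ⟨-, β, q, hq, hx⟩ := h
  obtain ⟨α, p⟩ := p
  obtain rfl : α = β := congrArg Sigma.fst hx
  have h1 : D.term ⟨μ, α⟩ (MvPolynomial.X (some p)) =
      D.term ⟨μ, α⟩ (MvPolynomial.rename (Option.map q) (MvPolynomial.X (some (0 : Fin 1)))) :=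
    eq_of_heq (Sigma.mk.inj hx).2
  have h2 := (termFun_X_some _root_.id p).symm.trans <| (congrArg (D.termIso ⟨μ, α⟩) h1).trans <|
    (D.termFun_rename q _).trans (termFun_X_some q 0)
  obtain rfl : p = q 0 := bFun_injective _ h2
  exact hq 0

theorem rep_termAlpha (i : C.Idx) (p : D.P i) :
    (D.termCoding M e ι).Rep (a := i.1)
    ⟨⟨1, MvPolynomial.X none⟩, fun _ => ι i.1 ⟨i.2, p⟩⟩ (D.termAlpha i) :=
  ⟨one_pos, i.2, fun _ => p, fun _ => rfl, congrArg (Sigma.mk i.2) (congrArg (D.term i)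
    (MvPolynomial.rename_X (Option.map fun _ : Fin 1 => p) none).symm)⟩

theorem exists_of_rep_termAlpha {i : C.Idx} {y : M.carrier (e i.1)}
    (h : (D.termCoding M e ι).Rep (a := i.1)
    ⟨⟨1, MvPolynomial.X none⟩, fun _ => y⟩ (D.termAlpha i)) :
    ∃ q : D.P i, y = ι i.1 ⟨i.2, q⟩ := by
  obtain ⟨-, β, q, hq, hx⟩ := h
  obtain ⟨μ, α⟩ := i
  obtain rfl : α = β := congrArg Sigma.fst hx
  exact ⟨q 0, hq 0⟩

end

variable (D) in
theorem isBiinterpretation_codingPtilde : MStr.IsBiinterpretation D.codingPtilde where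
  isInterpretation := MStr.isInterpretation_of_extend
      (c := D.codingPtilde) D.isInterpretation_codingXet
  isEmbedding := MStr.isEmbedding_of_extend (c := D.codingPtilde) D.isEmbedding_codingXet
  isSurjection μ p := ⟨{⟨μ, termP p⟩}, fun _ _ h =>
    eq_of_rep_termP (M := D.ptilde) (e := fun μ => μ) (ι := fun _ x => x)
      (h ⟨μ, termP p⟩ (Finset.mem_singleton_self _) _ (rep_termP (M := D.ptilde) (e := fun μ => μ)
          (ι := fun _ x => x) p))⟩

/-- An element of `X̃^et_fin(F)` is definable over the image of the formal terms if it is fixed by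
all automorphisms that fix certain finitely many elements of `F`: these are polynomials in some `α`,
which are terms. -/
theorem surjection_of_finset (t : FinSort C.ℳ) (m : D.Xfin.carrier t) (S : Finset F)
    (hS : ∀ σ : D.Xet.Aut, (∀ v ∈ S, autF σ v = v) → σ.1 t.toCov m = m) :
    ∃ B : Finset (Σ a, D.PX.carrier a), ∀ σ ∈ D.Xfin.Aut,
      (∀ x ∈ B, ∀ d : D.codingXfin.Tup x.1, D.codingXfin.Rep d x.2 →
          D.codingXfin.Rep (D.codingXfin.move σ d) x.2) →
        σ t m = m := by
  classical
  obtain ⟨u⟩ := D.nonempty_U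
  obtain ⟨i0⟩ := C.nonempty_idx
  choose i q hq using fun v => C.exists_eval_zero (u.1 i0).toX (u.1 i0).toX_s v
  let p0 : ∀ v, D.P (i v) := fun v => (P.nonempty (i v)).some
  refine ⟨S.image fun v => ⟨(i v).1, D.termAlpha (i v)⟩, fun σ hσ h => ?_⟩
  obtain ⟨σ', hσ'⟩ := MStr.exists_lift_induced ⟨σ, hσ⟩
    (fun o : Option S => o.elim t fun v => FinSort.p (i v).1)
    (fun o => match o with
      | none => m
      | some v => (⟨(i v).2, p0 v⟩ : Σ α : C.Zeros (i v).1, D.P ⟨(i v).1, α⟩))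
  refine (hσ' none).symm.trans (hS σ' fun v hv => ?_)
  have h1 := h ⟨(i v).1, D.termAlpha (i v)⟩ (Finset.mem_image_of_mem _ hv) _
    (rep_termAlpha (M := D.Xfin) (e := FinSort.p) (ι := fun _ x => x) (i v) (p0 v))
  obtain ⟨p', hp'⟩ := exists_of_rep_termAlpha (M := D.Xfin) (e := FinSort.p) (ι := fun _ x => x)
      (i := i v)
    (y := σ (FinSort.p (i v).1) ⟨(i v).2, p0 v⟩) h1
  have h2 : autP σ' (i v).1 ⟨(i v).2, p0 v⟩ = ⟨(i v).2, p'⟩ := (hσ' (some ⟨v, hv⟩)).trans hp'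
  have h3 := fst_autP σ' ⟨(i v).2, p0 v⟩
  rw [h2] at h3
  have h4 : autF σ' (i v).2.1 = (i v).2.1 := h3.symm
  rw [← hq v]
  change (autF σ' : F →+* F) _ = _
  rw [Polynomial.hom_eval₂]
  congr 1
  ext c; exact (autF σ').commutes c

/-- A point of `X_{μ,α}(F)` is definable over finitely many elements of `F`. -/
theorem exists_finset_fixing_X {μ : C.ℳ} (z : Σ α : C.Zeros μ, C.Pt ⟨μ, α⟩) :
    ∃ S : Finset F, ∀ σ : D.Xet.Aut,
    (∀ v ∈ S, autF σ v = v) → autX σ μ z = z := by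
  have hz : z.2.toY ≫ C.π μ ≫ s = base k F := (Category.assoc _ _ _).symm.trans z.2.toX_s
  obtain ⟨S, hS⟩ := exists_finset_fixing (C.π μ ≫ s) z.2.toY hz
  exact ⟨S, fun σ h => sigma_pt_ext ((toY_autX σ z).trans (hS _ h))⟩

variable (D) in
theorem isBiinterpretation_codingXfin : MStr.IsBiinterpretation D.codingXfin where
  isInterpretation := MStr.isInterpretation_of_extend
      (c := D.codingXfin) D.isInterpretation_codingXet
  isEmbedding := MStr.isEmbedding_of_extend (c := D.codingXfin) D.isEmbedding_codingXet
  isSurjection := by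
    classical
    rintro (_ | μ | μ | μ) m
    · exact surjection_of_finset _ m {(m : F)} fun σ h => h _ (Finset.mem_singleton_self _)
    · exact ⟨{⟨μ, termP m⟩}, fun σ _ h =>
        eq_of_rep_termP (M := D.Xfin) (e := FinSort.p) (ι := fun _ x => x)
          (h ⟨μ, termP m⟩ (Finset.mem_singleton_self _) _ (rep_termP (M := D.Xfin) (e := FinSort.p)
              (ι := fun _ x => x) m))⟩
    · obtain ⟨S, hS⟩ := exists_finset_fixing_X (D := D) (μ := μ) m
      exact surjection_of_finset _ m S hS
    -- A deck transformation is determined by a point and its image.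
    · obtain ⟨α, g⟩ := (m : Σ α : C.Zeros μ, C.GDeck ⟨μ, α⟩)
      obtain ⟨z⟩ := C.nonempty_pt ⟨μ, α⟩
      obtain ⟨S, hS⟩ := exists_finset_fixing_X (D := D) (μ := μ) ⟨α, z⟩
      obtain ⟨S', hS'⟩ := exists_finset_fixing_X (D := D) (μ := μ) ⟨α, g.act z⟩
      refine surjection_of_finset _ _ (S ∪ S') fun σ h => ?_
      obtain ⟨β, g', z', h1, h2, h3⟩ := autX_deck σ g z
      rw [hS σ fun v hv => h v (Finset.mem_union_left _ hv)] at h2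
      rw [hS' σ fun v hv => h v (Finset.mem_union_right _ hv)] at h3
      obtain rfl : α = β := congrArg Sigma.fst h2
      obtain rfl : z = z' := eq_of_heq (Sigma.mk.inj h2).2
      obtain rfl : g = g' := GDeck.ext_of_point z (eq_of_heq (Sigma.mk.inj h3).2)
      exact h1

/-! ### The interpretation of `K̃` in the formal terms -/

/-- The action of automorphisms on `P_X` agrees with that on values. -/
theorem transports_image (σ : D.Xet.Aut) {μ : C.ℳ} (y : Σ α : C.Zeros μ, D.PP ⟨μ, α⟩) :
    Transports σ (toK y) (toK (D.isInterpretation_codingXet.image (a := μ) σ y)) := by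
  obtain ⟨d, hd⟩ := exists_rep y
  exact (transports_of_rep σ hd (D.isInterpretation_codingXet.rep_image σ hd)).2

theorem fst_image (σ : D.Xet.Aut) {μ : C.ℳ} (y : Σ α : C.Zeros μ, D.PP ⟨μ, α⟩) :
    (Sigma.fst (D.isInterpretation_codingXet.image (a := μ) σ y)).1 = autF σ y.1.1 := by
  obtain ⟨d, hd⟩ := exists_rep y
  exact (transports_of_rep σ hd (D.isInterpretation_codingXet.rep_image σ hd)).1

/-- An automorphism of `P_X` transports finitely many elements of `K̃` in the same way as
some automorphism of `X̃^et(F)`. -/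
theorem exists_transports (τ : D.PX.Aut) {ι : Type*} [Finite ι] (w : ι → C.ℳ)
    (t : ∀ i, Σ α : C.Zeros (w i), D.PP ⟨w i, α⟩) : ∃ σ : D.Xet.Aut, ∀ i,
      Transports σ (toK (t i)) (toK (τ.1 (w i) (t i))) ∧ (Sigma.fst (τ.1 (w i) (t i))).1 =
          autF σ (t i).1.1 := by
  obtain ⟨σ, hσ⟩ :=
    MStr.exists_lift_interpreted D.isInterpretation_codingXet D.isEmbedding_codingXet τ w t
  refine ⟨σ, fun i => ?_⟩
  rw [← hσ]
  exact ⟨transports_image σ (t i), fst_image σ (t i)⟩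

theorem exists_const_iff {x : D.Ktilde} {c : X.functionField} :
    (∃ i : C.Idx, x = D.toKtilde i (pullFF (C.π i.1) c)) ↔ x = D.coeff c := by
  constructor
  · rintro ⟨i, rfl⟩; exact (D.coeff_eq i c).symm
  · rintro rfl; exact ⟨_, D.coeff_eq C.nonempty_idx.some c⟩

theorem val_termAlpha (i : C.Idx) (u : D.U) : D.Val u (toK (D.termAlpha i)) i.2.1 := by
  have h : toK (D.termAlpha i) = D.toKtilde i (globFF (C.Y i.1) (C.a i.1)) :=
    congrArg (D.toKtilde i) (D.isCanonical_termIso.map_alpha i)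
  rw [h]
  exact RatVal.val (ratVal_a _)

variable (D) in
theorem isInterpretation_glue : MStr.IsInterpretation (D.glue D.termIso) where
  functional d x y hx hy := Eq.trans (b := toK (d.2 (0 : Fin 1))) hx (Eq.symm hy)
  surjective x := by
    obtain ⟨i, r, rfl⟩ := D.exists_toKtilde x
    exact ⟨⟨i.1, fun _ => ⟨i.2, (D.termIso i).symm r⟩⟩,
      congrArg (D.toKtilde i) ((D.termIso i).apply_symm_apply r).symm⟩
  dom_definable σ _ _ d _ := ⟨_, rfl⟩
  eqv_definable σ hσ a d d' x y y' hx hx' hy hy' := by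
    obtain ⟨σ', h⟩ := exists_transports ⟨σ, hσ⟩ (fun b : Bool => cond b d.1 d'.1)
        (fun b => match b with
      | true => d.2 (0 : Fin 1)
      | false => d'.2 (0 : Fin 1))
    have h1 := (h true).1
    have h2 := (h false).1
    exact (Eq.trans hy ((h1.eq_iff h2).mp (Eq.trans (Eq.symm hx) hx'))).trans (Eq.symm hy')
  rel_definable r σ hσ d x y hx hy := by
    obtain ⟨σ', h⟩ := exists_transports ⟨σ, hσ⟩ (fun i => (d i).1) (fun i => (d i).2 (0 : Fin 1))
    have h' : ∀ i, Transports (D := D) σ' (x i) (y i) := fun i => by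
      have e1 := hx i
      have e2 := hy i
      have := (h i).1
      exact e1 ▸ e2 ▸ this
    cases r with
    | add => exact ((h' (0 : Fin 3)).add (h' (1 : Fin 3))).eq_iff (h' (2 : Fin 3))
    | mul => exact ((h' (0 : Fin 3)).mul (h' (1 : Fin 3))).eq_iff (h' (2 : Fin 3))
    | const c =>
      exact exists_const_iff.trans (((h' (0 : Fin 1)).eq_iff
          (transports_coeff σ' c)).trans exists_const_iff.symm)

variable (D) in
/-- An element `y` of `P_{μ,α}` is determined by its image in `K̃` and by `α`, which is the value of
the image of the term `α`. -/
theorem isSurjection_glue : MStr.IsSurjection (D.glue D.termIso) := by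
  classical
  intro μ m
  let y : Σ α : C.Zeros μ, D.PP ⟨μ, α⟩ := m
  let z := D.termAlpha ⟨μ, y.1⟩
  refine ⟨{⟨PUnit.unit, toK y⟩, ⟨PUnit.unit, toK z⟩}, fun σ hσ h => ?_⟩
  have h1 : toK y = toK (D := D) (σ μ y) := h ⟨PUnit.unit, toK y⟩ (by simp) ⟨μ, fun _ => y⟩ rfl
  have h2 : toK z = toK (D := D) (σ μ z) := h ⟨PUnit.unit, toK z⟩ (by simp) ⟨μ, fun _ => z⟩ rfl
  obtain ⟨σ', h'⟩ := exists_transports ⟨σ, hσ⟩ (fun _ : Bool => μ) (fun b => cond b y z)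
  have h3 := (h' true).2
  have h4 := (h' false).1
  have h5 : autF σ' y.1.1 = y.1.1 := by
    have h4' : Transports σ' (toK z) (toK z) := by
      have : Transports σ' (toK z) (toK (D := D) (σ μ z)) := h4
      rwa [← h2] at this
    obtain ⟨u, v, hv, hv'⟩ := h4'.exists
    rw [← hv.unique (val_termAlpha ⟨μ, y.1⟩ u)]
    rw [hv'.unique (val_termAlpha ⟨μ, y.1⟩ _)]
    exact hv.unique (val_termAlpha ⟨μ, y.1⟩ u) |>.symm
  exact toK_inj (Subtype.ext (h3.trans h5)) h1.symm

end CoverFamily.Choices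
end EtCov

namespace EtCov.CoverFamily

variable {k F : Type u} [Field k] [Field F] [Algebra k F] {X : Scheme.{u}} [IsIntegral X]
  {s : X ⟶ Spec (.of k)} {C : CoverFamily F s} {D : C.Choices}
variable [CharZero k] [IsAlgClosure k F] [Smooth s] [GeometricallyConnected s]

/-! ### Automorphisms of `K̃` over the function field of `X` -/

namespace Choices

section

variable (T : D.Ktilde ≃+* D.Ktilde)

/-- The elements of a function field that an automorphism of `K̃` maps into another one. -/
def subfieldInto (i l : C.Idx) : Subfield (C.KK i) where
  __ := ((D.toKtilde l).range.comap ((T : D.Ktilde →+* D.Ktilde).comp (D.toKtilde i)))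
  inv_mem' r := by
    rintro ⟨x, hx⟩
    by_cases hr : r = 0
    · subst hr; exact ⟨0, by rw [inv_zero, map_zero, map_zero]⟩
    · have hx' : D.toKtilde l x = T (D.toKtilde i r) := hx
      have hx0 : x ≠ 0 := by
        rintro rfl
        rw [map_zero] at hx'
        refine hr (D.toKtilde_injective i ?_)
        rw [map_zero]
        exact T.injective (hx'.symm.trans (map_zero T).symm)
      refine ⟨x⁻¹, ?_⟩
      refine left_inv_eq_right_inv (a := D.toKtilde l x) ?_ ?_
      · rw [← map_mul, inv_mul_cancel₀ hx0, map_one]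
      · rw [hx']
        change T _ * T _ = 1
        rw [← map_mul, ← map_mul, mul_inv_cancel₀ hr, map_one, map_one]

theorem mem_subfieldInto {i l : C.Idx} {r : C.KK i} :
    r ∈ subfieldInto T i l ↔ ∃ x, D.toKtilde l x = T (D.toKtilde i r) := Iff.rfl

variable {T}

/-- An automorphism of `K̃` over the function field of `X` induces automorphisms of all the covers.
-/
theorem exists_iso_of_ringEquiv (hT : ∀ c, T (D.coeff c) = D.coeff c) (i : C.Idx) :
    ∃ ψ : C.Y i.1 ≅ C.Y i.1, ψ.hom ≫ C.π i.1 = C.π i.1 ∧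
      ∀ r, T (D.toKtilde i r) = D.toKtilde i (pullFF ψ.hom r) := by
  have : IsAlgClosed F := IsAlgClosure.isAlgClosed k
  have := isDirectedOrder_idx (C := C)
  -- The images of the generators of the function field of the cover lie in that of one cover `l`.
  obtain ⟨l1, x1, hx1⟩ := D.exists_toKtilde (T (D.toKtilde i (globFF (C.Y i.1) (C.a i.1))))
  obtain ⟨l2, x2, hx2⟩ := D.exists_toKtilde (T (D.toKtilde i (D.b i.1)))
  obtain ⟨l12, h1, h2⟩ := exists_ge_ge l1 l2
  obtain ⟨l, h12, hi⟩ := exists_ge_ge l12 i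
  have htop : subfieldInto T i l = ⊤ := by
    rw [eq_top_iff, ← D.b_generates, Subfield.closure_le]
    rintro _ (⟨c, rfl⟩ | rfl | rfl)
    · refine (mem_subfieldInto T).mpr ⟨pullFF (C.π l.1) c, ?_⟩
      rw [← D.coeff_eq, ← D.coeff_eq, hT]
    · exact (mem_subfieldInto T).mpr ⟨_, (D.toKtilde_trans (h1.trans h12) x1).trans hx1⟩
    · exact (mem_subfieldInto T).mpr ⟨_, (D.toKtilde_trans (h2.trans h12) x2).trans hx2⟩
  have hex : ∀ r, ∃ x, D.toKtilde l x = T (D.toKtilde i r) := fun r =>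
    (mem_subfieldInto T).mp (htop ▸ Subfield.mem_top r)
  choose f hf using hex
  let h : C.KK i →+* C.KK l :=
    { toFun := f
      map_one' := D.toKtilde_injective l (by simp only [hf, map_one])
      map_zero' := D.toKtilde_injective l (by simp only [hf, map_zero])
      map_add' := fun x y => D.toKtilde_injective l (by simp only [hf, map_add])
      map_mul' := fun x y => D.toKtilde_injective l (by simp only [hf, map_mul]) }
  obtain ⟨ψ, hψ, _, hh⟩ := Inter.exists_of_ringHom (D.mor l i hi) h (by
    ext c
    apply D.toKtilde_injective l
    refine (hf _).trans ?_
    rw [← D.coeff_eq, ← D.coeff_eq, hT])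
  refine ⟨ψ, hψ, fun r => ?_⟩
  rw [← hf]
  exact (congrArg (D.toKtilde l) congr($hh r)).trans (D.toKtilde_trans hi _)

end

/-! ### Constants in `K̃` -/

variable (D) in
/-- Every element of `F` is the constant value of an element of `K̃`: a polynomial in some `a`. -/
theorem exists_val_const (v : F) : ∃ x : D.Ktilde, ∀ u, D.Val u x v := by
  obtain ⟨u0⟩ := D.nonempty_U
  obtain ⟨i0⟩ := C.nonempty_idx
  obtain ⟨i, q, rfl⟩ := C.exists_eval_zero (u0.1 i0).toX (u0.1 i0).toX_s v
  have hc : ∀ (u : D.U) (c : k), RatVal (u.1 i).toY (globFF (C.Y i.1) (constants (C.π i.1 ≫ s) c))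
      (algebraMap k F c) := by
    intro u c
    refine ratVal_globFF (comp_eq_SpecMap_iff.mp ?_ c)
    exact ((comp_toConst_iff i _).mp (u.1 i).toY_toConst).1
  refine ⟨D.toKtilde i (q.eval₂ ((globFF (C.Y i.1)).comp (constants (C.π i.1 ≫ s)))
      (globFF (C.Y i.1) (C.a i.1))), fun u => ?_⟩
  apply RatVal.val
  induction q using Polynomial.induction_on' with
  | add p q hp hq =>
    rw [Polynomial.eval₂_add, Polynomial.eval₂_add]
    exact hp.add hq
  | monomial n c =>
    rw [Polynomial.eval₂_monomial, Polynomial.eval₂_monomial]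
    exact (hc u c).mul ((ratVal_a _).pow n)

theorem eq_of_val_const {x y : D.Ktilde} {v : F} (h : ∀ u, D.Val u x v) (h' : ∀ u, D.Val u y v) :
    x = y :=
  D.eq_of_val (Filter.Frequently.of_forall fun u => ⟨v, h u, h' u⟩)

variable (D) in
/-- The embedding of `F` as the field of constants of `K̃`. -/
def constK : F →+* D.Ktilde where
  toFun v := (D.exists_val_const v).choose
  map_one' := eq_of_val_const (D.exists_val_const 1).choose_spec D.val_one
  map_zero' := eq_of_val_const (D.exists_val_const 0).choose_spec D.val_zero
  map_add' v w := eq_of_val_const (D.exists_val_const _).choose_spec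
    fun u => ((D.exists_val_const v).choose_spec u).add ((D.exists_val_const w).choose_spec u)
  map_mul' v w := eq_of_val_const (D.exists_val_const _).choose_spec
    fun u => ((D.exists_val_const v).choose_spec u).mul ((D.exists_val_const w).choose_spec u)

theorem val_constK (u : D.U) (v : F) :
    D.Val u (D.constK v) v := (D.exists_val_const v).choose_spec u

theorem constK_algebraMap (c : k) :
    D.constK (algebraMap k F c) = D.coeff (globFF X (specHom s c)) := by
  obtain ⟨i⟩ := C.nonempty_idx
  refine eq_of_val_const (fun u => val_constK u _) fun u => D.val_coeff (i := i) ?_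
  exact ratVal_globFF (comp_eq_SpecMap_iff.mp (u.1 i).toX_s c)

/-- An automorphism of `K̃` over the function field of `X` acts on the constants through an
automorphism of `F`, since `F` is normal over `k`. -/
theorem exists_algEquiv_constK {T : D.Ktilde ≃+* D.Ktilde} (hT : ∀ c, T (D.coeff c) = D.coeff c) :
    ∃ σ : F ≃ₐ[k] F, ∀ v, T (D.constK v) = D.constK (σ v) := by
  have : Normal k F := IsAlgClosure.normal k F
  let _ : Field D.Ktilde := D.isField_Ktilde.toField
  let _ : Algebra F D.Ktilde := D.constK.toAlgebra
  let _ : Algebra k D.Ktilde := (D.constK.comp (algebraMap k F)).toAlgebra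
  have : IsScalarTower k F D.Ktilde := .of_algebraMap_eq fun _ => rfl
  let χ : D.Ktilde ≃ₐ[k] D.Ktilde := AlgEquiv.ofRingEquiv (f := T) fun c => by
    change T (D.constK (algebraMap k F c)) = D.constK (algebraMap k F c)
    rw [constK_algebraMap, hT]
  exact ⟨χ.restrictNormal F, fun v => (χ.restrictNormal_commutes F v).symm⟩

end Choices
end EtCov.CoverFamily

namespace EtCov

/-! ### Twisting points by automorphisms of `F` -/

section Twist

variable {k F : Type u} [Field k] [Field F] [Algebra k F] {Y : Scheme.{u}} (σ : F ≃ₐ[k] F)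

/-- The automorphism of `Spec F` given by an automorphism of `F`. -/
def specAut : Spec (.of F) ⟶ Spec (.of F) := Spec.map (CommRingCat.ofHom (σ : F →+* F))

theorem specAut_comp_symm : specAut σ ≫ specAut σ.symm = 𝟙 _ := by
  rw [specAut, specAut, ← Spec.map_comp, ← CommRingCat.ofHom_comp]
  refine (congrArg (fun f => Spec.map (CommRingCat.ofHom f))
      (RingHom.ext σ.apply_symm_apply)).trans (Spec.map_id _)

theorem specAut_symm_comp : specAut σ.symm ≫ specAut σ = 𝟙 _ := specAut_comp_symm σ.symm

theorem specAut_base : specAut σ ≫ CoverFamily.base k F = CoverFamily.base k F := by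
  rw [specAut, CoverFamily.base, ← Spec.map_comp, ← CommRingCat.ofHom_comp]
  exact congrArg (fun f => Spec.map (CommRingCat.ofHom f)) (RingHom.ext σ.commutes)

instance : Epi (specAut σ) where
  left_cancellation g h e := by
    have := congrArg (specAut σ.symm ≫ ·) e
    simpa only [← Category.assoc, specAut_symm_comp, Category.id_comp] using this

theorem regVal_specAut_iff {y : Spec (.of F) ⟶ Y} {V : Y.Opens} {r : Γ(Y, V)} {v : F} :
    RegVal (specAut σ ≫ y) V r (σ v) ↔ RegVal y V r v := by
  refine ⟨fun h => ?_, fun h => h.twist (σ : F →+* F)⟩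
  have := h.twist (σ.symm : F →+* F)
  change RegVal (specAut σ.symm ≫ specAut σ ≫ y) V r (σ.symm (σ v)) at this
  rwa [← Category.assoc, specAut_symm_comp, Category.id_comp, σ.symm_apply_apply] at this

end Twist

namespace CoverFamily

variable {k F : Type u} [Field k] [Field F] [Algebra k F] {X : Scheme.{u}} [IsIntegral X]
  {s : X ⟶ Spec (.of k)} {C : CoverFamily F s} {D : C.Choices}

/-- The action of automorphisms of `F` on the zeros of a polynomial over `k`. -/
def Zeros.map (σ : F ≃ₐ[k] F) {μ : C.ℳ} (α : C.Zeros μ) : C.Zeros μ :=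
  ⟨σ α.1, by
    have h : (σ : F →+* F).comp (algebraMap k F) = algebraMap k F := RingHom.ext σ.commutes
    have h' := Polynomial.hom_eval₂ (C.f μ) (algebraMap k F) (σ : F →+* F) α.1
    rw [h] at h'
    exact h'.symm.trans ((congrArg σ α.2).trans (map_zero σ))⟩

/-- An `F`-point of the cover over `k` at which `a` has the value `α` is a point of `X_{μ,α}(F)`. -/
theorem exists_pt_of_regVal {i : C.Idx} {y : Spec (.of F) ⟶ C.Y i.1}
    (hy : y ≫ C.π i.1 ≫ s = base k F) (ha : RegVal y ⊤ (C.a i.1) i.2.1) : ∃ z : C.Pt i, z.toY = y :=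
  ⟨Pt.mk' y ((comp_toConst_iff i y).mpr ⟨hy, ha⟩), Pt.toY_mk' _ _⟩

theorem exists_twist (σ : F ≃ₐ[k] F) {μ : C.ℳ} {α : C.Zeros μ} (z : C.Pt ⟨μ, α⟩) :
    ∃ z' : C.Pt ⟨μ, α.map σ⟩, z'.toY = specAut σ ≫ z.toY := by
  refine exists_pt_of_regVal (i := ⟨μ, α.map σ⟩) ?_ (z.regVal_a.twist (σ : F →+* F))
  rw [Category.assoc, ((comp_toConst_iff (C := C) _ _).mp z.toY_toConst).1, specAut_base]

/-- The action of automorphisms of `F` on points of covers. -/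
def twist (σ : F ≃ₐ[k] F) (μ : C.ℳ) (x : Σ α : C.Zeros μ, C.Pt ⟨μ, α⟩) :
    Σ α : C.Zeros μ, C.Pt ⟨μ, α⟩ :=
  ⟨x.1.map σ, (exists_twist σ x.2).choose⟩

theorem toY_twist (σ : F ≃ₐ[k] F) {μ : C.ℳ} (x : Σ α : C.Zeros μ, C.Pt ⟨μ, α⟩) :
    (twist σ μ x).2.toY = specAut σ ≫ x.2.toY := (exists_twist σ x.2).choose_spec

/-- The action of automorphisms of `F` on points of covers, as a permutation. -/
def twistEquiv (σ : F ≃ₐ[k] F) (μ : C.ℳ) : Equiv.Perm (Σ α : C.Zeros μ, C.Pt ⟨μ, α⟩) where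
  toFun := twist σ μ
  invFun := twist σ.symm μ
  left_inv x := sigma_pt_ext (by
    rw [toY_twist, toY_twist, ← Category.assoc, specAut_symm_comp, Category.id_comp])
  right_inv x := sigma_pt_ext (by
    rw [toY_twist, toY_twist, ← Category.assoc, specAut_comp_symm, Category.id_comp])

/-- The deck transformation is induced by the morphism `φ` of covers. The same `φ` may induce deck
transformations of `X_{μ,α}` for several `α`. -/
def GDeck.IsInducedBy {μ : C.ℳ} {α : C.Zeros μ} (g : C.GDeck ⟨μ, α⟩) (φ : C.Y μ ⟶ C.Y μ) : Prop :=
  φ ≫ C.π μ = C.π μ ∧ ∀ z, (g.act z).toY = z.toY ≫ φ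

end CoverFamily

namespace CoverFamily.Choices

variable {k F : Type u} [Field k] [Field F] [Algebra k F] {X : Scheme.{u}} [IsIntegral X]
  {s : X ⟶ Spec (.of k)} {C : CoverFamily F s} {D : C.Choices}

/-- The graph of a deck transformation in terms of the morphism of covers which induces it. -/
theorem rel_deck_iff {μ : C.ℳ} {g : Σ α : C.Zeros μ, C.GDeck ⟨μ, α⟩}
    {x y : Σ α : C.Zeros μ, C.Pt ⟨μ, α⟩}
    {φ : C.Y μ ⟶ C.Y μ} (h : g.2.IsInducedBy φ) :
    (∃ (α : C.Zeros μ) (g' : C.GDeck ⟨μ, α⟩) (x' : C.Pt ⟨μ, α⟩),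
      g = ⟨α, g'⟩ ∧ x = ⟨α, x'⟩ ∧ y = ⟨α, g'.act x'⟩) ↔ g.1.1 = x.1.1 ∧ y.2.toY = x.2.toY ≫ φ := by
  constructor
  · rintro ⟨α, g, x, rfl, rfl, rfl⟩
    exact ⟨rfl, h.2 x⟩
  · obtain ⟨α, g⟩ := g
    obtain ⟨β, x⟩ := x
    rintro ⟨h1, h2⟩
    obtain rfl : α = β := Subtype.ext h1
    exact ⟨α, g, x, rfl, rfl, sigma_pt_ext (h2.trans (h.2 x).symm)⟩

variable [CharZero k] [IsAlgClosure k F] [Smooth s] [GeometricallyConnected s]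

/-- The action of a deck transformation on `p̃_{μ,α}` in terms of the morphism of covers which
induces it. -/
theorem rel_act_iff {μ : C.ℳ} {g : Σ α : C.Zeros μ, C.GDeck ⟨μ, α⟩}
    {p q : Σ α : C.Zeros μ, D.P ⟨μ, α⟩}
    {φ : C.Y μ ⟶ C.Y μ} (h : g.2.IsInducedBy φ) :
    (∃ (α : C.Zeros μ) (g' : C.GDeck ⟨μ, α⟩) (p' q' : D.P ⟨μ, α⟩),
      g = ⟨α, g'⟩ ∧ p = ⟨α, p'⟩ ∧ q = ⟨α, q'⟩ ∧ ∀ u, q'.1 u = g'.act (p'.1 u)) ↔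
    g.1.1 = p.1.1 ∧ ∀ u, (q.2.1 u).toY = (p.2.1 u).toY ≫ φ := by
  constructor
  · rintro ⟨α, g, p, q, rfl, rfl, rfl, hq⟩
    exact ⟨rfl, fun u => (congrArg Pt.toY (hq u)).trans (h.2 _)⟩
  · obtain ⟨α, g⟩ := g
    obtain ⟨β, p⟩ := p
    obtain ⟨γ, q⟩ := q
    rintro ⟨h1, h2⟩
    obtain rfl : α = β := Subtype.ext h1
    have h3 : ∀ u, (⟨γ, q.1 u⟩ : Σ α : C.Zeros μ, C.Pt ⟨μ, α⟩) = ⟨α, g.act (p.1 u)⟩ :=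
      fun u => sigma_pt_ext ((h2 u).trans (h.2 _).symm)
    obtain ⟨u⟩ := D.nonempty_U
    obtain rfl : γ = α := congrArg Sigma.fst (h3 u)
    exact ⟨γ, g, p, q, rfl, rfl, rfl, fun u => eq_of_heq (Sigma.mk.inj (h3 u)).2⟩

theorem rel_phi_iff {μ : C.ℳ} {p : Σ α : C.Zeros μ, D.P ⟨μ, α⟩} {u : D.U}
    {x : Σ α : C.Zeros μ, C.Pt ⟨μ, α⟩} :
    x = ⟨p.1, p.2.1 u⟩ ↔ x.2.toY = (p.2.1 u).toY :=
  ⟨fun h => by rw [h], fun h => sigma_pt_ext h⟩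

/-- The family of permutations of the sorts of `X̃^et(F)` that consists of an automorphism of `F`,
its action on points, and given permutations of the other sorts. -/
def permFamily (σ : F ≃ₐ[k] F) (fU : Equiv.Perm D.U)
    (fP : ∀ μ, Equiv.Perm (Σ α : C.Zeros μ, D.P ⟨μ, α⟩))
    (fG : ∀ μ, Equiv.Perm (Σ α : C.Zeros μ, C.GDeck ⟨μ, α⟩)) : ∀ t, Equiv.Perm (D.Xet.carrier t)
  | .U => fU
  | .F => σ.toEquiv
  | .p μ => fP μ
  | .X μ => twistEquiv σ μ
  | .G μ => fG μ

/-- Permutations of the sorts of `X̃^et(F)` which act compatibly with an automorphism of `F` and the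
morphisms of covers form an automorphism. -/
theorem permFamily_mem_aut {σ : F ≃ₐ[k] F} {fU : Equiv.Perm D.U}
    {fP : ∀ μ, Equiv.Perm (Σ α : C.Zeros μ, D.P ⟨μ, α⟩)}
    {fG : ∀ μ, Equiv.Perm (Σ α : C.Zeros μ, C.GDeck ⟨μ, α⟩)}
    (hP : ∀ (μ : C.ℳ) (p : Σ α : C.Zeros μ, D.P ⟨μ, α⟩) (u : D.U),
      ((fP μ p).2.1 (fU u)).toY = specAut σ ≫ (p.2.1 u).toY)
    (hG : ∀ (μ : C.ℳ) (g : Σ α : C.Zeros μ, C.GDeck ⟨μ, α⟩), (fG μ g).1.1 = σ g.1.1 ∧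
      ∃ φ, g.2.IsInducedBy φ ∧ (fG μ g).2.IsInducedBy φ) : permFamily σ fU fP fG ∈ D.Xet.Aut := by
  have hPa : ∀ (μ : C.ℳ) (p : Σ α : C.Zeros μ, D.P ⟨μ, α⟩), (fP μ p).1.1 = σ p.1.1 := by
    intro μ p
    obtain ⟨u⟩ := D.nonempty_U
    have h1 := ((fP μ p).2.1 (fU u)).regVal_a
    rw [hP] at h1
    exact h1.unique ((p.2.1 u).regVal_a.twist (σ : F →+* F))
  rintro (_ | _ | c | ⟨μ, V, r⟩ | μ | μ | μ | μ) t
  · let x : F := t (0 : Fin 3)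
    let y : F := t (1 : Fin 3)
    let z : F := t (2 : Fin 3)
    change x + y = z ↔ σ x + σ y = σ z
    rw [← map_add, σ.injective.eq_iff]
  · let x : F := t (0 : Fin 3)
    let y : F := t (1 : Fin 3)
    let z : F := t (2 : Fin 3)
    change x * y = z ↔ σ x * σ y = σ z
    rw [← map_mul, σ.injective.eq_iff]
  · let x : F := t (0 : Fin 1)
    change x = algebraMap k F c ↔ σ x = algebraMap k F c
    rw [← σ.commutes c, σ.injective.eq_iff, σ.commutes c]
  · let x : Σ α : C.Zeros μ, C.Pt ⟨μ, α⟩ := t (0 : Fin 2)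
    let v : F := t (1 : Fin 2)
    change RegVal x.2.toY V r v ↔ RegVal (twist σ μ x).2.toY V r (σ v)
    rw [toY_twist]
    exact (regVal_specAut_iff σ).symm
  · let g : Σ α : C.Zeros μ, C.GDeck ⟨μ, α⟩ := t (0 : Fin 3)
    let x : Σ α : C.Zeros μ, C.Pt ⟨μ, α⟩ := t (1 : Fin 3)
    let y : Σ α : C.Zeros μ, C.Pt ⟨μ, α⟩ := t (2 : Fin 3)
    obtain ⟨hg, φ, h1, h2⟩ := hG μ g
    refine (rel_deck_iff (x := x) (y := y) h1).trans
      (Iff.trans ?_ (rel_deck_iff (x := twist σ μ x) (y := twist σ μ y) h2).symm)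
    rw [hg, toY_twist, toY_twist, Category.assoc, cancel_epi]
    exact and_congr_left' σ.injective.eq_iff.symm
  · let p : Σ α : C.Zeros μ, D.P ⟨μ, α⟩ := t (0 : Fin 2)
    let v : F := t (1 : Fin 2)
    change p.1.1 = v ↔ (fP μ p).1.1 = σ v
    rw [hPa]; exact σ.injective.eq_iff.symm
  · let g : Σ α : C.Zeros μ, C.GDeck ⟨μ, α⟩ := t (0 : Fin 3)
    let p : Σ α : C.Zeros μ, D.P ⟨μ, α⟩ := t (1 : Fin 3)
    let q : Σ α : C.Zeros μ, D.P ⟨μ, α⟩ := t (2 : Fin 3)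
    obtain ⟨hg, φ, h1, h2⟩ := hG μ g
    refine (rel_act_iff (p := p) (q := q) h1).trans
      (Iff.trans ?_ (rel_act_iff (p := fP μ p) (q := fP μ q) h2).symm)
    refine and_congr ?_ (Iff.trans ?_ fU.surjective.forall.symm)
    · rw [hg, hPa, σ.injective.eq_iff]
    · refine forall_congr' fun u => ?_
      rw [hP, hP, Category.assoc, cancel_epi]
  · let p : Σ α : C.Zeros μ, D.P ⟨μ, α⟩ := t (0 : Fin 3)
    let u : D.U := t (1 : Fin 3)
    let x : Σ α : C.Zeros μ, C.Pt ⟨μ, α⟩ := t (2 : Fin 3)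
    refine (rel_phi_iff (p := p) (u := u) (x := x)).trans
      (Iff.trans ?_ (rel_phi_iff (p := fP μ p) (u := fU u) (x := twist σ μ x)).symm)
    rw [hP, toY_twist, cancel_epi]

end CoverFamily.Choices
end EtCov

namespace EtCov.CoverFamily

variable {k F : Type u} [Field k] [Field F] [Algebra k F] {X : Scheme.{u}} [IsIntegral X]
  {s : X ⟶ Spec (.of k)} {C : CoverFamily F s} {D : C.Choices}
variable [CharZero k] [IsAlgClosure k F] [Smooth s] [GeometricallyConnected s]

/-! ### The action of automorphisms of `F` on deck transformations -/

theorem GDeck.IsInducedBy.unique {μ : C.ℳ} {α : C.Zeros μ} {g : C.GDeck ⟨μ, α⟩}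
    {φ φ' : C.Y μ ⟶ C.Y μ}
    (h : g.IsInducedBy φ) (h' : g.IsInducedBy φ') : φ = φ' := by
  obtain ⟨z⟩ := C.nonempty_pt ⟨μ, α⟩
  exact hom_ext_of_point (C.π μ) (h.1.trans h'.1.symm) z.toY ((h.2 z).symm.trans (h'.2 z))

/-- A deck transformation is determined by `α` and the inducing morphism of covers. -/
theorem GDeck.sigma_ext {μ : C.ℳ} {g g' : Σ α : C.Zeros μ, C.GDeck ⟨μ, α⟩} (h : g.1.1 = g'.1.1)
    {φ : C.Y μ ⟶ C.Y μ} (h1 : g.2.IsInducedBy φ) (h2 : g'.2.IsInducedBy φ) : g = g' := by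
  obtain ⟨α, g⟩ := g
  obtain ⟨β, g'⟩ := g'
  obtain rfl : α = β := Subtype.ext h
  obtain ⟨z⟩ := C.nonempty_pt ⟨μ, α⟩
  exact congrArg (Sigma.mk α) (GDeck.ext_of_point z (Pt.ext_toY ((h1.2 z).trans (h2.2 z).symm)))

/-- Conjugates of deck transformations under automorphisms of `F` are induced by the same morphism
of covers. -/
theorem GDeck.exists_twist (σ : F ≃ₐ[k] F) {μ : C.ℳ} (g : Σ α : C.Zeros μ, C.GDeck ⟨μ, α⟩) :
    ∃ g' : Σ α : C.Zeros μ, C.GDeck ⟨μ, α⟩, g'.1.1 = σ g.1.1 ∧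
      ∃ φ, g.2.IsInducedBy φ ∧ g'.2.IsInducedBy φ := by
  obtain ⟨α, g⟩ := g
  obtain ⟨d, hd⟩ := g.exists_inter
  have hg : g.IsInducedBy d.φ := ⟨d.comm, fun z =>
    (congrArg Pt.toY (hd z)).symm.trans (Inter.toY_onPt d z)⟩
  obtain ⟨z⟩ := C.nonempty_pt ⟨μ, α⟩
  let d' : C.Inter ⟨μ, α.map σ⟩ ⟨μ, α.map σ⟩ := Inter.ofPoint d.φ d.comm
    (twist σ μ ⟨α, z⟩).2 (twist σ μ ⟨α, g.act z⟩).2 <|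
      (congrArg (· ≫ d.φ) (toY_twist σ ⟨α, z⟩)).trans <| (Category.assoc _ _ _).trans <|
        (congrArg (specAut σ ≫ ·) (hg.2 z).symm).trans (toY_twist σ ⟨α, g.act z⟩).symm
  obtain ⟨g', hg'⟩ := d'.exists_gdeck
  exact ⟨⟨α.map σ, g'⟩, rfl, d.φ, hg, d.comm, fun z =>
    (congrArg Pt.toY (hg' z)).trans (Inter.toY_onPt d' z)⟩

/-- The action of automorphisms of `F` on deck transformations. -/
def twistGDeck (σ : F ≃ₐ[k] F) (μ : C.ℳ) (g : Σ α : C.Zeros μ, C.GDeck ⟨μ, α⟩) :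
    Σ α : C.Zeros μ, C.GDeck ⟨μ, α⟩ := (GDeck.exists_twist σ g).choose

theorem twistGDeck_spec (σ : F ≃ₐ[k] F) {μ : C.ℳ} (g : Σ α : C.Zeros μ, C.GDeck ⟨μ, α⟩) :
    (twistGDeck σ μ g).1.1 = σ g.1.1 ∧ ∃ φ, g.2.IsInducedBy φ ∧
    (twistGDeck σ μ g).2.IsInducedBy φ :=
  (GDeck.exists_twist σ g).choose_spec

theorem twistGDeck_twistGDeck {σ τ : F ≃ₐ[k] F} (h : ∀ v, τ (σ v) = v) {μ : C.ℳ}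
    (g : Σ α : C.Zeros μ, C.GDeck ⟨μ, α⟩) : twistGDeck τ μ (twistGDeck σ μ g) = g := by
  obtain ⟨h1, φ, h2, h3⟩ := twistGDeck_spec σ g
  obtain ⟨h4, φ', h5, h6⟩ := twistGDeck_spec τ (twistGDeck σ μ g)
  obtain rfl : φ' = φ := h5.unique h3
  exact GDeck.sigma_ext (by rw [h4, h1, h]) h6 h2

/-- The action of automorphisms of `F` on deck transformations, as a permutation. -/
def twistGDeckEquiv (σ : F ≃ₐ[k] F) (μ : C.ℳ) : Equiv.Perm (Σ α : C.Zeros μ, C.GDeck ⟨μ, α⟩) where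
  toFun := twistGDeck σ μ
  invFun := twistGDeck σ.symm μ
  left_inv := twistGDeck_twistGDeck σ.symm_apply_apply
  right_inv := twistGDeck_twistGDeck σ.apply_symm_apply

theorem pullFF_iso_hom_inv {Y : Scheme.{u}} [IsIntegral Y] (e : Y ≅ Y) (r : Y.functionField) :
    pullFF e.hom (pullFF e.inv r) = r := by
  have h : IsDominant (e.hom ≫ e.inv) := inferInstance
  have h1 := pullFF_comp e.inv e.hom h
  have ht := e.hom_inv_id
  generalize e.hom ≫ e.inv = t at h h1 ht
  subst ht
  exact (congr($h1 r)).symm.trans (congr($(pullFF_id h) r))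

namespace Choices

/-! ### Lifting automorphisms of `K̃` -/

/-- An element of `p̃_μ` is determined by its value at one point. -/
theorem P.sigma_ext {μ : C.ℳ} {p q : Σ α : C.Zeros μ, D.P ⟨μ, α⟩} (u : D.U)
    (h : (p.2.1 u).toY = (q.2.1 u).toY) : p = q := by
  obtain ⟨α, p⟩ := p
  obtain ⟨β, q⟩ := q
  have h' : (⟨α, p.1 u⟩ : Σ α : C.Zeros μ, C.Pt ⟨μ, α⟩) = ⟨β, q.1 u⟩ := sigma_pt_ext h
  obtain rfl : α = β := congrArg Sigma.fst h'
  exact congrArg (Sigma.mk α) (P.ext_inter (Inter.ext_of_point (u.1 ⟨μ, α⟩)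
    ((p.apply_eq u).symm.trans ((Pt.ext_toY h).trans (q.apply_eq u)))))

variable (D) in
/-- Components of the points of `U` on the same cover for different `α` are related by one
isomorphism of the cover, the same for all points of `U`. -/
theorem exists_inter_onPt {i j : C.Idx} (h : i.1 = j.1) :
    ∃ χ : C.Inter i j, ∀ u : D.U, χ.onPt (u.1 i) = u.1 j := by
  obtain ⟨u0⟩ := D.nonempty_U
  have := isDirectedOrder_idx (C := C)
  obtain ⟨χ, hχ⟩ := exists_iso_of_toX_eq h (u0.1 i) (u0.1 j) (D.U_toX u0 i j)
  obtain ⟨l, hi, hj⟩ := exists_ge_ge i j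
  have : (D.mor l i hi).comp χ = D.mor l j hj :=
    Inter.ext_of_point (u0.1 l) (by rw [Inter.onPt_comp, u0.2, hχ, u0.2])
  exact ⟨χ, fun u => by rw [← u.2 l i hi, ← Inter.onPt_comp, this, u.2]⟩

variable (D) in
/-- Automorphisms of the covers which are compatible with the distinguished morphisms and act on the
constants as `σ⁻¹`, so that their composites with the action of `σ` map `X_{μ,α}(F)` to itself. -/
structure CoverAut (σ : F ≃ₐ[k] F) where
  /-- the automorphisms of the covers -/
  iso : ∀ i : C.Idx, C.Y i.1 ≅ C.Y i.1
  comm : ∀ i, (iso i).hom ≫ C.π i.1 = C.π i.1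
  compat : ∀ i j h, (iso i).hom ≫ (D.mor i j h).φ = (D.mor i j h).φ ≫ (iso j).hom
  val : ∀ (u : D.U) i, RegVal ((u.1 i).toY ≫ (iso i).hom) ⊤ (C.a i.1) (σ.symm i.2.1)
  val_inv : ∀ (u : D.U) i, RegVal ((u.1 i).toY ≫ (iso i).inv) ⊤ (C.a i.1) (σ i.2.1)

namespace CoverAut

variable {σ : F ≃ₐ[k] F} (A : CoverAut D σ)

theorem comm_inv (i : C.Idx) : (A.iso i).inv ≫ C.π i.1 = C.π i.1 := by
  rw [Iso.inv_comp_eq, A.comm]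

/-- The inverse automorphisms. -/
def symm : CoverAut D σ.symm where
  iso i := (A.iso i).symm
  comm := A.comm_inv
  compat i j h := by
    rw [Iso.symm_hom, Iso.symm_hom, Iso.inv_comp_eq, ← Category.assoc, A.compat, Category.assoc,
        Iso.hom_inv_id,
      Category.comp_id]
  val := A.val_inv
  val_inv := A.val

/-- The point with components `σ(ψ_i(u_i))`, for `ψ_i` the given automorphisms of the covers. -/
theorem exists_mapU (u : D.U) : ∃ u' : D.U, ∀ i, (u'.1 i).toY =
    specAut σ ≫ (u.1 i).toY ≫ (A.iso i).hom := by
  have hex : ∀ i, ∃ z : C.Pt i, z.toY = specAut σ ≫ (u.1 i).toY ≫ (A.iso i).hom := by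
    intro i
    refine exists_pt_of_regVal ?_ ?_
    · rw [Category.assoc, Category.assoc, reassoc_of% A.comm i,
        ((comp_toConst_iff i _).mp (u.1 i).toY_toConst).1, specAut_base]
    · have := (A.val u i).twist (σ : F →+* F)
      change RegVal _ _ _ (σ (σ.symm _)) at this
      rwa [σ.apply_symm_apply] at this
  choose z hz using hex
  refine ⟨⟨z, fun i j h => Pt.ext_toY ?_⟩, hz⟩
  rw [Inter.toY_onPt, hz, hz, ← u.2 i j h, Inter.toY_onPt]
  simp only [Category.assoc, A.compat]

/-- The action on the universal cover. -/
def mapU (u : D.U) : D.U := (A.exists_mapU u).choose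

theorem toY_mapU (u : D.U) (i : C.Idx) :
    ((A.mapU u).1 i).toY = specAut σ ≫ (u.1 i).toY ≫ (A.iso i).hom :=
  (A.exists_mapU u).choose_spec i

/-- The action on the universal cover, as a permutation. -/
def equivU : Equiv.Perm D.U where
  toFun := A.mapU
  invFun := A.symm.mapU
  left_inv u := Subtype.ext (funext fun i => Pt.ext_toY (by
    rw [toY_mapU, toY_mapU]
    simp only [symm, Iso.symm_hom, Category.assoc, Iso.hom_inv_id, Category.comp_id]
    rw [← Category.assoc, specAut_symm_comp, Category.id_comp]))
  right_inv u := Subtype.ext (funext fun i => Pt.ext_toY (by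
    rw [toY_mapU, toY_mapU]
    simp only [symm, Iso.symm_hom, Category.assoc, Iso.inv_hom_id, Category.comp_id]
    rw [← Category.assoc, specAut_comp_symm, Category.id_comp]))

theorem comp_iso_cancel {V W Y Y' Z : Scheme.{u}} (t : V ⟶ W) (y : W ⟶ Y) (e : Y ≅ Y) (f : Y ⟶ Y')
    (g : Y' ⟶ Z) :
    (t ≫ y ≫ e.hom) ≫ e.inv ≫ f ≫ g = t ≫ (y ≫ f) ≫ g := by
  simp only [Category.assoc, Iso.hom_inv_id_assoc]

/-- The projection `p`, conjugated by `σ` and the action on the universal cover, is again of the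
form `g ∘ 𝐩_{μ,β}`, with `β = σ α`. -/
theorem exists_mapP {μ : C.ℳ} (p : Σ α : C.Zeros μ, D.P ⟨μ, α⟩) :
    ∃ p' : Σ α : C.Zeros μ, D.P ⟨μ, α⟩,
    ∀ u, (p'.2.1 (A.equivU u)).toY = specAut σ ≫ (p.2.1 u).toY := by
  obtain ⟨α, p⟩ := p
  let i : C.Idx := ⟨μ, α⟩
  let j : C.Idx := ⟨μ, α.map σ⟩
  obtain ⟨χ, hχ⟩ := D.exists_inter_onPt (i := j) (j := i) rfl
  let ψ : C.Y μ ⟶ C.Y μ := (A.iso j).inv ≫ χ.φ ≫ p.inter.φ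
  have key : ∀ u : D.U, ((A.mapU u).1 j).toY ≫ ψ = specAut σ ≫ (p.1 u).toY := fun u => calc
    ((A.mapU u).1 j).toY ≫ ψ = (specAut σ ≫ (u.1 j).toY ≫ (A.iso j).hom) ≫ ψ :=
      congrArg (· ≫ ψ) (A.toY_mapU u j)
    _ = specAut σ ≫ ((u.1 j).toY ≫ χ.φ) ≫ p.inter.φ := comp_iso_cancel _ _ _ _ _
    _ = specAut σ ≫ (u.1 i).toY ≫ p.inter.φ := congrArg (fun y => specAut σ ≫ y ≫ p.inter.φ)
      ((Inter.toY_onPt χ _).symm.trans (congrArg Pt.toY (hχ u)))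
    _ = specAut σ ≫ (p.1 u).toY := congrArg (specAut σ ≫ ·)
      ((congrArg Pt.toY (p.apply_eq u)).trans (Inter.toY_onPt _ _)).symm
  have hψ : ψ ≫ C.π μ = C.π μ := by
    refine (Category.assoc _ _ _).trans ((congrArg ((A.iso j).inv ≫ ·) ?_).trans (A.comm_inv j))
    exact (Category.assoc _ _ _).trans ((congrArg (χ.φ ≫ ·) p.inter.comm).trans χ.comm)
  obtain ⟨u0⟩ := D.nonempty_U
  let d : C.Inter j j := Inter.ofPoint ψ hψ ((A.mapU u0).1 j)
    (twist σ μ ⟨α, p.1 u0⟩).2 ((key u0).trans (toY_twist σ ⟨α, p.1 u0⟩).symm)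
  refine ⟨⟨α.map σ, P.ofInter D d⟩, fun u => ?_⟩
  exact (Inter.toY_onPt d ((A.mapU u).1 j)).trans (key u)

/-- The action on `p̃_μ`. -/
def mapP (μ : C.ℳ) (p : Σ α : C.Zeros μ, D.P ⟨μ, α⟩) :
    Σ α : C.Zeros μ, D.P ⟨μ, α⟩ := (A.exists_mapP p).choose

theorem toY_mapP {μ : C.ℳ} (p : Σ α : C.Zeros μ, D.P ⟨μ, α⟩) (u : D.U) :
    ((A.mapP μ p).2.1 (A.equivU u)).toY = specAut σ ≫ (p.2.1 u).toY :=
    (A.exists_mapP p).choose_spec u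

theorem toY_symm_mapP {μ : C.ℳ} (p : Σ α : C.Zeros μ, D.P ⟨μ, α⟩) (u : D.U) :
    ((A.symm.mapP μ p).2.1 u).toY = specAut σ.symm ≫ (p.2.1 (A.equivU u)).toY := by
  have := A.symm.toY_mapP p (A.equivU u)
  rwa [show A.symm.equivU (A.equivU u) = u from A.equivU.symm_apply_apply u] at this

/-- The action on `p̃_μ`, as a permutation. -/
def equivP (μ : C.ℳ) : Equiv.Perm (Σ α : C.Zeros μ, D.P ⟨μ, α⟩) where
  toFun := A.mapP μ
  invFun := A.symm.mapP μ
  left_inv p := P.sigma_ext D.nonempty_U.some (by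
    rw [toY_symm_mapP, toY_mapP, ← Category.assoc, specAut_symm_comp, Category.id_comp])
  right_inv p := P.sigma_ext (A.equivU D.nonempty_U.some) (by
    rw [toY_mapP, toY_symm_mapP, ← Category.assoc, specAut_comp_symm, Category.id_comp])

/-- The automorphism of `X̃^et(F)` given by automorphisms of `F` and of the covers. -/
def toAut : D.Xet.Aut :=
  ⟨permFamily σ A.equivU A.equivP (twistGDeckEquiv σ),
      permFamily_mem_aut (fun _ p u => A.toY_mapP p u)
    fun _ g => twistGDeck_spec σ g⟩

/-- The action on rational functions of the automorphism given by automorphisms of `F` and of the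
covers. -/
theorem transports_toAut (i : C.Idx) (r : C.KK i) :
    Transports A.toAut (D.toKtilde i r) (D.toKtilde i (pullFF (A.iso i).inv r)) := by
  filter_upwards [D.eventually_ratVal i r] with u hu
  obtain ⟨v, hv⟩ := hu _ rfl
  refine ⟨v, RatVal.val hv, RatVal.val ?_⟩
  have h : RatVal (((u.1 i).toY ≫ (A.iso i).hom) ≫ (A.iso i).inv) r v := hv.congr_point (by simp)
  exact ((h.pull (A.iso i).inv).twist (σ : F →+* F)).congr_point (A.toY_mapU u i).symm

end CoverAut

/-- If an automorphism of `K̃` acts on constants as `σ` and on the function field of a cover through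
`ψ`, then `a` has the value `σ α` at the images under `ψ` of points of `X_{μ,α}`. -/
theorem regVal_a_of_iso {T : D.Ktilde ≃+* D.Ktilde} {σ : F ≃ₐ[k] F}
    (hσ : ∀ v, T (D.constK v) = D.constK (σ v))
    {i : C.Idx} {ψ : C.Y i.1 ≅ C.Y i.1}
    (hψ : ∀ r, T (D.toKtilde i r) = D.toKtilde i (pullFF ψ.hom r)) (u : D.U) :
    RegVal ((u.1 i).toY ≫ ψ.hom) ⊤ (C.a i.1) (σ i.2.1) := by
  obtain ⟨w, hw⟩ := exists_regVal (y := (u.1 i).toY ≫ ψ.hom) (V := ⊤) trivial (C.a i.1)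
  have h1 : D.Val u (T (D.toKtilde i (globFF (C.Y i.1) (C.a i.1)))) w := by
    rw [hψ]; exact RatVal.val ((ratVal_globFF hw).pull _)
  have h2 : D.toKtilde i (globFF (C.Y i.1) (C.a i.1)) = D.constK i.2.1 :=
    eq_of_val_const (fun u => RatVal.val (ratVal_a _)) fun u => val_constK u _
  rw [h2, hσ] at h1
  rwa [h1.unique (val_constK u _)] at hw

/-- Each automorphism of `K̃` over the function field of `X` is induced by an automorphism
of `X̃^et(F)`. -/
theorem exists_aut_of_ringEquiv {T : D.Ktilde ≃+* D.Ktilde} (hT : ∀ c, T (D.coeff c) = D.coeff c) :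
    ∃ σ : D.Xet.Aut, ∀ x, Transports σ x (T x) := by
  obtain ⟨σ, hσ⟩ := exists_algEquiv_constK hT
  -- On points, the inverse of the action on functions is needed.
  have hT' : ∀ c, T.symm (D.coeff c) = D.coeff c := fun c => by rw [RingEquiv.symm_apply_eq, hT]
  have hσ' : ∀ v, T.symm (D.constK v) = D.constK (σ.symm v) := fun v => by
    rw [RingEquiv.symm_apply_eq, hσ, σ.apply_symm_apply]
  choose ψ hπ hψ using fun i => exists_iso_of_ringEquiv hT' i
  have hψ' : ∀ i r, T (D.toKtilde i r) = D.toKtilde i (pullFF (ψ i).symm.hom r) := by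
    intro i r
    rw [← RingEquiv.eq_symm_apply, hψ]
    exact congrArg (D.toKtilde i) (pullFF_iso_hom_inv (ψ i) r).symm
  let A : CoverAut D σ :=
    { iso := ψ
      comm := hπ
      compat := fun i j h => by
        have : IsDominant ((ψ i).hom ≫ (D.mor i j h).φ) := inferInstance
        have : IsDominant ((D.mor i j h).φ ≫ (ψ j).hom) := inferInstance
        refine hom_ext_pullFF ?_ ?_
        · rw [Category.assoc, Category.assoc, (D.mor i j h).comm, hπ, hπ, (D.mor i j h).comm]
        · rw [pullFF_comp _ _ inferInstance, pullFF_comp _ _ inferInstance]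
          ext r
          apply D.toKtilde_injective i
          refine (hψ i _).symm.trans ?_
          refine (congrArg T.symm (D.toKtilde_trans h r)).trans ?_
          exact (hψ j r).trans (D.toKtilde_trans h _).symm
      val := fun u i => regVal_a_of_iso hσ' (hψ i) u
      val_inv := fun u i => regVal_a_of_iso hσ (hψ' i) u }
  refine ⟨A.toAut, fun x => ?_⟩
  obtain ⟨i, r, rfl⟩ := D.exists_toKtilde x
  rw [hψ']
  exact A.transports_toAut i r

end Choices
end EtCov.CoverFamily

namespace EtCov.CoverFamily.Choices

variable {k F : Type u} [Field k] [Field F] [Algebra k F] {X : Scheme.{u}} [IsIntegral X]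
  {s : X ⟶ Spec (.of k)} {C : CoverFamily F s} {D : C.Choices}
variable [CharZero k] [IsAlgClosure k F] [Smooth s] [GeometricallyConnected s]

/-! ### The automorphism groups -/

variable (D) in
/-- A triple as a tuple of elements of `K̃`. -/
def tripleK (x y z : D.Ktilde) (r : KRel X) (h : D.KStr.len r = 3) :
    ∀ i, D.KStr.carrier (D.KStr.srt r i) :=
  fun i => (![x, y, z] : Fin 3 → D.Ktilde) (i.cast h)

/-- The field automorphism given by an automorphism of `K̃` as a structure. -/
def ringEquivK (τ : D.KStr.Aut) : D.Ktilde ≃+* D.Ktilde :=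
  { (τ.1 PUnit.unit : Equiv.Perm D.Ktilde) with
    map_add' := fun x y => ((τ.2 KRel.add (D.tripleK x y (x + y) .add rfl)).mp rfl).symm
    map_mul' := fun x y => ((τ.2 KRel.mul (D.tripleK x y (x * y) .mul rfl)).mp rfl).symm }

theorem ringEquivK_coeff (τ : D.KStr.Aut) (c : X.functionField) :
    ringEquivK τ (D.coeff c) = D.coeff c :=
  exists_const_iff.mp ((τ.2 (KRel.const c) (fun _ => D.coeff c)).mp (exists_const_iff.mpr rfl))

/-- Each automorphism of `K̃` is induced by an automorphism of `X̃^et(F)`. -/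
theorem exists_aut_of_autK (τ : D.KStr.Aut) :
    ∃ σ : D.Xet.Aut, ∀ x : D.Ktilde, Transports σ x (τ.1 PUnit.unit x) :=
  exists_aut_of_ringEquiv (ringEquivK_coeff τ)

variable (D) in
/-- The homomorphism from the automorphisms of `X̃^et(F)` to those of `P_X`. -/
def autPX : D.Xet.Aut →* D.PX.Aut := D.isInterpretation_codingXet.autHom

theorem transports_autPX (σ : D.Xet.Aut) {μ : C.ℳ} (y : Σ α : C.Zeros μ, D.PP ⟨μ, α⟩) :
    Transports σ (toK y) (toK (D := D) ((D.autPX σ).1 μ y)) := transports_image σ y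

variable (D) in
/-- A relation on `K̃` that is definable in `P_X` is invariant under the automorphisms of
`X̃^et(F)`, which induce all automorphisms of `K̃` over the function field of `X`. -/
theorem isEmbedding_glue : MStr.IsEmbedding (D.glue D.termIso) := by
  intro n w R hR τ hτ t
  obtain ⟨σ, hσ⟩ := exists_aut_of_autK ⟨τ, hτ⟩
  choose d hd using fun i => D.isInterpretation_glue.surjective (t i)
  refine hR (D.autPX σ).1 (D.autPX σ).2 d t _ hd fun i => ?_
  have h1 : t i = toK (D := D) ((d i).2 (0 : Fin 1)) := hd i
  have h2 := transports_autPX σ ((d i).2 (0 : Fin 1))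
  have h3 := hσ (t i)
  rw [h1] at h3
  refine Eq.trans ?_ (h3.right_unique h2)
  exact congrArg (τ PUnit.unit) h1

variable (D) in
/-- An automorphism of `P_X` acts on `K̃`, and is determined by this action; the latter is induced
by an automorphism of `X̃^et(F)`. -/
theorem autPX_surjective : Function.Surjective D.autPX := by
  intro τ
  obtain ⟨σ, hσ⟩ := exists_aut_of_autK (D.isInterpretation_glue.autHom τ)
  refine ⟨σ, D.isInterpretation_glue.autHom_injective D.isSurjection_glue ?_⟩
  apply Subtype.ext
  funext ⟨⟩
  ext x
  obtain ⟨d, hd⟩ := D.isInterpretation_glue.surjective x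
  have h1 := D.isInterpretation_glue.induces_autHom (D.autPX σ) d x hd
  have h2 := transports_autPX σ (d.2 (0 : Fin 1))
  have h3 := hσ x
  have hd' : x = toK (D := D) (d.2 (0 : Fin 1)) := hd
  rw [← hd'] at h2
  exact Eq.trans h1 (h2.right_unique h3)

variable (D) in
theorem induces_autPX (σ : D.Xet.Aut) :
    MStr.Induces D.codingXfin (D.Xet.restrict FinSort.toCov σ) (D.autPX σ) := by
  intro μ d x hd
  exact D.isInterpretation_codingXet.induces_autHom σ d x hd

variable (D) in
/-- An automorphism of `X̃^et(F)` that fixes `P_X` fixes `X̃^et_fin(F)`, and then the points of `U`,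
which are determined by their projections. -/
theorem autPX_injective : Function.Injective D.autPX := by
  rw [injective_iff_map_eq_one]
  intro σ hσ
  have hfin : ∀ t m, (D.Xet.restrict FinSort.toCov σ).1 t m = m := by
    intro t m
    obtain ⟨B, hB⟩ := (D.isBiinterpretation_codingXfin).isSurjection t m
    refine hB _ (D.Xet.restrict FinSort.toCov σ).2 fun x _ d hd => ?_
    have h := D.induces_autPX σ d x.2 hd
    rwa [hσ] at h
  have hU : ∀ u, autU σ u = u := by
    refine fun u => Subtype.ext (funext fun i => ?_)
    let p : Σ α : C.Zeros i.1, D.P ⟨i.1, α⟩ := ⟨i.2, P.ofInter D (Inter.id i)⟩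
    have h1 : autP σ i.1 p = p := hfin (FinSort.p i.1) p
    have h2 := autX_apply σ p u
    rw [h1] at h2
    have h3 : autX σ i.1 ⟨p.1, p.2.1 u⟩ = ⟨p.1, p.2.1 u⟩ := hfin (FinSort.X i.1) _
    rw [h3] at h2
    have h4 : p.2.1 u = p.2.1 (autU σ u) := eq_of_heq (Sigma.mk.inj h2).2
    exact ((Inter.onPt_id _).symm.trans h4.symm).trans (Inter.onPt_id _)
  apply Subtype.ext
  funext t
  ext m
  cases t with
  | U => exact hU m
  | F => exact hfin .F m
  | p μ => exact hfin (.p μ) m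
  | X μ => exact hfin (.X μ) m
  | G μ => exact hfin (.G μ) m

variable (D) in
/-- The automorphism groups of `X̃^et(F)` and of `P_X` are isomorphic. -/
def autEquiv : D.Xet.Aut ≃* D.PX.Aut :=
    MulEquiv.ofBijective D.autPX ⟨D.autPX_injective, D.autPX_surjective⟩

end EtCov.CoverFamily.Choices

end

theorem theorem6p9 {k F : Type u} [Field k] [CharZero k] [Field F] [Algebra k F]
    [IsAlgClosure k F] {X : Scheme.{u}} [IsIntegral X] (s : X ⟶ Spec (.of k))
    [Smooth s] [IsSeparated s] [QuasiCompact s] [GeometricallyConnected s]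
    (C : EtCov.CoverFamily F s) (D : C.Choices) :
    (IsField D.Ktilde ∧ ∃ φ : ∀ i : C.Idx, D.PP i ≃+* C.KK i,
      D.IsCanonical φ ∧ MStr.IsBiinterpretation (D.glue φ)) ∧
    MStr.IsBiinterpretation D.codingPtilde ∧
    MStr.IsBiinterpretation D.codingXfin ∧
    ∃ Θ : D.PX.Aut ≃* D.Xet.Aut, ∀ τ : D.PX.Aut,
      MStr.Induces D.codingXfin (D.Xet.restrict EtCov.FinSort.toCov (Θ τ)) τ := by
  refine ⟨⟨D.isField_Ktilde, D.termIso, D.isCanonical_termIso,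
    D.isInterpretation_glue, D.isEmbedding_glue, D.isSurjection_glue⟩,
    D.isBiinterpretation_codingPtilde, D.isBiinterpretation_codingXfin, D.autEquiv.symm,
    fun τ _ d x hd => ?_⟩
  have h := D.induces_autPX (D.autEquiv.symm τ) d x hd
  rwa [show D.autPX (D.autEquiv.symm τ) = τ from D.autEquiv.apply_symm_apply τ] at h
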